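/- **Theorem 5.1.** Let $\Bbbk$ be a field and let $n\ge 1$ be an integer, $\mathbf n=\{1,\dots,n\}$. *Notation.* $\mathcal A_n$ is the 2-category with one object $\mathtt i$, whose 1-morphisms are the permutations $\sigma\in S_n$ (composed as permutations) and whose 2-morphisms $\sigma\to\tau$ are the binary relations $\alpha\subseteq\sigma\cap\tau$ on $\mathbf n$ (permutations being identified with their graphs); vertical composition is intersection of relations, horizontal composition is composition of relations, and the identity 2-morphism of $\sigma$ is $\sigma$. $IS_n$ is the symmetric inverse monoid of all bijections between subsets of $\mathbf n$ under composition of partial maps, ordered by inclusion of graphs. $\mathcal S_{IS_n}$ is the 2-category with one object whose 1-morphisms are the elements of $IS_n$, composed by multiplication, with exactly one 2-morphism $s\to t$ if $s\subseteq t$ and none otherwise. For a 2-category $\mathcal C$ with finitely many 2-morphisms, $\Bbbk\mathcal C$ is obtained from $\mathcal C$ by replacing the sets of 2-morphisms by the free $\Bbbk$-vector spaces on them, then replacing every category of 1-morphisms by its additive envelope (formal finite direct sums, matrices of morphisms), and then by its idempotent completion, with all compositions induced. $\overline{\Bbbk\mathcal C}$ has as objects the pairs $\mathtt i^{(\varepsilon)}$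 of an object $\mathtt i$ of $\Bbbk\mathcal C$ and a primitive idempotent $\varepsilon$ of the commutative algebra $\mathrm{End}(\mathbb 1_{\mathtt i})$; 1-morphisms $\mathtt i^{(\varepsilon)}\to\mathtt j^{(\delta)}$ are the 1-morphisms $\mathtt i\to\mathtt j$ of $\Bbbk\mathcal C$; the 2-morphisms $\mathrm F\to\mathrm G$ are the elements of $\delta\circ_0\mathrm{Hom}_{\Bbbk\mathcal C}(\mathrm F,\mathrm G)\circ_0\varepsilon$; the identity 1-morphism of $\mathtt i^{(\varepsilon)}$ is $\mathbb 1_{\mathtt i}$; the composite of $\mathrm F:\mathtt i^{(\varepsilon)}\to\mathtt j^{(\delta)}$ and $\mathrm G:\mathtt j^{(\delta)}\to\mathtt l^{(\zeta)}$ is the direct summand of $\mathrm G\mathrm F$ cut out by the idempotent $\mathrm{id}_{\mathrm G}\circ_0\delta\circ_0\mathrm{id}_{\mathrm F}$; compositions of 2-morphisms are induced. For a 2-category $\mathcal C$ with additive categories of 1-morphisms and biadditive composition, the Grothendieck decategorification is $A_{\mathcal C}=\bigoplus_{\mathtt i,\mathtt j}[\mathcal C(\mathtt i,\mathtt j)]_\oplus$,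 the direct sum of the split Grothendieck groups over all pairs of objects, with product $[\mathrm G][\mathrm F]=[\mathrm G\mathrm F]$ if $\mathrm F$ and $\mathrm G$ are composable and $0$ otherwise. For $\sigma\in IS_n$ put $\underline{\sigma}=\sum_{\rho\subseteq\sigma}(-1)^{|\sigma\setminus\rho|}\rho\in\mathbb Z[IS_n]$ (the Möbius basis). For $X\subseteq\mathbf n$ put $\varepsilon^{(X)}=\sum_{Y\subseteq X}(-1)^{|X|-|Y|}\,\mathrm{id}_Y\in\mathrm{End}_{\Bbbk\mathcal A_n}(\mathbb 1_{\mathtt i})$, where $\mathrm{id}_Y=\{(y,y):y\in Y\}$. *Claim.* There are ring isomorphisms $$A_{\overline{\Bbbk\mathcal A_n}}\;\cong\;\mathbb Z[IS_n]\;\cong\;A_{\Bbbk\mathcal S_{IS_n}}.$$ More precisely: 1. The $\varepsilon^{(X)}$, $X\subseteq\mathbf n$, are primitive idempotents, and $X\mapsto\mathtt i^{(X)}:=\mathtt i^{(\varepsilon^{(X)})}$ is a bijection from the subsets of $\mathbf n$ onto the objects of $\overline{\Bbbk\mathcal A_n}$. There is a ring isomorphism $\varphi:A_{\overline{\Bbbk\mathcal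 A_n}}\to\mathbb Z[IS_n]$ such that, whenever $X,Y\subseteq\mathbf n$ and $\sigma\in S_n$ with $\sigma(X)=Y$, the 1-morphism $\sigma:\mathtt i^{(X)}\to\mathtt i^{(Y)}$ is indecomposable and $\varphi([\sigma])=\underline{\sigma|_X}$. If also $\tau(X)=Y$ with $\tau\in S_n$, then $\sigma$ and $\tau$ are isomorphic as 1-morphisms $\mathtt i^{(X)}\to\mathtt i^{(Y)}$ if and only if $\sigma|_X=\tau|_X$; and every indecomposable 1-morphism $\mathtt i^{(X)}\to\mathtt i^{(Y)}$ is isomorphic to some $\sigma\in S_n$ with $\sigma(X)=Y$. 2. There is a ring isomorphism $\psi:A_{\Bbbk\mathcal S_{IS_n}}\to\mathbb Z[IS_n]$ such that, for every $s\in IS_n$, the 1-morphism $s$ is indecomposable and $\psi([s])=s$; every indecomposable 1-morphism of $\Bbbk\mathcal S_{IS_n}$ is isomorphic to some $s\in IS_n$. -/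

import Mathlib

open CategoryTheory CategoryTheory.Limits

noncomputable section

namespace Decat

universe w v u

/-! ### Bicategories presented by horizontal composition -/

section HComp

open Bicategory

/-- Data and axioms of a bicategory, presented through the horizontal composition
`hcomp` of 2-morphisms (vertical composition is composition in the categories `a ⟶ b`). -/
structure HCompData (B : Type u) [CategoryStruct.{v} B] [∀ a b : B, Category.{w} (a ⟶ b)] where
  hcomp : ∀ {a b c : B} {f f' : a ⟶ b} {g g' : b ⟶ c}, (f ⟶ f') → (g ⟶ g') → (f ≫ g ⟶ f' ≫ g')
  assoc : ∀ {a b c d : B} (f : a ⟶ b) (g : b ⟶ c) (h : c ⟶ d), (f ≫ g) ≫ h ≅ f ≫ g ≫ h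
  left : ∀ {a b : B} (f : a ⟶ b), 𝟙 a ≫ f ≅ f
  right : ∀ {a b : B} (f : a ⟶ b), f ≫ 𝟙 b ≅ f
  hcomp_id : ∀ {a b c : B} (f : a ⟶ b) (g : b ⟶ c), hcomp (𝟙 f) (𝟙 g) = 𝟙 (f ≫ g)
  interchange : ∀ {a b c : B} {f f' f'' : a ⟶ b} {g g' g'' : b ⟶ c}
    (η : f ⟶ f') (η' : f' ⟶ f'') (θ : g ⟶ g') (θ' : g' ⟶ g''),
    hcomp (η ≫ η') (θ ≫ θ') = hcomp η θ ≫ hcomp η' θ'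
  assoc_nat : ∀ {a b c d : B} {f f' : a ⟶ b} {g g' : b ⟶ c} {h h' : c ⟶ d}
    (η : f ⟶ f') (θ : g ⟶ g') (ζ : h ⟶ h'),
    hcomp (hcomp η θ) ζ ≫ (assoc f' g' h').hom = (assoc f g h).hom ≫ hcomp η (hcomp θ ζ)
  left_nat : ∀ {a b : B} {f f' : a ⟶ b} (η : f ⟶ f'),
    hcomp (𝟙 (𝟙 a)) η ≫ (left f').hom = (left f).hom ≫ η
  right_nat : ∀ {a b : B} {f f' : a ⟶ b} (η : f ⟶ f'),
    hcomp η (𝟙 (𝟙 b)) ≫ (right f').hom = (right f).hom ≫ η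
  pentagon : ∀ {a b c d e : B} (f : a ⟶ b) (g : b ⟶ c) (h : c ⟶ d) (i : d ⟶ e),
    hcomp (assoc f g h).hom (𝟙 i) ≫ (assoc f (g ≫ h) i).hom ≫ hcomp (𝟙 f) (assoc g h i).hom =
      (assoc (f ≫ g) h i).hom ≫ (assoc f g (h ≫ i)).hom
  triangle : ∀ {a b c : B} (f : a ⟶ b) (g : b ⟶ c),
    (assoc f (𝟙 b) g).hom ≫ hcomp (𝟙 f) (left g).hom = hcomp (right f).hom (𝟙 g)

/-- The bicategory with the given horizontal composition; whiskering is horizontal composition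
with an identity 2-morphism. -/
abbrev HCompData.toBicategory {B : Type u} [CategoryStruct.{v} B]
    [I : ∀ a b : B, Category.{w} (a ⟶ b)] (H : HCompData B) : Bicategory B where
  homCategory := I
  whiskerLeft f _ _ η := H.hcomp (𝟙 f) η
  whiskerRight η h := H.hcomp η (𝟙 h)
  associator := H.assoc
  leftUnitor := H.left
  rightUnitor := H.right
  whiskerLeft_id := H.hcomp_id
  whiskerLeft_comp f _ _ _ η θ := by rw [← H.interchange, Category.id_comp]
  id_whiskerLeft η := by rw [← Category.assoc, ← H.left_nat]; simp
  comp_whiskerLeft f g _ _ η := by rw [← Category.assoc, ← H.assoc_nat, H.hcomp_id]; simp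
  id_whiskerRight := H.hcomp_id
  comp_whiskerRight η θ i := by rw [← H.interchange, Category.id_comp]
  whiskerRight_id η := by rw [← Category.assoc, ← H.right_nat]; simp
  whiskerRight_comp η g h := by rw [H.assoc_nat, H.hcomp_id]; simp
  whisker_assoc f _ _ η h := by rw [← Category.assoc, ← H.assoc_nat]; simp
  whisker_exchange η θ := by simp [← H.interchange]
  pentagon := H.pentagon
  triangle := H.triangle

variable {B : Type u} [Bicategory.{w, v} B]

/-- Horizontal composition of 2-morphisms in a bicategory. -/
def hcomp {a b c : B} {f f' : a ⟶ b} {g g' : b ⟶ c} (η : f ⟶ f') (θ : g ⟶ g') :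
    f ≫ g ⟶ f' ≫ g' :=
  η ▷ g ≫ f' ◁ θ

theorem hcomp_id {a b c : B} (f : a ⟶ b) (g : b ⟶ c) : hcomp (𝟙 f) (𝟙 g) = 𝟙 (f ≫ g) := by
  simp [hcomp]

theorem interchange {a b c : B} {f f' f'' : a ⟶ b} {g g' g'' : b ⟶ c}
    (η : f ⟶ f') (η' : f' ⟶ f'') (θ : g ⟶ g') (θ' : g' ⟶ g'') :
    hcomp (η ≫ η') (θ ≫ θ') = hcomp η θ ≫ hcomp η' θ' := by
  simp only [hcomp, comp_whiskerRight, whiskerLeft_comp, Category.assoc]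
  rw [← whisker_exchange_assoc]

theorem assoc_nat {a b c d : B} {f f' : a ⟶ b} {g g' : b ⟶ c} {h h' : c ⟶ d}
    (η : f ⟶ f') (θ : g ⟶ g') (ζ : h ⟶ h') :
    hcomp (hcomp η θ) ζ ≫ (α_ f' g' h').hom = (α_ f g h).hom ≫ hcomp η (hcomp θ ζ) := by
  simp [hcomp]

theorem left_nat {a b : B} {f f' : a ⟶ b} (η : f ⟶ f') :
    hcomp (𝟙 (𝟙 a)) η ≫ (λ_ f').hom = (λ_ f).hom ≫ η := by
  simp [hcomp]

theorem right_nat {a b : B} {f f' : a ⟶ b} (η : f ⟶ f') :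
    hcomp η (𝟙 (𝟙 b)) ≫ (ρ_ f').hom = (ρ_ f).hom ≫ η := by
  simp [hcomp]

theorem pentagon {a b c d e : B} (f : a ⟶ b) (g : b ⟶ c) (h : c ⟶ d) (i : d ⟶ e) :
    hcomp (α_ f g h).hom (𝟙 i) ≫ (α_ f (g ≫ h) i).hom ≫ hcomp (𝟙 f) (α_ g h i).hom =
      (α_ (f ≫ g) h i).hom ≫ (α_ f g (h ≫ i)).hom := by
  simp [hcomp]

theorem triangle {a b c : B} (f : a ⟶ b) (g : b ⟶ c) :
    (α_ f (𝟙 b) g).hom ≫ hcomp (𝟙 f) (λ_ g).hom = hcomp (ρ_ f).hom (𝟙 g) := by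
  simp [hcomp]

end HComp

/-- A bicategory whose categories of 1-morphisms are preadditive, with biadditive horizontal
composition. -/
class LocallyPreadditive (B : Type u) [Bicategory.{w, v} B] where
  preadditive : ∀ a b : B, Preadditive (a ⟶ b)
  hcomp_add : ∀ {a b c : B} {f f' : a ⟶ b} {g g' : b ⟶ c} (η : f ⟶ f') (θ θ' : g ⟶ g'),
    hcomp η (θ + θ') = hcomp η θ + hcomp η θ'
  add_hcomp : ∀ {a b c : B} {f f' : a ⟶ b} {g g' : b ⟶ c} (η η' : f ⟶ f') (θ : g ⟶ g'),
    hcomp (η + η') θ = hcomp η θ + hcomp η' θ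

attribute [reducible, instance] LocallyPreadditive.preadditive

section

variable {B : Type u} [Bicategory.{w, v} B] [LocallyPreadditive B]

theorem hcomp_zero {a b c : B} {f f' : a ⟶ b} {g g' : b ⟶ c} (η : f ⟶ f') :
    hcomp η (0 : g ⟶ g') = 0 :=
  (AddMonoidHom.mk' (fun θ : g ⟶ g' => hcomp η θ) (LocallyPreadditive.hcomp_add η)).map_zero

theorem zero_hcomp {a b c : B} {f f' : a ⟶ b} {g g' : b ⟶ c} (θ : g ⟶ g') :
    hcomp (0 : f ⟶ f') θ = 0 :=
  (AddMonoidHom.mk' (fun η : f ⟶ f' => hcomp η θ)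
    (fun η η' => LocallyPreadditive.add_hcomp η η' θ)).map_zero

theorem sum_hcomp_sum {a b c : B} {f f' : a ⟶ b} {g g' : b ⟶ c} {I J : Type*} (s : Finset I)
    (t : Finset J) (η : I → (f ⟶ f')) (θ : J → (g ⟶ g')) :
    hcomp (∑ i ∈ s, η i) (∑ j ∈ t, θ j) = ∑ i ∈ s, ∑ j ∈ t, hcomp (η i) (θ j) := by
  have h1 := map_sum (AddMonoidHom.mk' (fun η : f ⟶ f' => hcomp η (∑ j ∈ t, θ j))
    (fun η η' => LocallyPreadditive.add_hcomp η η' _)) η s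
  refine h1.trans (Finset.sum_congr rfl fun i _ => ?_)
  exact map_sum (AddMonoidHom.mk' (fun θ : g ⟶ g' => hcomp (η i) θ)
    (LocallyPreadditive.hcomp_add (η i))) θ t

end

/-! ### Linearization of the categories of 1-morphisms -/

section Lin

open Bicategory

universe uk

/-- The bicategory obtained from `B` by replacing the sets of 2-morphisms by the `k`-modules
of formal linear combinations (`Free k`), all compositions being extended bilinearly. -/
structure Lin (k : Type uk) (B : Type u) where
  obj : B

namespace Lin

/-- The bilinear extension of a map of sets to formal linear combinations. -/
def bilin {k X Y Z : Type*} [CommRing k] (m : X → Y → Z) (p : X →₀ k) (q : Y →₀ k) : Z →₀ k :=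
  p.sum fun x r => q.sum fun y s => Finsupp.single (m x y) (r * s)

theorem bilin_single {k X Y Z : Type*} [CommRing k] (m : X → Y → Z) (x : X) (y : Y) (r s : k) :
    bilin m (Finsupp.single x r) (Finsupp.single y s) = Finsupp.single (m x y) (r * s) := by
  simp [bilin]

theorem bilin_add {k X Y Z : Type*} [CommRing k] (m : X → Y → Z) (p : X →₀ k) (q q' : Y →₀ k) :
    bilin m p (q + q') = bilin m p q + bilin m p q' := by
  unfold bilin
  rw [← Finsupp.sum_add]
  exact Finsupp.sum_congr fun x _ => Finsupp.sum_add_index' (by simp) (by simp [mul_add])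

theorem add_bilin {k X Y Z : Type*} [CommRing k] (m : X → Y → Z) (p p' : X →₀ k) (q : Y →₀ k) :
    bilin m (p + p') q = bilin m p q + bilin m p' q := by
  exact Finsupp.sum_add_index' (by simp) (by simp [add_mul])

variable {k : Type uk} [CommRing k] {B : Type u} [Bicategory.{w, v} B]

instance : Quiver (Lin k B) where
  Hom a b := Free k (a.obj ⟶ b.obj)

/-- The 1-morphism of `B` underlying a 1-morphism of `Lin k B`. -/
def un {a b : Lin k B} (f : a ⟶ b) : a.obj ⟶ b.obj := f

instance : CategoryStruct (Lin k B) where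
  id a := Free.of k (𝟙 a.obj)
  comp f g := Free.of k (un f ≫ un g)

instance (a b : Lin k B) : Category (a ⟶ b) := inferInstanceAs (Category (Free k (a.obj ⟶ b.obj)))

instance (a b : Lin k B) : Preadditive (a ⟶ b) :=
  inferInstanceAs (Preadditive (Free k (a.obj ⟶ b.obj)))

/-- A 1-morphism of `B` as a 1-morphism of `Lin k B`. -/
def mor1 {a b : B} (f : a ⟶ b) : (⟨a⟩ : Lin k B) ⟶ ⟨b⟩ := Free.of k f

/-- The scalar multiple `r • η` of a 2-morphism of `B`. -/
def sg {a b : Lin k B} {f g : a ⟶ b} (η : un f ⟶ un g) (r : k) : f ⟶ g := Finsupp.single η r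

/-- Bilinear extension of horizontal composition. -/
def hc {a b c : Lin k B} {f f' : a ⟶ b} {g g' : b ⟶ c} (η : f ⟶ f') (θ : g ⟶ g') :
    f ≫ g ⟶ f' ≫ g' :=
  bilin (fun (x : un f ⟶ un f') (y : un g ⟶ un g') => hcomp x y) η θ

theorem sg_comp {a b : Lin k B} {f g h : a ⟶ b} (η : un f ⟶ un g) (θ : un g ⟶ un h) (r s : k) :
    (sg η r : f ⟶ g) ≫ (sg θ s : g ⟶ h) = sg (η ≫ θ) (r * s) :=
  Free.single_comp_single _ _ η θ r s

theorem hc_sg {a b c : Lin k B} {f f' : a ⟶ b} {g g' : b ⟶ c} (η : un f ⟶ un f')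
    (θ : un g ⟶ un g') (r s : k) :
    hc (sg η r : f ⟶ f') (sg θ s : g ⟶ g') = sg (hcomp η θ) (r * s) := by
  exact bilin_single _ _ _ _ _

theorem id_eq {a b : Lin k B} (f : a ⟶ b) : 𝟙 f = sg (𝟙 (un f)) 1 := rfl

theorem hc_add {a b c : Lin k B} {f f' : a ⟶ b} {g g' : b ⟶ c} (η : f ⟶ f') (θ θ' : g ⟶ g') :
    hc η (θ + θ') = hc η θ + hc η θ' := by
  exact bilin_add _ _ _ _

theorem add_hc {a b c : Lin k B} {f f' : a ⟶ b} {g g' : b ⟶ c} (η η' : f ⟶ f') (θ : g ⟶ g') :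
    hc (η + η') θ = hc η θ + hc η' θ := by
  exact add_bilin _ _ _ _

theorem hc_zero {a b c : Lin k B} {f f' : a ⟶ b} {g g' : b ⟶ c} (η : f ⟶ f') :
    hc η (0 : g ⟶ g') = 0 :=
  (AddMonoidHom.mk' (fun θ : g ⟶ g' => hc η θ) (hc_add η)).map_zero

theorem zero_hc {a b c : Lin k B} {f f' : a ⟶ b} {g g' : b ⟶ c} (θ : g ⟶ g') :
    hc (0 : f ⟶ f') θ = 0 :=
  (AddMonoidHom.mk' (fun η : f ⟶ f' => hc η θ) (fun η η' => add_hc η η' θ)).map_zero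

/-- Linear combinations are generated by scalar multiples of 2-morphisms of `B`. -/
theorem ind {a b : Lin k B} {f g : a ⟶ b} {P : (f ⟶ g) → Prop} (η : f ⟶ g) (h0 : P 0)
    (ha : ∀ x y, P x → P y → P (x + y)) (hs : ∀ x r, P (sg x r)) : P η :=
  Finsupp.induction_linear (motive := P) η h0 ha hs

/-- The invertible 2-morphism of `Lin k B` given by one of `B`. -/
def iso {a b : Lin k B} {f g : a ⟶ b} (e : un f ≅ un g) : f ≅ g where
  hom := sg e.hom 1
  inv := sg e.inv 1
  hom_inv_id := by rw [sg_comp, e.hom_inv_id, mul_one, id_eq]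
  inv_hom_id := by rw [sg_comp, e.inv_hom_id, mul_one, id_eq]

/-- Horizontal composition in `Lin k B` as a bicategory structure. -/
def data : HCompData (Lin k B) where
  hcomp := hc
  assoc f g h := iso (α_ (un f) (un g) (un h))
  left f := iso (λ_ (un f))
  right f := iso (ρ_ (un f))
  hcomp_id f g := by
    rw [id_eq, id_eq, id_eq, hc_sg, hcomp_id, mul_one]; rfl
  interchange {a b c f f' f'' g g' g''} η η' θ θ' := by
    induction η using ind with
    | h0 => simp only [Limits.zero_comp, zero_hc]
    | ha x y hx hy => simp only [Preadditive.add_comp, add_hc, hx, hy]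
    | hs x r =>
    induction η' using ind with
    | h0 => simp only [Limits.comp_zero, zero_hc]
    | ha x y hx hy => simp only [Preadditive.comp_add, add_hc, hx, hy]
    | hs x' r' =>
    induction θ using ind with
    | h0 => simp only [Limits.zero_comp, hc_zero]
    | ha x y hx hy => simp only [Preadditive.add_comp, hc_add, hx, hy]
    | hs y s =>
    induction θ' using ind with
    | h0 => simp only [Limits.comp_zero, hc_zero]
    | ha x y hx hy => simp only [Preadditive.comp_add, hc_add, hx, hy]
    | hs y' s' =>
      rw [sg_comp, sg_comp, hc_sg, hc_sg, hc_sg, interchange, mul_mul_mul_comm]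
      exact (sg_comp _ _ _ _).symm
  assoc_nat {a b c d f f' g g' h h'} η θ ζ := by
    induction η using ind with
    | h0 => simp only [Limits.zero_comp, Limits.comp_zero, zero_hc]
    | ha x y hx hy => simp only [Preadditive.add_comp, Preadditive.comp_add, add_hc, hx, hy]
    | hs x r =>
    induction θ using ind with
    | h0 => simp only [Limits.zero_comp, Limits.comp_zero, zero_hc, hc_zero]
    | ha x y hx hy => simp only [Preadditive.add_comp, Preadditive.comp_add, add_hc, hc_add, hx, hy]
    | hs y s =>
    induction ζ using ind with
    | h0 => simp only [Limits.zero_comp, Limits.comp_zero, hc_zero]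
    | ha x y hx hy => simp only [Preadditive.add_comp, Preadditive.comp_add, hc_add, hx, hy]
    | hs z t =>
      rw [hc_sg, hc_sg]
      refine (congrArg (· ≫ _) (hc_sg (f := f ≫ g) (f' := f' ≫ g') (hcomp x y) z (r * s) t)).trans ?_
      refine Eq.trans ?_
        (congrArg (_ ≫ ·) (hc_sg (g := g ≫ h) (g' := g' ≫ h') x (hcomp y z) r (s * t))).symm
      refine (sg_comp _ _ _ _).trans (Eq.trans ?_ (sg_comp _ _ _ _).symm)
      rw [mul_one, one_mul, mul_assoc]
      exact congrArg (sg · _) (assoc_nat x y z)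
  left_nat {a b f f'} η := by
    induction η using ind with
    | h0 => simp only [Limits.zero_comp, Limits.comp_zero, hc_zero]
    | ha x y hx hy => simp only [Preadditive.add_comp, Preadditive.comp_add, hc_add, hx, hy]
    | hs x r =>
      rw [id_eq, hc_sg]
      refine (sg_comp _ _ _ _).trans (Eq.trans ?_ (sg_comp _ _ _ _).symm)
      rw [mul_one]
      exact congrArg (sg · _) (left_nat x)
  right_nat {a b f f'} η := by
    induction η using ind with
    | h0 => simp only [Limits.zero_comp, Limits.comp_zero, zero_hc]
    | ha x y hx hy => simp only [Preadditive.add_comp, Preadditive.comp_add, add_hc, hx, hy]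
    | hs x r =>
      rw [id_eq, hc_sg]
      refine (sg_comp _ _ _ _).trans (Eq.trans ?_ (sg_comp _ _ _ _).symm)
      rw [mul_one, one_mul, mul_one]
      exact congrArg (sg · _) (right_nat x)
  pentagon f g h i := by
    rw [id_eq, id_eq]
    refine (congrArg₂ (fun x y => x ≫ _ ≫ y) (hc_sg _ _ _ _) (hc_sg _ _ _ _)).trans ?_
    refine (congrArg (_ ≫ ·) (sg_comp _ _ _ _)).trans ?_
    refine (sg_comp _ _ _ _).trans (Eq.trans ?_ (sg_comp _ _ _ _).symm)
    simp only [mul_one]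
    exact congrArg (sg · _) (pentagon (un f) (un g) (un h) (un i))
  triangle f g := by
    rw [id_eq, id_eq]
    refine (congrArg (_ ≫ ·) (hc_sg _ _ _ _)).trans ?_
    refine (sg_comp _ _ _ _).trans (Eq.trans ?_ (hc_sg _ _ _ _).symm)
    simp only [mul_one]
    exact congrArg (sg · _) (triangle (un f) (un g))

instance : Bicategory (Lin k B) := data.toBicategory

theorem hcomp_eq {a b c : Lin k B} {f f' : a ⟶ b} {g g' : b ⟶ c} (η : f ⟶ f') (θ : g ⟶ g') :
    hcomp η θ = hc η θ := by
  refine (data.interchange _ _ _ _).symm.trans ?_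
  rw [Category.comp_id, Category.id_comp]; rfl

instance : LocallyPreadditive (Lin k B) where
  preadditive _ _ := inferInstance
  hcomp_add η θ θ' := by simp only [hcomp_eq]; exact hc_add _ _ _
  add_hcomp η η' θ := by simp only [hcomp_eq]; exact add_hc _ _ _

end Lin

end Lin

/-! ### Additive envelope of the categories of 1-morphisms -/

section AddEnv

open Bicategory

namespace MatAux

variable {C : Type u} [Category.{w} C] [Preadditive C]

open scoped Classical in
/-- The monomial matrix with entries `φ i` at the positions `(i, e i)`. -/
def mono {M N : Mat_ C} (e : M.ι ≃ N.ι) (φ : ∀ i, M.X i ⟶ N.X (e i)) : M ⟶ N :=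
  (fun i j => if h : e i = j then φ i ≫ eqToHom (congrArg N.X h) else 0 : Mat_.Hom M N)

theorem mono_self {M N : Mat_ C} (e : M.ι ≃ N.ι) (φ : ∀ i, M.X i ⟶ N.X (e i)) (i : M.ι) :
    (mono e φ : Mat_.Hom M N) i (e i) = φ i := by
  simp [mono]

theorem mono_ne {M N : Mat_ C} (e : M.ι ≃ N.ι) (φ : ∀ i, M.X i ⟶ N.X (e i)) {i : M.ι} {j : N.ι}
    (h : e i ≠ j) : (mono e φ : Mat_.Hom M N) i j = 0 := by
  simp [mono, h]

theorem mono_comp {M N K : Mat_ C} (e : M.ι ≃ N.ι) (φ : ∀ i, M.X i ⟶ N.X (e i)) (g : N ⟶ K)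
    (i : M.ι) (k : K.ι) : (mono e φ ≫ g : Mat_.Hom M K) i k = φ i ≫ g (e i) k := by
  classical
  rw [Mat_.comp_def]
  dsimp only
  rw [Finset.sum_eq_single (e i), mono_self]
  · intro j _ hj
    rw [mono_ne _ _ hj.symm, Limits.zero_comp]
  · simp

theorem comp_mono {M N K : Mat_ C} (e : N.ι ≃ K.ι) (φ : ∀ i, N.X i ⟶ K.X (e i)) (g : M ⟶ N)
    (i : M.ι) (j : N.ι) : (g ≫ mono e φ : Mat_.Hom M K) i (e j) = g i j ≫ φ j := by
  classical
  rw [Mat_.comp_def]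
  dsimp only
  rw [Finset.sum_eq_single j, mono_self]
  · intro j' _ hj
    rw [mono_ne _ _ (fun h => hj (e.injective h)), Limits.comp_zero]
  · simp

theorem mono_ext {M N : Mat_ C} (e : M.ι ≃ N.ι) (φ : ∀ i, M.X i ⟶ N.X (e i)) (g : M ⟶ N)
    (h1 : ∀ i, g i (e i) = φ i) (h2 : ∀ i j, i ≠ j → g i (e j) = 0) : g = mono e φ := by
  apply Mat_.hom_ext
  intro i j
  obtain ⟨j, rfl⟩ := e.surjective j
  by_cases h : i = j
  · subst h
    rw [h1, mono_self]
  · rw [h2 i j h, mono_ne _ _ (fun h' => h (e.injective h'))]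

theorem mono_comp_mono {M N K : Mat_ C} (e : M.ι ≃ N.ι) (φ : ∀ i, M.X i ⟶ N.X (e i))
    (e' : N.ι ≃ K.ι) (φ' : ∀ i, N.X i ⟶ K.X (e' i)) :
    mono e φ ≫ mono e' φ' = mono (e.trans e') (fun i => φ i ≫ φ' (e i)) := by
  apply mono_ext
  · intro i
    exact (mono_comp _ _ _ _ _).trans (congrArg (_ ≫ ·) (mono_self e' φ' (e i)))
  · intro i j h
    refine (mono_comp _ _ _ _ _).trans ?_
    rw [mono_ne, Limits.comp_zero]
    simpa using h

theorem id_eq (M : Mat_ C) : 𝟙 M = mono (Equiv.refl _) (fun i => 𝟙 (M.X i)) := by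
  apply mono_ext
  · intro i; simp
  · intro i j h; exact Mat_.id_apply_of_ne _ _ _ h

/-- A reindexing together with isomorphisms of summands gives an isomorphism. -/
def iso {M N : Mat_ C} (e : M.ι ≃ N.ι) (φ : ∀ i, M.X i ≅ N.X (e i)) : M ≅ N where
  hom := mono e (fun i => (φ i).hom)
  inv := mono e.symm (fun j => eqToHom (by simp) ≫ (φ (e.symm j)).inv)
  hom_inv_id := by
    rw [mono_comp_mono, id_eq]
    symm
    apply mono_ext
    · intro i
      have : ∀ j (h : j = i), (mono (Equiv.refl _) (fun i => 𝟙 (M.X i)) : Mat_.Hom M M) i j =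
          (φ i).hom ≫ eqToHom (by rw [h]) ≫ (φ j).inv := by
        rintro _ rfl
        rw [← id_eq, Mat_.id_apply_self]
        simp
      exact this _ (by simp)
    · intro i j h
      apply mono_ne
      simpa using h
  inv_hom_id := by
    rw [mono_comp_mono, id_eq]
    symm
    apply mono_ext
    · intro i
      have : ∀ j (h : j = i), (mono (Equiv.refl _) (fun i => 𝟙 (N.X i)) : Mat_.Hom N N) i j =
          eqToHom (by rw [h]) := by
        rintro _ rfl
        rw [← id_eq, Mat_.id_apply_self]
        simp
      rw [this _ (by simp)]
      simp
    · intro i j h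
      apply mono_ne
      simpa using h

end MatAux

/-- The bicategory obtained from the locally preadditive bicategory `B` by passing to the additive
envelopes `Mat_` of the categories of 1-morphisms: 1-morphisms are finite tuples (formal direct
sums) of 1-morphisms, 2-morphisms are matrices, all compositions being extended biadditively. -/
structure AddEnv (B : Type u) where
  obj : B

namespace AddEnv

variable {B : Type u} [Bicategory.{w, v} B] [LocallyPreadditive B]

instance : Quiver (AddEnv B) where
  Hom a b := Mat_ (a.obj ⟶ b.obj)

/-- The tuple of 1-morphisms underlying a 1-morphism of `AddEnv B`. -/
def un {a b : AddEnv B} (F : a ⟶ b) : Mat_ (a.obj ⟶ b.obj) := F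

instance : CategoryStruct (AddEnv B) where
  id a := (⟨PUnit, fun _ => 𝟙 a.obj⟩ : Mat_ (a.obj ⟶ a.obj))
  comp {a _ c} F G :=
    (⟨(un F).ι × (un G).ι, fun p => (un F).X p.1 ≫ (un G).X p.2⟩ : Mat_ (a.obj ⟶ c.obj))

instance (a b : AddEnv B) : Category (a ⟶ b) := inferInstanceAs (Category (Mat_ (a.obj ⟶ b.obj)))

instance (a b : AddEnv B) : Preadditive (a ⟶ b) :=
  inferInstanceAs (Preadditive (Mat_ (a.obj ⟶ b.obj)))

instance (a b : AddEnv B) : HasFiniteBiproducts (a ⟶ b) :=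
  inferInstanceAs (HasFiniteBiproducts (Mat_ (a.obj ⟶ b.obj)))

/-- A 1-morphism of `B` as a one-term tuple. -/
def mor1 {a b : B} (f : a ⟶ b) : (⟨a⟩ : AddEnv B) ⟶ ⟨b⟩ := (⟨PUnit, fun _ => f⟩ : Mat_ (a ⟶ b))

/-- The matrix underlying a 2-morphism of `AddEnv B`. -/
def ent {a b : AddEnv B} {F G : a ⟶ b} (η : F ⟶ G) : Mat_.Hom (un F) (un G) := η

/-- The 2-morphism of `AddEnv B` given by a matrix. -/
def ofEnt {a b : AddEnv B} {F G : a ⟶ b} (η : Mat_.Hom (un F) (un G)) : F ⟶ G := η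

/-- Horizontal composition of matrices (Kronecker product). -/
def hc {a b c : AddEnv B} {F F' : a ⟶ b} {G G' : b ⟶ c} (η : F ⟶ F') (θ : G ⟶ G') :
    F ≫ G ⟶ F' ≫ G' :=
  ofEnt (F := F ≫ G) (G := F' ≫ G') fun p q => hcomp (ent η p.1 q.1) (ent θ p.2 q.2)

theorem hc_mono {a b c : AddEnv B} {F F' : a ⟶ b} {G G' : b ⟶ c} (e : (un F).ι ≃ (un F').ι)
    (φ : ∀ i, (un F).X i ⟶ (un F').X (e i)) (e' : (un G).ι ≃ (un G').ι)
    (φ' : ∀ i, (un G).X i ⟶ (un G').X (e' i)) :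
    hc (MatAux.mono e φ : F ⟶ F') (MatAux.mono e' φ' : G ⟶ G') =
      MatAux.mono (M := un (F ≫ G)) (N := un (F' ≫ G')) (e.prodCongr e')
        (fun p => hcomp (φ p.1) (φ' p.2)) := by
  apply MatAux.mono_ext
  · intro i
    exact congrArg₂ hcomp (MatAux.mono_self e φ i.1) (MatAux.mono_self e' φ' i.2)
  · intro i j h
    by_cases h1 : i.1 = j.1
    · have h2 : i.2 ≠ j.2 := fun h2 => h (Prod.ext h1 h2)
      exact (congrArg₂ hcomp rfl
        (MatAux.mono_ne e' φ' (fun h' => h2 (e'.injective h')))).trans (hcomp_zero _)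
    · exact (congrArg₂ hcomp
        (MatAux.mono_ne e φ (fun h' => h1 (e.injective h'))) rfl).trans (zero_hcomp _)

/-- Horizontal composition in `AddEnv B` as a bicategory structure. -/
def data : HCompData (AddEnv B) where
  hcomp := hc
  assoc F G H := MatAux.iso (M := un ((F ≫ G) ≫ H)) (N := un (F ≫ G ≫ H))
    (Equiv.prodAssoc (un F).ι (un G).ι (un H).ι)
    (fun p => α_ ((un F).X p.1.1) ((un G).X p.1.2) ((un H).X p.2))
  left {a _} F := MatAux.iso (M := un (𝟙 a ≫ F)) (N := un F) (Equiv.punitProd (un F).ι)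
    (fun p => λ_ ((un F).X p.2))
  right {_ b} F := MatAux.iso (M := un (F ≫ 𝟙 b)) (N := un F) (Equiv.prodPUnit (un F).ι)
    (fun p => ρ_ ((un F).X p.1))
  hcomp_id F G := by
    refine (congrArg₂ hc (MatAux.id_eq (un F)) (MatAux.id_eq (un G))).trans ?_
    refine (hc_mono (F := F) (F' := F) (G := G) (G' := G) _ _ _ _).trans
      (Eq.trans ?_ (MatAux.id_eq (un (F ≫ G))).symm)
    exact congrArg (MatAux.mono (M := un (F ≫ G)) (N := un (F ≫ G)) (Equiv.refl _))
      (funext fun i => hcomp_id _ _)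
  interchange {a b c F F' F'' G G' G''} η η' θ θ' := by
    apply Mat_.hom_ext
    intro p q
    refine (sum_hcomp_sum _ _ _ _).trans ?_
    refine Eq.trans ?_ (Fintype.sum_prod_type _).symm
    exact Finset.sum_congr rfl fun i _ => Finset.sum_congr rfl fun j _ => interchange _ _ _ _
  assoc_nat {a b c d F F' G G' H H'} η θ ζ := by
    apply Mat_.hom_ext
    intro p q
    refine (MatAux.comp_mono (N := un ((F' ≫ G') ≫ H')) _ _ _ p ((q.1, q.2.1), q.2.2)).trans ?_
    refine Eq.trans ?_ (MatAux.mono_comp _ _ _ _ _).symm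
    exact assoc_nat _ _ _
  left_nat {a b F F'} η := by
    apply Mat_.hom_ext
    intro p q
    refine (MatAux.comp_mono (N := un (𝟙 a ≫ F')) _ _ _ p (PUnit.unit, q)).trans ?_
    refine Eq.trans ?_ (MatAux.mono_comp _ _ _ _ _).symm
    refine Eq.trans ?_ (left_nat (ent η p.2 q))
    exact congrArg (fun x => hcomp x (ent η p.2 q) ≫ _) (Mat_.id_apply_self (un (𝟙 a)) PUnit.unit)
  right_nat {a b F F'} η := by
    apply Mat_.hom_ext
    intro p q
    refine (MatAux.comp_mono (N := un (F' ≫ 𝟙 b)) _ _ _ p (q, PUnit.unit)).trans ?_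
    refine Eq.trans ?_ (MatAux.mono_comp _ _ _ _ _).symm
    refine Eq.trans ?_ (right_nat (ent η p.1 q))
    exact congrArg (fun x => hcomp (ent η p.1 q) x ≫ _) (Mat_.id_apply_self (un (𝟙 b)) PUnit.unit)
  pentagon F G H I := by
    refine (congrArg₂ (fun x y => x ≫ _ ≫ y)
      ((congrArg (hc _) (MatAux.id_eq (un I))).trans
        (hc_mono (F := (F ≫ G) ≫ H) (F' := F ≫ G ≫ H) (G := I) (G' := I) _ _ _ _))
      ((congrArg (hc · _) (MatAux.id_eq (un F))).trans
        (hc_mono (F := F) (F' := F) (G := (G ≫ H) ≫ I) (G' := G ≫ H ≫ I) _ _ _ _))).trans ?_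
    refine (congrArg (_ ≫ ·) (MatAux.mono_comp_mono _ _ _ _)).trans ?_
    refine (MatAux.mono_comp_mono _ _ _ _).trans
      (Eq.trans ?_ (MatAux.mono_comp_mono _ _ _ _).symm)
    refine congrArg (MatAux.mono (M := un (((F ≫ G) ≫ H) ≫ I)) (N := un (F ≫ G ≫ H ≫ I))
      ((Equiv.prodAssoc ((un F).ι × (un G).ι) (un H).ι (un I).ι).trans
        (Equiv.prodAssoc (un F).ι (un G).ι ((un H).ι × (un I).ι)))) ?_
    exact funext fun i => pentagon ((un F).X _) ((un G).X _) ((un H).X _) ((un I).X _)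
  triangle {a b c} F G := by
    refine (congrArg (_ ≫ ·) ((congrArg (hc · _) (MatAux.id_eq (un F))).trans
      (hc_mono (F := F) (F' := F) (G := 𝟙 b ≫ G) (G' := G) _ _ _ _))).trans ?_
    refine (MatAux.mono_comp_mono _ _ _ _).trans (Eq.trans ?_
      ((congrArg (hc _) (MatAux.id_eq (un G))).trans
        (hc_mono (F := F ≫ 𝟙 b) (F' := F) (G := G) (G' := G) _ _ _ _)).symm)
    refine congrArg (MatAux.mono (M := un ((F ≫ 𝟙 b) ≫ G)) (N := un (F ≫ G))
      ((Equiv.prodPUnit (un F).ι).prodCongr (Equiv.refl (un G).ι))) ?_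
    exact funext fun i => triangle ((un F).X _) ((un G).X _)

instance : Bicategory (AddEnv B) := data.toBicategory

theorem hcomp_eq {a b c : AddEnv B} {F F' : a ⟶ b} {G G' : b ⟶ c} (η : F ⟶ F') (θ : G ⟶ G') :
    hcomp η θ = hc η θ := by
  refine (data.interchange _ _ _ _).symm.trans ?_
  rw [Category.comp_id, Category.id_comp]; rfl

instance : LocallyPreadditive (AddEnv B) where
  preadditive _ _ := inferInstance
  hcomp_add η θ θ' := by
    simp only [hcomp_eq]
    apply Mat_.hom_ext
    intro p q
    exact LocallyPreadditive.hcomp_add _ _ _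
  add_hcomp η η' θ := by
    simp only [hcomp_eq]
    apply Mat_.hom_ext
    intro p q
    exact LocallyPreadditive.add_hcomp _ _ _

end AddEnv

end AddEnv

/-! ### Idempotent completion of the categories of 1-morphisms -/

section Kar

open Bicategory Idempotents

namespace KarAux

variable {B : Type u} [Bicategory.{w, v} B]

theorem idem {a b c : B} {F : a ⟶ b} {G : b ⟶ c} {p : F ⟶ F} {q : G ⟶ G} (hp : p ≫ p = p)
    (hq : q ≫ q = q) : hcomp p q ≫ hcomp p q = hcomp p q := by
  rw [← interchange, hp, hq]

theorem assoc_nat' {a b c d : B} {f f' : a ⟶ b} {g g' : b ⟶ c} {h h' : c ⟶ d}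
    (η : f ⟶ f') (θ : g ⟶ g') (ζ : h ⟶ h') :
    hcomp η (hcomp θ ζ) ≫ (α_ f' g' h').inv = (α_ f g h).inv ≫ hcomp (hcomp η θ) ζ := by
  rw [Iso.eq_inv_comp, ← Category.assoc, ← assoc_nat, Category.assoc, Iso.hom_inv_id,
    Category.comp_id]

/-- The associator cut down by idempotents. -/
def asc {a b c d : B} {F : a ⟶ b} {G : b ⟶ c} {H : c ⟶ d} (p : F ⟶ F) (q : G ⟶ G) (r : H ⟶ H) :
    (F ≫ G) ≫ H ⟶ F ≫ G ≫ H :=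
  hcomp (hcomp p q) r ≫ (α_ F G H).hom

/-- The inverse associator cut down by idempotents. -/
def ascInv {a b c d : B} {F : a ⟶ b} {G : b ⟶ c} {H : c ⟶ d} (p : F ⟶ F) (q : G ⟶ G)
    (r : H ⟶ H) : F ≫ G ≫ H ⟶ (F ≫ G) ≫ H :=
  hcomp p (hcomp q r) ≫ (α_ F G H).inv

section

variable {a b c d e : B} {F : a ⟶ b} {G : b ⟶ c} {H : c ⟶ d} {I : d ⟶ e}
  {p : F ⟶ F} {q : G ⟶ G} {r : H ⟶ H} {s : I ⟶ I}

theorem asc_eq : asc p q r = (α_ F G H).hom ≫ hcomp p (hcomp q r) := assoc_nat _ _ _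

theorem asc_comm (hp : p ≫ p = p) (hq : q ≫ q = q) (hr : r ≫ r = r) :
    hcomp (hcomp p q) r ≫ asc p q r ≫ hcomp p (hcomp q r) = asc p q r := by
  unfold asc
  simp only [Category.assoc, ← assoc_nat]
  simp only [← Category.assoc, idem (idem hp hq) hr]

theorem ascInv_comm (hp : p ≫ p = p) (hq : q ≫ q = q) (hr : r ≫ r = r) :
    hcomp p (hcomp q r) ≫ ascInv p q r ≫ hcomp (hcomp p q) r = ascInv p q r := by
  unfold ascInv
  simp only [Category.assoc, ← assoc_nat']
  simp only [← Category.assoc, idem hp (idem hq hr)]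

theorem asc_inv (hp : p ≫ p = p) (hq : q ≫ q = q) (hr : r ≫ r = r) :
    asc p q r ≫ ascInv p q r = hcomp (hcomp p q) r := by
  unfold asc ascInv
  simp only [Category.assoc, assoc_nat', Iso.hom_inv_id_assoc, idem (idem hp hq) hr]

theorem inv_asc (hp : p ≫ p = p) (hq : q ≫ q = q) (hr : r ≫ r = r) :
    ascInv p q r ≫ asc p q r = hcomp p (hcomp q r) := by
  unfold asc ascInv
  simp only [Category.assoc, assoc_nat, Iso.inv_hom_id_assoc, idem hp (idem hq hr)]

theorem asc_nat {F' : a ⟶ b} {G' : b ⟶ c} {H' : c ⟶ d} {p' : F' ⟶ F'} {q' : G' ⟶ G'}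
    {r' : H' ⟶ H'} (f : F ⟶ F') (g : G ⟶ G') (h : H ⟶ H') (hf : p ≫ f = f) (hf' : f ≫ p' = f)
    (hg : q ≫ g = g) (hg' : g ≫ q' = g) (hh : r ≫ h = h) (hh' : h ≫ r' = h) :
    hcomp (hcomp f g) h ≫ asc p' q' r' = asc p q r ≫ hcomp f (hcomp g h) := by
  unfold asc
  rw [← Category.assoc, ← interchange, ← interchange, hf', hg', hh', Category.assoc, ← assoc_nat,
    ← Category.assoc, ← interchange, ← interchange, hf, hg, hh]

theorem pent (hp : p ≫ p = p) (hq : q ≫ q = q) (hr : r ≫ r = r) (hs : s ≫ s = s) :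
    hcomp (asc p q r) s ≫ asc p (hcomp q r) s ≫ hcomp p (asc q r s) =
      asc (hcomp p q) r s ≫ asc p q (hcomp r s) := by
  have h1 : hcomp (asc p q r) s = hcomp (hcomp (hcomp p q) r) s ≫ hcomp (α_ F G H).hom (𝟙 I) := by
    rw [← interchange, Category.comp_id]; rfl
  have h2 : hcomp p (asc q r s) = hcomp p (hcomp (hcomp q r) s) ≫ hcomp (𝟙 F) (α_ G H I).hom := by
    rw [← interchange, Category.comp_id]; rfl
  have h3 : hcomp (α_ F G H).hom (𝟙 I) ≫ hcomp (hcomp p (hcomp q r)) s =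
      hcomp (hcomp (hcomp p q) r) s ≫ hcomp (α_ F G H).hom (𝟙 I) := by
    rw [← interchange, ← interchange, assoc_nat, Category.comp_id, Category.id_comp]
  have i4 := idem (idem (idem hp hq) hr) hs
  have h4 : asc p (hcomp q r) s ≫ hcomp p (asc q r s) = hcomp (hcomp p (hcomp q r)) s ≫
      (α_ F (G ≫ H) I).hom ≫ hcomp (𝟙 F) (α_ G H I).hom := by
    rw [h2, asc_eq]
    simp only [Category.assoc]
    rw [← Category.assoc (hcomp p _) (hcomp p _), idem hp (idem (idem hq hr) hs),
      ← Category.assoc, ← assoc_nat, Category.assoc]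
  have h5 : asc (hcomp p q) r s ≫ asc p q (hcomp r s) = hcomp (hcomp (hcomp p q) r) s ≫
      (α_ (F ≫ G) H I).hom ≫ (α_ F G (H ≫ I)).hom := by
    rw [asc_eq]
    unfold asc
    simp only [Category.assoc]
    rw [← Category.assoc (hcomp _ _) (hcomp _ _), idem (idem hp hq) (idem hr hs),
      ← Category.assoc, ← assoc_nat, Category.assoc]
  rw [h4, h5, h1, ← pentagon]
  simp only [Category.assoc]
  rw [← Category.assoc (hcomp (α_ F G H).hom (𝟙 I)), h3]
  simp only [← Category.assoc, i4]

/-- The left unitor cut down by idempotents. -/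
def lft (u : 𝟙 a ⟶ 𝟙 a) (p : F ⟶ F) : 𝟙 a ≫ F ⟶ F := hcomp u p ≫ (λ_ F).hom

/-- The inverse left unitor cut down by idempotents. -/
def lftInv (u : 𝟙 a ⟶ 𝟙 a) (p : F ⟶ F) : F ⟶ 𝟙 a ≫ F := (λ_ F).inv ≫ hcomp u p

/-- The right unitor cut down by idempotents. -/
def rgt (p : F ⟶ F) (u : 𝟙 b ⟶ 𝟙 b) : F ≫ 𝟙 b ⟶ F := hcomp p u ≫ (ρ_ F).hom

/-- The inverse right unitor cut down by idempotents. -/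
def rgtInv (p : F ⟶ F) (u : 𝟙 b ⟶ 𝟙 b) : F ⟶ F ≫ 𝟙 b := (ρ_ F).inv ≫ hcomp p u

/-- The action of an endomorphism of an identity 1-morphism on a 2-morphism from the left,
that is, the horizontal composite of `u` and `f`, up to left unitors. -/
def lact {F F' : a ⟶ b} (u : 𝟙 a ⟶ 𝟙 a) (f : F ⟶ F') : F ⟶ F' :=
  (λ_ F).inv ≫ hcomp u f ≫ (λ_ F').hom

/-- The action of an endomorphism of an identity 1-morphism on a 2-morphism from the right,
that is, the horizontal composite of `f` and `u`, up to right unitors. -/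
def ract {F F' : a ⟶ b} (f : F ⟶ F') (u : 𝟙 b ⟶ 𝟙 b) : F ⟶ F' :=
  (ρ_ F).inv ≫ hcomp f u ≫ (ρ_ F').hom

theorem lft_comm {u : 𝟙 a ⟶ 𝟙 a} (hu : u ≫ u = u) (hp : p ≫ p = p) (hl : lact u p = p) :
    hcomp u p ≫ lft u p ≫ p = lft u p := by
  have h : (λ_ F).hom ≫ p = hcomp u p ≫ (λ_ F).hom := by
    conv_lhs => rw [← hl]
    simp [lact]
  unfold lft
  rw [Category.assoc, h]
  simp only [← Category.assoc, idem hu hp]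

theorem lftInv_comm {u : 𝟙 a ⟶ 𝟙 a} (hu : u ≫ u = u) (hp : p ≫ p = p) (hl : lact u p = p) :
    p ≫ lftInv u p ≫ hcomp u p = lftInv u p := by
  have h : p ≫ (λ_ F).inv = (λ_ F).inv ≫ hcomp u p := by
    conv_lhs => rw [← hl]
    simp [lact]
  unfold lftInv
  rw [← Category.assoc, ← Category.assoc, h]
  simp only [Category.assoc, idem hu hp]

theorem lft_inv {u : 𝟙 a ⟶ 𝟙 a} (hu : u ≫ u = u) (hp : p ≫ p = p) :
    lft u p ≫ lftInv u p = hcomp u p := by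
  simp [lft, lftInv, idem hu hp]

theorem lftInv_lft {u : 𝟙 a ⟶ 𝟙 a} (hu : u ≫ u = u) (hp : p ≫ p = p) (hl : lact u p = p) :
    lftInv u p ≫ lft u p = p := by
  unfold lft lftInv
  rw [Category.assoc, ← Category.assoc (hcomp u p), idem hu hp]
  exact hl

theorem rgt_comm {u : 𝟙 b ⟶ 𝟙 b} (hu : u ≫ u = u) (hp : p ≫ p = p) (hl : ract p u = p) :
    hcomp p u ≫ rgt p u ≫ p = rgt p u := by
  have h : (ρ_ F).hom ≫ p = hcomp p u ≫ (ρ_ F).hom := by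
    conv_lhs => rw [← hl]
    simp [ract]
  unfold rgt
  rw [Category.assoc, h]
  simp only [← Category.assoc, idem hp hu]

theorem rgtInv_comm {u : 𝟙 b ⟶ 𝟙 b} (hu : u ≫ u = u) (hp : p ≫ p = p) (hl : ract p u = p) :
    p ≫ rgtInv p u ≫ hcomp p u = rgtInv p u := by
  have h : p ≫ (ρ_ F).inv = (ρ_ F).inv ≫ hcomp p u := by
    conv_lhs => rw [← hl]
    simp [ract]
  unfold rgtInv
  rw [← Category.assoc, ← Category.assoc, h]
  simp only [Category.assoc, idem hp hu]

theorem rgt_inv {u : 𝟙 b ⟶ 𝟙 b} (hu : u ≫ u = u) (hp : p ≫ p = p) :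
    rgt p u ≫ rgtInv p u = hcomp p u := by
  simp [rgt, rgtInv, idem hp hu]

theorem rgtInv_rgt {u : 𝟙 b ⟶ 𝟙 b} (hu : u ≫ u = u) (hp : p ≫ p = p) (hl : ract p u = p) :
    rgtInv p u ≫ rgt p u = p := by
  unfold rgt rgtInv
  rw [Category.assoc, ← Category.assoc (hcomp p u), idem hp hu]
  exact hl

theorem lft_nat {F' : a ⟶ b} {u : 𝟙 a ⟶ 𝟙 a} {p' : F' ⟶ F'} (hu : u ≫ u = u) (f : F ⟶ F')
    (hf : p ≫ f = f) (hf' : f ≫ p' = f) : hcomp u f ≫ lft u p' = lft u p ≫ f := by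
  unfold lft
  rw [Category.assoc, ← left_nat, ← Category.assoc, ← Category.assoc, ← interchange, ← interchange,
    hu, hf, hf', Category.comp_id]

theorem rgt_nat {F' : a ⟶ b} {u : 𝟙 b ⟶ 𝟙 b} {p' : F' ⟶ F'} (hu : u ≫ u = u) (f : F ⟶ F')
    (hf : p ≫ f = f) (hf' : f ≫ p' = f) : hcomp f u ≫ rgt p' u = rgt p u ≫ f := by
  unfold rgt
  rw [Category.assoc, ← right_nat, ← Category.assoc, ← Category.assoc, ← interchange, ← interchange,
    hu, hf, hf', Category.comp_id]

theorem tri {u : 𝟙 b ⟶ 𝟙 b} (hp : p ≫ p = p) (hu : u ≫ u = u) (hq : q ≫ q = q) :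
    asc p u q ≫ hcomp p (lft u q) = hcomp (rgt p u) q := by
  unfold lft rgt
  have h1 : hcomp p (hcomp u q ≫ (λ_ G).hom) = hcomp p (hcomp u q) ≫ hcomp (𝟙 F) (λ_ G).hom := by
    rw [← interchange, Category.comp_id]
  have h2 : hcomp (hcomp p u ≫ (ρ_ F).hom) q = hcomp (hcomp p u) q ≫ hcomp (ρ_ F).hom (𝟙 G) := by
    rw [← interchange, Category.comp_id]
  rw [h1, h2, asc_eq, Category.assoc, ← Category.assoc (hcomp p _), idem hp (idem hu hq),
    ← Category.assoc, ← assoc_nat, Category.assoc, triangle]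

theorem id_lact {F F' : a ⟶ b} (f : F ⟶ F') : lact (𝟙 (𝟙 a)) f = f := by
  rw [lact, left_nat, Iso.inv_hom_id_assoc]

theorem ract_id {F F' : a ⟶ b} (f : F ⟶ F') : ract f (𝟙 (𝟙 b)) = f := by
  rw [ract, right_nat, Iso.inv_hom_id_assoc]

end

end KarAux

open KarAux

/-- The bicategory obtained from `B` by passing to the idempotent completions (Karoubi envelopes)
of the categories of 1-morphisms: 1-morphisms are pairs `(F, p)` with `p` an idempotent
2-endomorphism of `F`, and all compositions are induced from `B`. -/
structure Kar (B : Type u) where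
  obj : B

namespace Kar

variable {B : Type u} [Bicategory.{w, v} B]

instance : Quiver (Kar B) where
  Hom a b := Karoubi (a.obj ⟶ b.obj)

/-- The pair `(F, p)` underlying a 1-morphism of `Kar B`. -/
def un {a b : Kar B} (F : a ⟶ b) : Karoubi (a.obj ⟶ b.obj) := F

instance : CategoryStruct (Kar B) where
  id a := (⟨𝟙 a.obj, 𝟙 _, Category.comp_id _⟩ : Karoubi (a.obj ⟶ a.obj))
  comp {a _ c} F G := (⟨(un F).X ≫ (un G).X, hcomp (un F).p (un G).p,
    idem (un F).idem (un G).idem⟩ : Karoubi (a.obj ⟶ c.obj))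

instance (a b : Kar B) : Category (a ⟶ b) := inferInstanceAs (Category (Karoubi (a.obj ⟶ b.obj)))

/-- A 1-morphism `F` of `B` as the 1-morphism `(F, 𝟙)` of `Kar B`. -/
def mor1 {a b : B} (F : a ⟶ b) : (⟨a⟩ : Kar B) ⟶ ⟨b⟩ :=
  (⟨F, 𝟙 F, Category.comp_id _⟩ : Karoubi (a ⟶ b))

/-- The 2-morphism of `B` underlying a 2-morphism of `Kar B`. -/
def two {a b : Kar B} {F G : a ⟶ b} (f : F ⟶ G) : (un F).X ⟶ (un G).X := Karoubi.Hom.f f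

theorem two_ext {a b : Kar B} {F G : a ⟶ b} {f g : F ⟶ G} (h : two f = two g) : f = g :=
  Karoubi.hom_ext f g h

/-- Constructor for 2-morphisms of `Kar B`. -/
def ofTwo {a b : Kar B} {F G : a ⟶ b} (f : (un F).X ⟶ (un G).X)
    (h : (un F).p ≫ f ≫ (un G).p = f) : F ⟶ G :=
  (⟨f, h⟩ : Karoubi.Hom (un F) (un G))

theorem p_two {a b : Kar B} {F G : a ⟶ b} (f : F ⟶ G) : (un F).p ≫ two f = two f :=
  Karoubi.p_comp (P := un F) (Q := un G) f

theorem two_p {a b : Kar B} {F G : a ⟶ b} (f : F ⟶ G) : two f ≫ (un G).p = two f :=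
  Karoubi.comp_p (P := un F) (Q := un G) f

theorem two_comp {a b : Kar B} {F G H : a ⟶ b} (f : F ⟶ G) (g : G ⟶ H) :
    two (f ≫ g) = two f ≫ two g := rfl

theorem two_id {a b : Kar B} (F : a ⟶ b) : two (𝟙 F) = (un F).p := rfl

/-- Horizontal composition in `Kar B` as a bicategory structure. -/
def data : HCompData (Kar B) where
  hcomp {a b c F F' G G'} η θ := ofTwo (F := F ≫ G) (G := F' ≫ G') (hcomp (two η) (two θ)) (by
    change hcomp _ _ ≫ _ ≫ hcomp _ _ = _
    rw [← interchange, ← interchange, two_p, two_p, p_two, p_two])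
  assoc F G H :=
    { hom := ofTwo (F := (F ≫ G) ≫ H) (G := F ≫ G ≫ H) (asc (un F).p (un G).p (un H).p)
        (asc_comm (un F).idem (un G).idem (un H).idem)
      inv := ofTwo (F := F ≫ G ≫ H) (G := (F ≫ G) ≫ H) (ascInv (un F).p (un G).p (un H).p)
        (ascInv_comm (un F).idem (un G).idem (un H).idem)
      hom_inv_id := two_ext (asc_inv (un F).idem (un G).idem (un H).idem)
      inv_hom_id := two_ext (inv_asc (un F).idem (un G).idem (un H).idem) }
  left {a b} F :=
    { hom := ofTwo (F := 𝟙 a ≫ F) (G := F) (lft (𝟙 _) (un F).p)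
        (lft_comm (Category.comp_id _) (un F).idem (id_lact _))
      inv := ofTwo (F := F) (G := 𝟙 a ≫ F) (lftInv (𝟙 _) (un F).p)
        (lftInv_comm (Category.comp_id _) (un F).idem (id_lact _))
      hom_inv_id := two_ext (lft_inv (Category.comp_id _) (un F).idem)
      inv_hom_id := two_ext (lftInv_lft (Category.comp_id _) (un F).idem (id_lact _)) }
  right {a b} F :=
    { hom := ofTwo (F := F ≫ 𝟙 b) (G := F) (rgt (un F).p (𝟙 _))
        (rgt_comm (Category.comp_id _) (un F).idem (ract_id _))
      inv := ofTwo (F := F) (G := F ≫ 𝟙 b) (rgtInv (un F).p (𝟙 _))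
        (rgtInv_comm (Category.comp_id _) (un F).idem (ract_id _))
      hom_inv_id := two_ext (rgt_inv (Category.comp_id _) (un F).idem)
      inv_hom_id := two_ext (rgtInv_rgt (Category.comp_id _) (un F).idem (ract_id _)) }
  hcomp_id F G := rfl
  interchange η η' θ θ' := two_ext (interchange (two η) (two η') (two θ) (two θ'))
  assoc_nat η θ ζ := two_ext (asc_nat (two η) (two θ) (two ζ) (p_two η) (two_p η) (p_two θ)
    (two_p θ) (p_two ζ) (two_p ζ))
  left_nat {a b f f'} η := two_ext (lft_nat (Category.comp_id _) (two η) (p_two η) (two_p η))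
  right_nat {a b f f'} η := two_ext (rgt_nat (Category.comp_id _) (two η) (p_two η) (two_p η))
  pentagon f g h i := two_ext (pent (un f).idem (un g).idem (un h).idem (un i).idem)
  triangle f g := two_ext (tri (un f).idem (Category.comp_id _) (un g).idem)

instance : Bicategory (Kar B) := data.toBicategory

theorem hcomp_eq {a b c : Kar B} {F F' : a ⟶ b} {G G' : b ⟶ c} (η : F ⟶ F') (θ : G ⟶ G') :
    hcomp η θ = data.hcomp η θ := by
  refine (data.interchange _ _ _ _).symm.trans ?_
  rw [Category.comp_id, Category.id_comp]

variable [LocallyPreadditive B]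

instance (a b : Kar B) : Preadditive (a ⟶ b) :=
  inferInstanceAs (Preadditive (Karoubi (a.obj ⟶ b.obj)))

instance : LocallyPreadditive (Kar B) where
  preadditive _ _ := inferInstance
  hcomp_add η θ θ' := by
    simp only [hcomp_eq]
    exact two_ext (LocallyPreadditive.hcomp_add _ _ _)
  add_hcomp η η' θ := by
    simp only [hcomp_eq]
    exact two_ext (LocallyPreadditive.add_hcomp _ _ _)

instance [∀ a b : B, HasFiniteBiproducts (a ⟶ b)] (a b : Kar B) : HasFiniteBiproducts (a ⟶ b) :=
  inferInstanceAs (HasFiniteBiproducts (Karoubi (a.obj ⟶ b.obj)))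

instance [∀ a b : B, HasFiniteBiproducts (a ⟶ b)] (a b : Kar B) : HasBinaryBiproducts (a ⟶ b) :=
  hasBinaryBiproducts_of_finite_biproducts _

end Kar

end Kar

/-! ### Splitting the identity 1-morphisms -/

section Split

open Bicategory Idempotents KarAux

namespace KarAux

variable {B : Type u} [Bicategory.{w, v} B] {a b c : B}

theorem lact_comp {F F' F'' : a ⟶ b} (u u' : 𝟙 a ⟶ 𝟙 a) (f : F ⟶ F') (f' : F' ⟶ F'') :
    lact (u ≫ u') (f ≫ f') = lact u f ≫ lact u' f' := by
  simp [lact, interchange]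

theorem ract_comp {F F' F'' : a ⟶ b} (u u' : 𝟙 b ⟶ 𝟙 b) (f : F ⟶ F') (f' : F' ⟶ F'') :
    ract (f ≫ f') (u ≫ u') = ract f u ≫ ract f' u' := by
  simp [ract, interchange]

theorem lact_eq {F F' : a ⟶ b} (u : 𝟙 a ⟶ 𝟙 a) (f : F ⟶ F') : lact u f = lact u (𝟙 F) ≫ f := by
  conv_rhs => rw [← id_lact f]
  rw [← lact_comp, Category.comp_id, Category.id_comp]

theorem lact_eq' {F F' : a ⟶ b} (u : 𝟙 a ⟶ 𝟙 a) (f : F ⟶ F') : lact u f = f ≫ lact u (𝟙 F') := by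
  conv_rhs => rw [← id_lact f]
  rw [← lact_comp, Category.comp_id, Category.id_comp]

theorem ract_eq {F F' : a ⟶ b} (u : 𝟙 b ⟶ 𝟙 b) (f : F ⟶ F') : ract f u = ract (𝟙 F) u ≫ f := by
  conv_rhs => rw [← ract_id f]
  rw [← ract_comp, Category.comp_id, Category.id_comp]

theorem ract_eq' {F F' : a ⟶ b} (u : 𝟙 b ⟶ 𝟙 b) (f : F ⟶ F') : ract f u = f ≫ ract (𝟙 F') u := by
  conv_rhs => rw [← ract_id f]
  rw [← ract_comp, Category.comp_id, Category.id_comp]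

theorem lact_lact {F F' : a ⟶ b} (u u' : 𝟙 a ⟶ 𝟙 a) (f : F ⟶ F') :
    lact u (lact u' f) = lact (u ≫ u') f := by
  rw [lact_eq u, lact_eq u', ← Category.assoc, ← lact_comp, Category.comp_id, ← lact_eq]

theorem ract_ract {F F' : a ⟶ b} (u u' : 𝟙 b ⟶ 𝟙 b) (f : F ⟶ F') :
    ract (ract f u') u = ract f (u ≫ u') := by
  rw [ract_eq u, ract_eq u', ← Category.assoc, ← ract_comp, Category.comp_id, ← ract_eq]

theorem lact_ract {F F' : a ⟶ b} (u : 𝟙 a ⟶ 𝟙 a) (u' : 𝟙 b ⟶ 𝟙 b) (f : F ⟶ F') :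
    lact u (ract f u') = ract (lact u f) u' := by
  rw [ract_eq u' f, ract_eq u' (lact u f), lact_eq, lact_eq u f, ← Category.assoc,
    ← Category.assoc, ← lact_eq, ← lact_eq']

theorem lact_id_id (u : 𝟙 a ⟶ 𝟙 a) : lact u (𝟙 (𝟙 a)) = u := by
  have h : (λ_ (𝟙 a)).inv = (ρ_ (𝟙 a)).inv := unitors_inv_equal
  rw [lact, h, unitors_equal, right_nat, Iso.inv_hom_id_assoc]

theorem ract_id_id (u : 𝟙 a ⟶ 𝟙 a) : ract (𝟙 (𝟙 a)) u = u := by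
  have h : (ρ_ (𝟙 a)).inv = (λ_ (𝟙 a)).inv := unitors_inv_equal.symm
  rw [ract, h, ← unitors_equal, left_nat, Iso.inv_hom_id_assoc]

theorem lft_lact {F F' : a ⟶ b} {p : F ⟶ F} {p' : F' ⟶ F'} (u : 𝟙 a ⟶ 𝟙 a) (f : F ⟶ F')
    (hf : p ≫ f = f) (hf' : f ≫ p' = f) :
    lftInv (𝟙 (𝟙 a)) p ≫ hcomp u f ≫ lft (𝟙 (𝟙 a)) p' = lact u f := by
  unfold lft lftInv lact
  rw [Category.assoc, ← Category.assoc (hcomp u f), ← interchange, ← Category.assoc (hcomp _ p),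
    ← interchange, Category.comp_id, Category.id_comp, hf', hf]

theorem rgt_ract {F F' : a ⟶ b} {p : F ⟶ F} {p' : F' ⟶ F'} (f : F ⟶ F') (u : 𝟙 b ⟶ 𝟙 b)
    (hf : p ≫ f = f) (hf' : f ≫ p' = f) :
    rgtInv p (𝟙 (𝟙 b)) ≫ hcomp f u ≫ rgt p' (𝟙 (𝟙 b)) = ract f u := by
  unfold rgt rgtInv ract
  rw [Category.assoc, ← Category.assoc (hcomp f u), ← interchange, ← Category.assoc (hcomp p _),
    ← interchange, Category.comp_id, Category.id_comp, hf', hf]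

theorem lact_hcomp {F F' : a ⟶ b} {G G' : b ⟶ c} (u : 𝟙 a ⟶ 𝟙 a) (f : F ⟶ F') (g : G ⟶ G') :
    lact u (hcomp f g) = hcomp (lact u f) g := by
  rw [lact_eq, lact_eq u f, ← Category.id_comp g, interchange, Category.id_comp]
  congr 1
  simp [lact, hcomp]

theorem ract_hcomp {F F' : a ⟶ b} {G G' : b ⟶ c} (u : 𝟙 c ⟶ 𝟙 c) (f : F ⟶ F') (g : G ⟶ G') :
    ract (hcomp f g) u = hcomp f (ract g u) := by
  rw [ract_eq, ract_eq u g, ← Category.id_comp f, interchange, Category.id_comp]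
  congr 1
  simp [ract, hcomp]

theorem hcomp_ract_lact {F F' : a ⟶ b} {G G' : b ⟶ c} (u : 𝟙 b ⟶ 𝟙 b) (f : F ⟶ F')
    (g : G ⟶ G') : hcomp (ract f u) g = hcomp f (lact u g) := by
  have h : hcomp (ract (𝟙 F) u) (𝟙 G) = hcomp (𝟙 F) (lact u (𝟙 G)) := by
    simp [ract, lact, hcomp]
  rw [ract_eq, lact_eq, ← Category.id_comp g, interchange, h, ← interchange, Category.id_comp,
    Category.id_comp]

/-- The horizontal composite of `u`, `f` and `u'`, up to unitors. -/
def cut {F F' : a ⟶ b} (u : 𝟙 a ⟶ 𝟙 a) (u' : 𝟙 b ⟶ 𝟙 b) (f : F ⟶ F') : F ⟶ F' :=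
  ract (lact u f) u'

theorem cut_comp {F F' F'' : a ⟶ b} {u : 𝟙 a ⟶ 𝟙 a} {u' : 𝟙 b ⟶ 𝟙 b} (hu : u ≫ u = u)
    (hu' : u' ≫ u' = u') (f : F ⟶ F') (g : F' ⟶ F'') :
    cut u u' (f ≫ g) = cut u u' f ≫ cut u u' g := by
  unfold cut
  rw [← ract_comp, ← lact_comp, hu, hu']

theorem cut_cut {F F' : a ⟶ b} {u : 𝟙 a ⟶ 𝟙 a} {u' : 𝟙 b ⟶ 𝟙 b} (hu : u ≫ u = u)
    (hu' : u' ≫ u' = u') (f : F ⟶ F') : cut u u' (cut u u' f) = cut u u' f := by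
  unfold cut
  rw [lact_ract, lact_lact, ract_ract, hu, hu']

theorem lact_of_cut {F F' : a ⟶ b} {u : 𝟙 a ⟶ 𝟙 a} {u' : 𝟙 b ⟶ 𝟙 b} (hu : u ≫ u = u)
    {f : F ⟶ F'} (hf : cut u u' f = f) : lact u f = f := by
  conv_lhs => rw [← hf]
  unfold cut
  rw [lact_ract, lact_lact, hu]
  exact hf

theorem ract_of_cut {F F' : a ⟶ b} {u : 𝟙 a ⟶ 𝟙 a} {u' : 𝟙 b ⟶ 𝟙 b} (hu' : u' ≫ u' = u')
    {f : F ⟶ F'} (hf : cut u u' f = f) : ract f u' = f := by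
  conv_lhs => rw [← hf]
  unfold cut
  rw [ract_ract, hu']
  exact hf

theorem cut_comp_right {F F' F'' : a ⟶ b} {u : 𝟙 a ⟶ 𝟙 a} {u' : 𝟙 b ⟶ 𝟙 b} (f : F ⟶ F')
    (g : F' ⟶ F'') : cut u u' (f ≫ g) = cut u u' f ≫ g := by
  unfold cut
  rw [lact_eq, ← Category.assoc, ← lact_eq, ract_eq, ← Category.assoc, ← ract_eq]

theorem cut_add [LocallyPreadditive B] {F F' : a ⟶ b} (u : 𝟙 a ⟶ 𝟙 a) (u' : 𝟙 b ⟶ 𝟙 b)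
    (f g : F ⟶ F') : cut u u' (f + g) = cut u u' f + cut u u' g := by
  simp [cut, lact, ract, LocallyPreadditive.hcomp_add, LocallyPreadditive.add_hcomp]

end KarAux

/-- An idempotent endomorphism is primitive if it is nonzero and the only idempotents below it are
zero and itself. -/
structure IsPrimitive {C : Type u} [Category.{v} C] [Preadditive C] {X : C} (e : X ⟶ X) : Prop where
  idem : e ≫ e = e
  ne_zero : e ≠ 0
  minimal : ∀ f : X ⟶ X, f ≫ f = f → e ≫ f = f → f ≫ e = f → f = 0 ∨ f = e

namespace Kar

variable {B : Type u} [Bicategory.{w, v} B] {a b c : Kar B}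

/-- The image of an idempotent 2-endomorphism `e` of a 1-morphism `F = (F, p)` of `Kar B`:
the direct summand `(F, e)` of `(F, p)`. -/
def summand (F : a ⟶ b) (e : F ⟶ F) (he : e ≫ e = e) : a ⟶ b :=
  (⟨(un F).X, two e, congrArg two he⟩ : Karoubi (a.obj ⟶ b.obj))

theorem two_hcomp {F F' : a ⟶ b} {G G' : b ⟶ c} (η : F ⟶ F') (θ : G ⟶ G') :
    two (hcomp η θ) = hcomp (two η) (two θ) := congrArg two (hcomp_eq η θ)

/-- The 2-endomorphism of `𝟙 a` in `B` underlying one in `Kar B`. -/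
def twoId (u : 𝟙 a ⟶ 𝟙 a) : 𝟙 a.obj ⟶ 𝟙 a.obj := two u

theorem two_lact {F F' : a ⟶ b} (u : 𝟙 a ⟶ 𝟙 a) (f : F ⟶ F') :
    two (lact u f) = lact (twoId u) (two f) :=
  (congrArg (fun x => lftInv (𝟙 (𝟙 a.obj)) (un F).p ≫ x ≫ lft (𝟙 (𝟙 a.obj)) (un F').p)
    (two_hcomp u f)).trans (lft_lact (twoId u) (two f) (p_two f) (two_p f))

theorem two_ract {F F' : a ⟶ b} (f : F ⟶ F') (u : 𝟙 b ⟶ 𝟙 b) :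
    two (ract f u) = ract (two f) (twoId u) :=
  (congrArg (fun x => rgtInv (un F).p (𝟙 (𝟙 b.obj)) ≫ x ≫ rgt (un F').p (𝟙 (𝟙 b.obj)))
    (two_hcomp f u)).trans (rgt_ract (two f) (twoId u) (p_two f) (two_p f))

theorem two_cut {F F' : a ⟶ b} (u : 𝟙 a ⟶ 𝟙 a) (u' : 𝟙 b ⟶ 𝟙 b) (f : F ⟶ F') :
    two (cut u u' f) = cut (twoId u) (twoId u') (two f) := by
  unfold cut
  rw [two_ract, two_lact]

end Kar

open Kar

/-- Objects of the bicategory obtained from `Kar B` by splitting the identity 1-morphisms: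
pairs `(i, ε)` where `i` is an object of `Kar B` and `ε` is a primitive idempotent of the
2-endomorphism algebra of `𝟙 i`. -/
structure Split (B : Type u) [Bicategory.{w, v} B] [LocallyPreadditive B] where
  obj : Kar B
  e : 𝟙 obj ⟶ 𝟙 obj
  prim : IsPrimitive e

namespace Split

variable {B : Type u} [Bicategory.{w, v} B] [LocallyPreadditive B]

/-- The 1-morphisms `(i, ε) ⟶ (j, δ)` are the 1-morphisms `i ⟶ j` of `Kar B`. -/
@[ext]
structure Mor (X Y : Split B) where
  mor : X.obj ⟶ Y.obj

instance : Quiver (Split B) where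
  Hom := Mor

/-- The 2-morphisms `F ⟶ G` between 1-morphisms `(i, ε) ⟶ (j, δ)` are the 2-morphisms of `Kar B`
which lie in the image of the idempotent operation of horizontal composition with `ε` and `δ` on
the two sides. -/
@[ext]
structure Mor₂ {X Y : Split B} (F G : X ⟶ Y) where
  hom : F.mor ⟶ G.mor
  cut_hom : cut X.e Y.e hom = hom

instance (X Y : Split B) : Category (X ⟶ Y) where
  Hom := Mor₂
  id F := ⟨cut X.e Y.e (𝟙 F.mor), cut_cut X.prim.idem Y.prim.idem _⟩
  comp f g := ⟨f.hom ≫ g.hom, by rw [cut_comp X.prim.idem Y.prim.idem, f.cut_hom, g.cut_hom]⟩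
  id_comp f := Mor₂.ext (by
    change cut X.e Y.e (𝟙 _) ≫ f.hom = f.hom
    conv_lhs => rw [← f.cut_hom]
    rw [← cut_comp X.prim.idem Y.prim.idem, Category.id_comp, f.cut_hom])
  comp_id f := Mor₂.ext (by
    change f.hom ≫ cut X.e Y.e (𝟙 _) = f.hom
    conv_lhs => rw [← f.cut_hom]
    rw [← cut_comp X.prim.idem Y.prim.idem, Category.comp_id, f.cut_hom])
  assoc f g h := Mor₂.ext (Category.assoc _ _ _)

theorem mid_idem {X Y Z : Split B} (F : X ⟶ Y) (G : Y ⟶ Z) :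
    hcomp (𝟙 F.mor) (lact Y.e (𝟙 G.mor)) ≫ hcomp (𝟙 F.mor) (lact Y.e (𝟙 G.mor)) =
      hcomp (𝟙 F.mor) (lact Y.e (𝟙 G.mor)) := by
  rw [← interchange, ← lact_comp, Y.prim.idem, Category.comp_id, Category.comp_id]

/-- The identity 1-morphism of `(i, ε)` is the identity 1-morphism of `i`. The composite of
`F : (i, ε) ⟶ (j, δ)` and `G : (j, δ) ⟶ (l, ζ)` is the direct summand of the composite of `F` and
`G` in `Kar B` given by the idempotent `𝟙 F ∘₀ δ ∘₀ 𝟙 G`. -/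
instance : CategoryStruct (Split B) where
  id X := ⟨𝟙 X.obj⟩
  comp {_ Y _} F G := ⟨summand (F.mor ≫ G.mor) (hcomp (𝟙 F.mor) (lact Y.e (𝟙 G.mor))) (mid_idem F G)⟩

/-- The idempotent of `B` underlying the identity 2-morphism of a 1-morphism of `Split B`. -/
def idp {X Y : Split B} (F : X ⟶ Y) : (un F.mor).X ⟶ (un F.mor).X :=
  cut (twoId X.e) (twoId Y.e) (un F.mor).p

/-- The 2-morphism of `B` underlying a 2-morphism of `Split B`. -/
def tw {X Y : Split B} {F G : X ⟶ Y} (f : F ⟶ G) : (un F.mor).X ⟶ (un G.mor).X := two f.hom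

theorem tw_ext {X Y : Split B} {F G : X ⟶ Y} {f g : F ⟶ G} (h : tw f = tw g) : f = g :=
  Mor₂.ext (two_ext h)

theorem tw_id {X Y : Split B} (F : X ⟶ Y) : tw (𝟙 F) = idp F := by
  refine (two_cut _ _ _).trans ?_
  rw [two_id]; rfl

theorem tw_comp {X Y : Split B} {F G H : X ⟶ Y} (f : F ⟶ G) (g : G ⟶ H) :
    tw (f ≫ g) = tw f ≫ tw g := rfl

theorem idp_idem {X Y : Split B} (F : X ⟶ Y) : idp F ≫ idp F = idp F := by
  rw [← tw_id, ← tw_comp, Category.comp_id]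

theorem idp_tw {X Y : Split B} {F G : X ⟶ Y} (f : F ⟶ G) : idp F ≫ tw f = tw f := by
  rw [← tw_id, ← tw_comp, Category.id_comp]

theorem tw_idp {X Y : Split B} {F G : X ⟶ Y} (f : F ⟶ G) : tw f ≫ idp G = tw f := by
  rw [← tw_id, ← tw_comp, Category.comp_id]

theorem two_idem (X : Split B) : twoId X.e ≫ twoId X.e = twoId X.e :=
  congrArg two X.prim.idem

theorem cut_tw {X Y : Split B} {F G : X ⟶ Y} (f : F ⟶ G) :
    cut (twoId X.e) (twoId Y.e) (tw f) = tw f := by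
  unfold tw
  rw [← two_cut, f.cut_hom]

theorem p_idp {X Y : Split B} (F : X ⟶ Y) : (un F.mor).p ≫ idp F = idp F := by
  rw [← tw_id]; exact p_two _

theorem idp_p {X Y : Split B} (F : X ⟶ Y) : idp F ≫ (un F.mor).p = idp F := by
  rw [← tw_id]; exact two_p _

theorem cut_idp {X Y : Split B} (F : X ⟶ Y) : cut (twoId X.e) (twoId Y.e) (idp F) = idp F := by
  rw [← tw_id]; exact cut_tw _

/-- Constructor for 2-morphisms of `Split B`. -/
def ofTw {X Y : Split B} {F G : X ⟶ Y} (f : (un F.mor).X ⟶ (un G.mor).X)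
    (h : idp F ≫ f ≫ idp G = f) : F ⟶ G where
  hom := ofTwo f (by
    rw [← h]
    simp only [Category.assoc, idp_p]
    rw [← Category.assoc, p_idp])
  cut_hom := two_ext (by
    rw [two_cut]
    change cut (twoId X.e) (twoId Y.e) f = f
    conv_lhs => rw [← h]
    rw [cut_comp_right, cut_idp, h])

theorem p_comp {X Y Z : Split B} (F : X ⟶ Y) (G : Y ⟶ Z) :
    (un (F ≫ G).mor).p = hcomp (un F.mor).p (lact (twoId Y.e) (un G.mor).p) := by
  refine (two_hcomp _ _).trans ?_
  rw [two_lact]; rfl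

theorem idp_comp {X Y Z : Split B} (F : X ⟶ Y) (G : Y ⟶ Z) :
    idp (F ≫ G) = hcomp (idp F) (idp G) := by
  unfold idp
  rw [p_comp]
  unfold cut
  refine (congrArg (ract · _) (lact_hcomp _ _ _)).trans ((ract_hcomp _ _ _).trans ?_)
  rw [hcomp_ract_lact, ← lact_ract, lact_ract, lact_ract, lact_lact, two_idem]

theorem idp_id (X : Split B) : idp (𝟙 X) = twoId X.e := by
  refine (congrArg (ract · (twoId X.e)) (lact_id_id (twoId X.e))).trans ?_
  rw [ract_eq, ract_id_id, two_idem]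

theorem lact_idp {X Y : Split B} (F : X ⟶ Y) : lact (twoId X.e) (idp F) = idp F :=
  lact_of_cut (two_idem X) (cut_idp F)

theorem ract_idp {X Y : Split B} (F : X ⟶ Y) : ract (idp F) (twoId Y.e) = idp F :=
  ract_of_cut (two_idem Y) (cut_idp F)

theorem tw_id_comp {X Y Z : Split B} (F : X ⟶ Y) (G : Y ⟶ Z) :
    tw (𝟙 (F ≫ G)) = hcomp (idp F) (idp G) := (tw_id _).trans (idp_comp F G)

theorem tw_id_comp₃ {X Y Z W : Split B} (F : X ⟶ Y) (G : Y ⟶ Z) (H : Z ⟶ W) :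
    tw (𝟙 ((F ≫ G) ≫ H)) = hcomp (hcomp (idp F) (idp G)) (idp H) :=
  (tw_id_comp (F ≫ G) H).trans (congrArg (hcomp · (idp H)) (idp_comp F G))

theorem tw_id_comp₃' {X Y Z W : Split B} (F : X ⟶ Y) (G : Y ⟶ Z) (H : Z ⟶ W) :
    tw (𝟙 (F ≫ G ≫ H)) = hcomp (idp F) (hcomp (idp G) (idp H)) :=
  (tw_id_comp F (G ≫ H)).trans (congrArg (hcomp (idp F) ·) (idp_comp G H))

theorem tw_id_left {X Y : Split B} (F : X ⟶ Y) :
    tw (𝟙 (𝟙 X ≫ F)) = hcomp (twoId X.e) (idp F) :=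
  (tw_id_comp (𝟙 X) F).trans (congrArg (hcomp · (idp F)) (idp_id X))

theorem tw_id_right {X Y : Split B} (F : X ⟶ Y) :
    tw (𝟙 (F ≫ 𝟙 Y)) = hcomp (idp F) (twoId Y.e) :=
  (tw_id_comp F (𝟙 Y)).trans (congrArg (hcomp (idp F) ·) (idp_id Y))

/-- Horizontal composition in `Split B` as a bicategory structure; all compositions of 2-morphisms
are induced from `B`. -/
def data : HCompData (Split B) where
  hcomp {X Y Z F F' G G'} η θ := ofTw (F := F ≫ G) (G := F' ≫ G') (hcomp (tw η) (tw θ)) (by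
    rw [idp_comp, idp_comp]
    refine (congrArg (_ ≫ ·) (interchange _ _ _ _).symm).trans ((interchange _ _ _ _).symm.trans ?_)
    rw [tw_idp, tw_idp, idp_tw, idp_tw])
  assoc F G H :=
    { hom := ofTw (F := (F ≫ G) ≫ H) (G := F ≫ G ≫ H) (asc (idp F) (idp G) (idp H)) (by
        rw [idp_comp, idp_comp, idp_comp, idp_comp]
        exact asc_comm (idp_idem F) (idp_idem G) (idp_idem H))
      inv := ofTw (F := F ≫ G ≫ H) (G := (F ≫ G) ≫ H) (ascInv (idp F) (idp G) (idp H)) (by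
        rw [idp_comp, idp_comp, idp_comp, idp_comp]
        exact ascInv_comm (idp_idem F) (idp_idem G) (idp_idem H))
      hom_inv_id := tw_ext ((asc_inv (idp_idem F) (idp_idem G) (idp_idem H)).trans
        (tw_id_comp₃ F G H).symm)
      inv_hom_id := tw_ext ((inv_asc (idp_idem F) (idp_idem G) (idp_idem H)).trans
        (tw_id_comp₃' F G H).symm) }
  left {X Y} F :=
    { hom := ofTw (F := 𝟙 X ≫ F) (G := F) (lft (twoId X.e) (idp F)) (by
        rw [idp_comp, idp_id]
        exact lft_comm (two_idem X) (idp_idem F) (lact_idp F))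
      inv := ofTw (F := F) (G := 𝟙 X ≫ F) (lftInv (twoId X.e) (idp F)) (by
        rw [idp_comp, idp_id]
        exact lftInv_comm (two_idem X) (idp_idem F) (lact_idp F))
      hom_inv_id := tw_ext ((lft_inv (two_idem X) (idp_idem F)).trans (tw_id_left F).symm)
      inv_hom_id := tw_ext ((lftInv_lft (two_idem X) (idp_idem F) (lact_idp F)).trans
        (tw_id F).symm) }
  right {X Y} F :=
    { hom := ofTw (F := F ≫ 𝟙 Y) (G := F) (rgt (idp F) (twoId Y.e)) (by
        rw [idp_comp, idp_id]
        exact rgt_comm (two_idem Y) (idp_idem F) (ract_idp F))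
      inv := ofTw (F := F) (G := F ≫ 𝟙 Y) (rgtInv (idp F) (twoId Y.e)) (by
        rw [idp_comp, idp_id]
        exact rgtInv_comm (two_idem Y) (idp_idem F) (ract_idp F))
      hom_inv_id := tw_ext ((rgt_inv (two_idem Y) (idp_idem F)).trans (tw_id_right F).symm)
      inv_hom_id := tw_ext ((rgtInv_rgt (two_idem Y) (idp_idem F) (ract_idp F)).trans
        (tw_id F).symm) }
  hcomp_id F G := tw_ext ((congrArg₂ hcomp (tw_id F) (tw_id G)).trans (tw_id_comp F G).symm)
  interchange η η' θ θ' := tw_ext (interchange (tw η) (tw η') (tw θ) (tw θ'))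
  assoc_nat η θ ζ := tw_ext (asc_nat (tw η) (tw θ) (tw ζ) (idp_tw η) (tw_idp η) (idp_tw θ)
    (tw_idp θ) (idp_tw ζ) (tw_idp ζ))
  left_nat {X Y F F'} η := tw_ext (by
    refine (congrArg (fun x => hcomp x (tw η) ≫ lft (twoId X.e) (idp F'))
      ((tw_id (𝟙 X)).trans (idp_id X))).trans ?_
    exact lft_nat (two_idem X) (tw η) (idp_tw η) (tw_idp η))
  right_nat {X Y F F'} η := tw_ext (by
    refine (congrArg (fun x => hcomp (tw η) x ≫ rgt (idp F') (twoId Y.e))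
      ((tw_id (𝟙 Y)).trans (idp_id Y))).trans ?_
    exact rgt_nat (two_idem Y) (tw η) (idp_tw η) (tw_idp η))
  pentagon F G H I := tw_ext (by
    refine Eq.trans (b := hcomp (asc (idp F) (idp G) (idp H)) (idp I) ≫
      asc (idp F) (hcomp (idp G) (idp H)) (idp I) ≫ hcomp (idp F) (asc (idp G) (idp H) (idp I))) ?_ ?_
    · have h : ∀ x y z, x = idp I → y = hcomp (idp G) (idp H) → z = idp F →
          hcomp (asc (idp F) (idp G) (idp H)) x ≫ asc (idp F) y (idp I) ≫
            hcomp z (asc (idp G) (idp H) (idp I)) =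
          hcomp (asc (idp F) (idp G) (idp H)) (idp I) ≫
            asc (idp F) (hcomp (idp G) (idp H)) (idp I) ≫
              hcomp (idp F) (asc (idp G) (idp H) (idp I)) := by
        rintro _ _ _ rfl rfl rfl; rfl
      exact h _ _ _ (tw_id I) (idp_comp G H) (tw_id F)
    · refine (pent (idp_idem F) (idp_idem G) (idp_idem H) (idp_idem I)).trans ?_
      have h : ∀ x y, x = hcomp (idp F) (idp G) → y = hcomp (idp H) (idp I) →
          asc (hcomp (idp F) (idp G)) (idp H) (idp I) ≫ asc (idp F) (idp G) (hcomp (idp H) (idp I)) =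
          asc x (idp H) (idp I) ≫ asc (idp F) (idp G) y := by
        rintro _ _ rfl rfl; rfl
      exact h _ _ (idp_comp F G) (idp_comp H I))
  triangle {X Y Z} F G := tw_ext (by
    have h : ∀ x y z, x = twoId Y.e → y = idp F → z = idp G →
        asc (idp F) x (idp G) ≫ hcomp y (lft (twoId Y.e) (idp G)) =
        hcomp (rgt (idp F) (twoId Y.e)) z := by
      rintro _ _ _ rfl rfl rfl
      exact tri (idp_idem F) (two_idem Y) (idp_idem G)
    exact h _ _ _ (idp_id Y) (tw_id F) (tw_id G))

instance : Bicategory (Split B) := data.toBicategory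

theorem hcomp_eq {X Y Z : Split B} {F F' : X ⟶ Y} {G G' : Y ⟶ Z} (η : F ⟶ F') (θ : G ⟶ G') :
    hcomp η θ = data.hcomp η θ := by
  refine (data.interchange _ _ _ _).symm.trans ?_
  rw [Category.comp_id, Category.id_comp]

section Additive

variable {X Y : Split B}

theorem cut_zero (F G : X ⟶ Y) : cut X.e Y.e (0 : F.mor ⟶ G.mor) = 0 :=
  (AddMonoidHom.mk' (fun f : F.mor ⟶ G.mor => cut X.e Y.e f) (cut_add X.e Y.e)).map_zero

theorem cut_neg (F G : X ⟶ Y) (f : F.mor ⟶ G.mor) : cut X.e Y.e (-f) = -cut X.e Y.e f :=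
  (AddMonoidHom.mk' (fun f : F.mor ⟶ G.mor => cut X.e Y.e f) (cut_add X.e Y.e)).map_neg f

instance (F G : X ⟶ Y) : Add (F ⟶ G) where
  add f g := ⟨f.hom + g.hom, by rw [cut_add, f.cut_hom, g.cut_hom]⟩

instance (F G : X ⟶ Y) : Zero (F ⟶ G) where
  zero := ⟨0, cut_zero F G⟩

instance (F G : X ⟶ Y) : Neg (F ⟶ G) where
  neg f := ⟨-f.hom, by rw [cut_neg, f.cut_hom]⟩

instance (F G : X ⟶ Y) : AddCommGroup (F ⟶ G) where
  add_assoc f g h := Mor₂.ext (add_assoc f.hom g.hom h.hom)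
  zero_add f := Mor₂.ext (zero_add f.hom)
  add_zero f := Mor₂.ext (add_zero f.hom)
  add_comm f g := Mor₂.ext (add_comm f.hom g.hom)
  neg_add_cancel f := Mor₂.ext (neg_add_cancel f.hom)
  nsmul := nsmulRec
  zsmul := zsmulRec

instance : Preadditive (X ⟶ Y) where
  add_comp _ _ _ f f' g := Mor₂.ext (Preadditive.add_comp _ _ _ f.hom f'.hom g.hom)
  comp_add _ _ _ f g g' := Mor₂.ext (Preadditive.comp_add _ _ _ f.hom g.hom g'.hom)

/-- The image in `X ⟶ Y` of a 2-morphism of `Kar B`. -/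
def proj (F G : X ⟶ Y) (f : F.mor ⟶ G.mor) : F ⟶ G :=
  ⟨cut X.e Y.e f, cut_cut X.prim.idem Y.prim.idem f⟩

theorem proj_comp {F G H : X ⟶ Y} (f : F.mor ⟶ G.mor) (g : G.mor ⟶ H.mor) :
    proj F G f ≫ proj G H g = proj F H (f ≫ g) :=
  Mor₂.ext (cut_comp X.prim.idem Y.prim.idem f g).symm

theorem proj_add {F G : X ⟶ Y} (f g : F.mor ⟶ G.mor) :
    proj F G (f + g) = proj F G f + proj F G g := Mor₂.ext (cut_add _ _ f g)

instance [∀ a b : B, HasFiniteBiproducts (a ⟶ b)] : HasBinaryBiproducts (X ⟶ Y) where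
  has_binary_biproduct F G :=
    HasBinaryBiproduct.mk
    { bicone :=
        { pt := ⟨F.mor ⊞ G.mor⟩
          fst := proj _ _ biprod.fst
          snd := proj _ _ biprod.snd
          inl := proj _ _ biprod.inl
          inr := proj _ _ biprod.inr
          inl_fst := by rw [proj_comp, biprod.inl_fst]; rfl
          inl_snd := by rw [proj_comp, biprod.inl_snd]; exact Mor₂.ext (cut_zero F G)
          inr_fst := by rw [proj_comp, biprod.inr_fst]; exact Mor₂.ext (cut_zero G F)
          inr_snd := by rw [proj_comp, biprod.inr_snd]; rfl }
      isBilimit := isBinaryBilimitOfTotal _ ((congrArg₂ (· + ·) (proj_comp _ _) (proj_comp _ _)).trans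
        ((proj_add _ _).symm.trans (congrArg (proj _ _) biprod.total))) }

end Additive

instance : LocallyPreadditive (Split B) where
  preadditive _ _ := inferInstance
  hcomp_add η θ θ' := by
    simp only [hcomp_eq]
    exact tw_ext (LocallyPreadditive.hcomp_add _ _ _)
  add_hcomp η η' θ := by
    simp only [hcomp_eq]
    exact tw_ext (LocallyPreadditive.add_hcomp _ _ _)

end Split

end Split

/-! ### Grothendieck decategorification -/

section Groth

open Bicategory

/-- The split Grothendieck group of an additive category: the abelian group generated by the
objects, with the relations `[Z] = [X] + [Y]` whenever `Z` is isomorphic to `X ⊞ Y`. -/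
def K0 (C : Type u) [Category.{v} C] [Preadditive C] [HasBinaryBiproducts C] : Type u :=
  FreeAbelianGroup C ⧸ AddSubgroup.closure
    {x : FreeAbelianGroup C | ∃ X Y Z : C, Nonempty (Z ≅ X ⊞ Y) ∧
      x = FreeAbelianGroup.of Z - (FreeAbelianGroup.of X + FreeAbelianGroup.of Y)}

namespace K0

variable {C : Type u} [Category.{v} C] [Preadditive C] [HasBinaryBiproducts C]

instance : AddCommGroup (K0 C) := inferInstanceAs (AddCommGroup (_ ⧸ _))

/-- The class of an object. -/
def of (X : C) : K0 C := QuotientAddGroup.mk (FreeAbelianGroup.of X)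

theorem of_biprod {X Y Z : C} (h : Z ≅ X ⊞ Y) : of Z = of X + of Y := by
  have : (QuotientAddGroup.mk (FreeAbelianGroup.of Z -
      (FreeAbelianGroup.of X + FreeAbelianGroup.of Y)) : K0 C) = 0 :=
    (QuotientAddGroup.eq_zero_iff _).2 (AddSubgroup.subset_closure ⟨X, Y, Z, ⟨h⟩, rfl⟩)
  exact sub_eq_zero.1 this

theorem of_iso {X Y : C} (h : X ≅ Y) : of X = of Y := by
  have h1 := of_biprod (Iso.refl (X ⊞ X))
  have h2 := of_biprod (biprod.mapIso h (Iso.refl X))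
  exact add_right_cancel (h1.symm.trans h2)

/-- An additive function on objects extends to the split Grothendieck group. -/
def lift {A : Type*} [AddCommGroup A] (φ : C → A)
    (h : ∀ X Y Z : C, (Z ≅ X ⊞ Y) → φ Z = φ X + φ Y) : K0 C →+ A :=
  QuotientAddGroup.lift _ (FreeAbelianGroup.lift φ) (by
    rw [AddSubgroup.closure_le]
    rintro _ ⟨X, Y, Z, ⟨e⟩, rfl⟩
    simp [h X Y Z e])

theorem lift_of {A : Type*} [AddCommGroup A] (φ : C → A)
    (h : ∀ X Y Z : C, (Z ≅ X ⊞ Y) → φ Z = φ X + φ Y) (X : C) : lift φ h (of X) = φ X :=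
  FreeAbelianGroup.lift_apply_of φ X

theorem hom_ext {A : Type*} [AddCommGroup A] {f g : K0 C →+ A} (h : ∀ X, f (of X) = g (of X)) :
    f = g := by
  apply QuotientAddGroup.addMonoidHom_ext
  exact FreeAbelianGroup.lift_ext _ _ h

theorem ind {P : K0 C → Prop} (x : K0 C) (zero : P 0) (of : ∀ X, P (of X)) (neg : ∀ x, P x → P (-x))
    (add : ∀ x y, P x → P y → P (x + y)) : P x := by
  obtain ⟨x, rfl⟩ := QuotientAddGroup.mk_surjective x
  have hn : ∀ X, P (QuotientAddGroup.mk (FreeAbelianGroup.of X)) := of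
  induction x using FreeAbelianGroup.induction_on with
  | zero => exact zero
  | of X => exact hn X
  | neg X _ => exact neg _ (hn X)
  | add x y hx hy => exact add _ _ hx hy

end K0

variable {B : Type u} [Bicategory.{w, v} B] [LocallyPreadditive B]

theorem whiskerLeft_add' {a b c : B} (F : a ⟶ b) {G G' : b ⟶ c} (η θ : G ⟶ G') :
    F ◁ (η + θ) = F ◁ η + F ◁ θ := by
  simpa [hcomp] using LocallyPreadditive.hcomp_add (𝟙 F) η θ

theorem add_whiskerRight' {a b c : B} {F F' : a ⟶ b} (η θ : F ⟶ F') (G : b ⟶ c) :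
    (η + θ) ▷ G = η ▷ G + θ ▷ G := by
  simpa [hcomp] using LocallyPreadditive.add_hcomp η θ (𝟙 G)

variable [∀ a b : B, HasBinaryBiproducts (a ⟶ b)]

/-- Composition of 1-morphisms preserves biproducts in the second argument. -/
def compBiprod {a b c : B} (F : a ⟶ b) {X Y Z : b ⟶ c} (e : Z ≅ X ⊞ Y) :
    F ≫ Z ≅ (F ≫ X) ⊞ (F ≫ Y) :=
  have h0 : ∀ {U V : b ⟶ c}, F ◁ (0 : U ⟶ V) = 0 := fun {U V} =>
    (AddMonoidHom.mk' (fun η : U ⟶ V => F ◁ η) (whiskerLeft_add' F)).map_zero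
  whiskerLeftIso F e ≪≫ biprod.uniqueUpToIso _ _ (b :=
    { pt := F ≫ (X ⊞ Y)
      fst := F ◁ biprod.fst
      snd := F ◁ biprod.snd
      inl := F ◁ biprod.inl
      inr := F ◁ biprod.inr
      inl_fst := by rw [← whiskerLeft_comp, biprod.inl_fst, whiskerLeft_id]
      inl_snd := by rw [← whiskerLeft_comp, biprod.inl_snd, h0]
      inr_fst := by rw [← whiskerLeft_comp, biprod.inr_fst, h0]
      inr_snd := by rw [← whiskerLeft_comp, biprod.inr_snd, whiskerLeft_id] })
    (isBinaryBilimitOfTotal _ ((congrArg₂ (· + ·) (whiskerLeft_comp F _ _).symm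
      (whiskerLeft_comp F _ _).symm).trans ((whiskerLeft_add' F _ _).symm.trans
        ((congrArg (F ◁ ·) biprod.total).trans (whiskerLeft_id F _)))))

/-- Composition of 1-morphisms preserves biproducts in the first argument. -/
def biprodComp {a b c : B} {X Y Z : a ⟶ b} (e : Z ≅ X ⊞ Y) (G : b ⟶ c) :
    Z ≫ G ≅ (X ≫ G) ⊞ (Y ≫ G) :=
  have h0 : ∀ {U V : a ⟶ b}, (0 : U ⟶ V) ▷ G = 0 := fun {U V} =>
    (AddMonoidHom.mk' (fun η : U ⟶ V => η ▷ G) (fun η θ => add_whiskerRight' η θ G)).map_zero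
  whiskerRightIso e G ≪≫ biprod.uniqueUpToIso _ _ (b :=
    { pt := (X ⊞ Y) ≫ G
      fst := biprod.fst ▷ G
      snd := biprod.snd ▷ G
      inl := biprod.inl ▷ G
      inr := biprod.inr ▷ G
      inl_fst := by rw [← comp_whiskerRight, biprod.inl_fst, id_whiskerRight]
      inl_snd := by rw [← comp_whiskerRight, biprod.inl_snd, h0]
      inr_fst := by rw [← comp_whiskerRight, biprod.inr_fst, h0]
      inr_snd := by rw [← comp_whiskerRight, biprod.inr_snd, id_whiskerRight] })
    (isBinaryBilimitOfTotal _ ((congrArg₂ (· + ·) (comp_whiskerRight _ _ G).symm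
      (comp_whiskerRight _ _ G).symm).trans ((add_whiskerRight' _ _ G).symm.trans
        ((congrArg (· ▷ G) biprod.total).trans (id_whiskerRight _ G)))))

/-- The composition of the Grothendieck decategorification, induced by composition of
1-morphisms: `[G] ∘ [F] = [G ∘ F]`. -/
def K0.comp (a b c : B) : K0 (b ⟶ c) →+ K0 (a ⟶ b) →+ K0 (a ⟶ c) :=
  K0.lift (fun G => K0.lift (fun F => K0.of (F ≫ G))
      (fun _ _ _ e => K0.of_biprod (biprodComp e G)))
    (fun X Y Z e => K0.hom_ext fun F => by
      rw [AddMonoidHom.add_apply, K0.lift_of, K0.lift_of, K0.lift_of]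
      exact K0.of_biprod (compBiprod F e))

theorem K0.comp_of {a b c : B} (G : b ⟶ c) (F : a ⟶ b) :
    K0.comp a b c (K0.of G) (K0.of F) = K0.of (F ≫ G) := by
  rw [K0.comp, K0.lift_of, K0.lift_of]

theorem K0.comp_assoc {a b c d : B} (x : K0 (c ⟶ d)) (y : K0 (b ⟶ c)) (z : K0 (a ⟶ b)) :
    K0.comp a b d (K0.comp b c d x y) z = K0.comp a c d x (K0.comp a b c y z) := by
  induction x using K0.ind with
  | zero => simp only [map_zero, AddMonoidHom.zero_apply]
  | neg x hx => simp only [map_neg, AddMonoidHom.neg_apply, hx]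
  | add x x' hx hx' => simp only [map_add, AddMonoidHom.add_apply, hx, hx']
  | of H =>
  induction y using K0.ind with
  | zero => simp only [map_zero, AddMonoidHom.zero_apply]
  | neg x hx => simp only [map_neg, AddMonoidHom.neg_apply, hx]
  | add x x' hx hx' => simp only [map_add, AddMonoidHom.add_apply, hx, hx']
  | of G =>
  induction z using K0.ind with
  | zero => simp only [map_zero]
  | neg x hx => simp only [map_neg, hx]
  | add x x' hx hx' => simp only [map_add, hx, hx']
  | of F =>
    rw [K0.comp_of, K0.comp_of, K0.comp_of, K0.comp_of]
    exact K0.of_iso (α_ F G H).symm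

variable (B) in
/-- The decategorification of `B`: the direct sum over all pairs of objects `i`, `j` of the split
Grothendieck groups of the categories of 1-morphisms `i ⟶ j`. -/
def Groth : Type (max u v) :=
  DirectSum (B × B) fun p => K0 (p.1 ⟶ p.2)

namespace Groth

instance : AddCommGroup (Groth B) := inferInstanceAs (AddCommGroup (DirectSum _ _))

open scoped Classical in
/-- The inclusion of a summand. -/
def incl (a b : B) : K0 (a ⟶ b) →+ Groth B := DirectSum.of (fun p : B × B => K0 (p.1 ⟶ p.2)) (a, b)

/-- The class of a 1-morphism. -/
def cls {a b : B} (F : a ⟶ b) : Groth B := incl a b (K0.of F)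

open scoped Classical in
/-- The product of homogeneous elements: composition if the elements are composable and zero
otherwise. -/
def homMul (p q : B × B) : K0 (p.1 ⟶ p.2) →+ K0 (q.1 ⟶ q.2) →+ Groth B :=
  if h : q.2 = p.1 then
    match p, q, h with
    | (_, c), (a, b), rfl => (K0.comp a b c).compr₂ (incl a c)
  else 0

open scoped Classical in
/-- The multiplication of the decategorification, as a biadditive map. -/
def mulHom : Groth B →+ Groth B →+ Groth B :=
  DirectSum.toAddMonoid fun p => (DirectSum.toAddMonoid fun q => (homMul p q).flip).flip

instance : Mul (Groth B) where
  mul x y := mulHom x y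

theorem mul_def (x y : Groth B) : x * y = mulHom x y := rfl

theorem incl_mul {p q : B × B} (x : K0 (p.1 ⟶ p.2)) (y : K0 (q.1 ⟶ q.2)) :
    incl p.1 p.2 x * incl q.1 q.2 y = homMul p q x y := by
  classical
  have h1 := DirectSum.toAddMonoid_of
    (fun p : B × B => (DirectSum.toAddMonoid fun q => (homMul p q).flip).flip) p x
  have h2 := DirectSum.toAddMonoid_of (fun q => (homMul p q).flip) q y
  exact (DFunLike.congr_fun h1 _).trans (DFunLike.congr_fun h2 x)

theorem incl_mul_incl {a b c : B} (x : K0 (b ⟶ c)) (y : K0 (a ⟶ b)) :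
    incl b c x * incl a b y = incl a c (K0.comp a b c x y) := by
  refine (incl_mul (p := (b, c)) (q := (a, b)) x y).trans ?_
  rw [homMul, dif_pos rfl]
  rfl

theorem incl_mul_incl_ne {a b b' c : B} (h : b ≠ b') (x : K0 (b' ⟶ c)) (y : K0 (a ⟶ b)) :
    incl b' c x * incl a b y = 0 := by
  refine (incl_mul (p := (b', c)) (q := (a, b)) x y).trans ?_
  rw [homMul, dif_neg h]
  rfl

theorem ind {P : Groth B → Prop} (x : Groth B) (h0 : P 0) (hi : ∀ a b y, P (incl a b y))
    (ha : ∀ x y, P x → P y → P (x + y)) : P x := by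
  classical
  exact DirectSum.induction_on x h0 (fun p y => hi p.1 p.2 y) ha

/-- The decategorification is a ring (with unit the sum of the classes of the identity
1-morphisms if there are finitely many objects). -/
instance : NonUnitalRing (Groth B) where
  left_distrib x y z := (mulHom x).map_add y z
  right_distrib x y z := by simp only [mul_def, map_add, AddMonoidHom.add_apply]
  zero_mul x := by simp only [mul_def, map_zero, AddMonoidHom.zero_apply]
  mul_zero x := (mulHom x).map_zero
  mul_assoc x y z := by
    have hz : ∀ t : Groth B, 0 * t = 0 := fun t => by
      simp only [mul_def, map_zero, AddMonoidHom.zero_apply]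
    have hz' : ∀ t : Groth B, t * 0 = 0 := fun t => (mulHom t).map_zero
    have hd : ∀ s t r : Groth B, (s + t) * r = s * r + t * r := fun s t r => by
      simp only [mul_def, map_add, AddMonoidHom.add_apply]
    have hd' : ∀ s t r : Groth B, s * (t + r) = s * t + s * r := fun s t r => (mulHom s).map_add t r
    induction x using ind with
    | h0 => simp only [hz]
    | ha x x' hx hx' => simp only [hd, hx, hx']
    | hi c d x =>
    induction y using ind with
    | h0 => simp only [hz, hz']
    | ha y y' hy hy' => simp only [hd, hd', hy, hy']
    | hi b c' y =>
    induction z using ind with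
    | h0 => simp only [hz']
    | ha z z' h h' => simp only [hd', h, h']
    | hi a b' z =>
      by_cases h1 : c' = c
      · subst h1
        rw [incl_mul_incl]
        by_cases h2 : b' = b
        · subst h2
          rw [incl_mul_incl, incl_mul_incl, incl_mul_incl, K0.comp_assoc]
        · rw [incl_mul_incl_ne h2, incl_mul_incl_ne h2, hz']
      · rw [incl_mul_incl_ne h1, hz]
        by_cases h2 : b' = b
        · subst h2
          rw [incl_mul_incl, incl_mul_incl_ne h1]
        · rw [incl_mul_incl_ne h2, hz']

end Groth

end Groth

/-! ### The bicategory `k𝒞` of a bicategory `𝒞` -/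

section Finitarization

/-- The `k`-finitarization of a bicategory: pass to formal `k`-linear combinations of 2-morphisms,
then to additive envelopes of the categories of 1-morphisms, then to idempotent completions. -/
abbrev Fin2 (k : Type*) (C : Type*) [CommRing k] [Bicategory.{w, v} C] :=
  Kar (AddEnv (Lin k C))

/-- The `k`-finitarization with all identity 1-morphisms split by primitive idempotents. -/
abbrev SplitFin2 (k : Type*) (C : Type*) [CommRing k] [Bicategory.{w, v} C] :=
  Split (AddEnv (Lin k C))

variable (k : Type*) {C : Type*} [CommRing k] [Bicategory.{w, v} C]

/-- An object of `C` as an object of its finitarization. -/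
def Fin2.obj (i : C) : Fin2 k C := ⟨⟨⟨i⟩⟩⟩

/-- A 1-morphism of `C` as a 1-morphism of its finitarization. -/
def Fin2.mor {i j : C} (F : i ⟶ j) : Fin2.obj k i ⟶ Fin2.obj k j :=
  Kar.mor1 (AddEnv.mor1 (Lin.mor1 (k := k) F))

/-- A linear combination of 2-endomorphisms of the identity 1-morphism of `i` as a 2-endomorphism
of the identity 1-morphism of `i` in the finitarization. -/
def Fin2.endId {k : Type*} {C : Type*} [CommRing k] [Bicategory.{w, v} C] (i : C)
    (x : (𝟙 i ⟶ 𝟙 i) →₀ k) : 𝟙 (Fin2.obj k i) ⟶ 𝟙 (Fin2.obj k i) :=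
  Kar.ofTwo (AddEnv.ofEnt (F := 𝟙 (⟨⟨i⟩⟩ : AddEnv (Lin k C))) (G := 𝟙 (⟨⟨i⟩⟩ : AddEnv (Lin k C)))
    (fun _ _ => (x : (𝟙 (⟨i⟩ : Lin k C) : (⟨i⟩ : Lin k C) ⟶ ⟨i⟩) ⟶ 𝟙 _)))
    ((Category.id_comp _).trans (Category.comp_id _))

end Finitarization

/-! ### The bicategory of an ordered monoid -/

section Ordered

/-- The (unique) object of the bicategory of an ordered monoid `S`. -/
inductive OrdTwo (S : Type u)
  | pt

namespace OrdTwo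

variable {S : Type u} [Monoid S] [PartialOrder S]

instance : Quiver (OrdTwo S) where
  Hom _ _ := S

/-- An element of `S` as a 1-morphism. -/
def mor (s : S) : (pt : OrdTwo S) ⟶ pt := s

/-- The element of `S` underlying a 1-morphism. -/
def val {a b : OrdTwo S} (s : a ⟶ b) : S := s

/-- Composition of 1-morphisms is multiplication: the composite of `s` followed by `t` is `ts`. -/
instance : CategoryStruct (OrdTwo S) where
  id _ := (1 : S)
  comp s t := (val t * val s : S)

/-- There is exactly one 2-morphism `s ⟶ t` if `s ≤ t` and none otherwise. -/
instance (a b : OrdTwo S) : Category.{0} (a ⟶ b) where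
  Hom s t := PLift (val s ≤ val t)
  id s := ⟨le_refl (val s)⟩
  comp h h' := ⟨h.down.trans h'.down⟩

theorem two_ext {S : Type u} [Monoid S] [PartialOrder S] {a b : OrdTwo S} {s t : a ⟶ b}
    (f g : s ⟶ t) : f = g :=
  Subsingleton.elim (α := PLift (val s ≤ val t)) f g

/-- Equal 1-morphisms are isomorphic. -/
def isoOfEq {a b : OrdTwo S} {s t : a ⟶ b} (h : val s = val t) : s ≅ t where
  hom := ⟨h.le⟩
  inv := ⟨h.ge⟩
  hom_inv_id := two_ext _ _
  inv_hom_id := two_ext _ _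

variable [MulLeftMono S] [MulRightMono S]

instance : Bicategory.{0} (OrdTwo S) := HCompData.toBicategory
  { hcomp := fun η θ => ⟨mul_le_mul' θ.down η.down⟩
    assoc := fun f g h => isoOfEq (mul_assoc (val h) (val g) (val f)).symm
    left := fun f => isoOfEq (mul_one (val f))
    right := fun f => isoOfEq (one_mul (val f))
    hcomp_id := fun _ _ => two_ext _ _
    interchange := fun _ _ _ _ => two_ext _ _
    assoc_nat := fun _ _ _ => two_ext _ _
    left_nat := fun _ => two_ext _ _
    right_nat := fun _ => two_ext _ _
    pentagon := fun _ _ _ _ => two_ext _ _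
    triangle := fun _ _ => two_ext _ _ }

end OrdTwo

end Ordered

/-! ### The first extension of the symmetric group to a bicategory -/

section SymTwo

open scoped SetRel

/-- The (unique) object of the bicategory `𝒜ₙ`. -/
inductive SymTwo (n : ℕ)
  | pt

namespace SymTwo

variable {n : ℕ}

/-- The 1-morphisms are the permutations of `Fin n`. -/
instance : Quiver (SymTwo n) where
  Hom _ _ := Equiv.Perm (Fin n)

/-- A permutation as a 1-morphism. -/
def mor (σ : Equiv.Perm (Fin n)) : (pt : SymTwo n) ⟶ pt := σ

/-- The permutation underlying a 1-morphism. -/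
def val {a b : SymTwo n} (σ : a ⟶ b) : Equiv.Perm (Fin n) := σ

/-- Composition of 1-morphisms is composition of permutations: the composite of `σ` followed by `τ`
is `τσ`. -/
instance : CategoryStruct (SymTwo n) where
  id _ := (1 : Equiv.Perm (Fin n))
  comp σ τ := (val τ * val σ : Equiv.Perm (Fin n))

/-- A permutation as a binary relation on `Fin n`, relating `x` to `σ x`. -/
def graph (σ : Equiv.Perm (Fin n)) : SetRel (Fin n) (Fin n) := {p | σ p.1 = p.2}

/-- The 2-morphisms `σ ⟶ τ` are the binary relations contained in `σ ∩ τ`; vertical composition is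
intersection. -/
instance (a b : SymTwo n) : Category.{0} (a ⟶ b) where
  Hom σ τ := {α : SetRel (Fin n) (Fin n) // α ⊆ graph (val σ) ∩ graph (val τ)}
  id σ := ⟨graph (val σ), by simp⟩
  comp α β := ⟨β.1 ∩ α.1, fun _ h => ⟨(α.2 h.2).1, (β.2 h.1).2⟩⟩
  id_comp α := Subtype.ext (Set.inter_eq_left.2 fun _ h => (α.2 h).1)
  comp_id α := Subtype.ext (Set.inter_eq_right.2 fun _ h => (α.2 h).2)
  assoc α β γ := Subtype.ext (Set.inter_assoc _ _ _).symm

/-- The relation underlying a 2-morphism. -/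
def rel {a b : SymTwo n} {σ τ : a ⟶ b} (α : σ ⟶ τ) : SetRel (Fin n) (Fin n) := α.1

theorem rel_sub {a b : SymTwo n} {σ τ : a ⟶ b} (α : σ ⟶ τ) :
    rel α ⊆ graph (val σ) ∩ graph (val τ) := α.2

theorem two_ext {a b : SymTwo n} {σ τ : a ⟶ b} {α β : σ ⟶ τ} (h : rel α = rel β) : α = β :=
  Subtype.ext h

theorem rel_comp {a b : SymTwo n} {σ τ ρ : a ⟶ b} (α : σ ⟶ τ) (β : τ ⟶ ρ) :
    rel (α ≫ β) = rel β ∩ rel α := rfl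

/-- Horizontal composition of 2-morphisms is composition of binary relations. -/
def hc {a b c : SymTwo n} {σ σ' : a ⟶ b} {τ τ' : b ⟶ c} (α : σ ⟶ σ') (β : τ ⟶ τ') :
    σ ≫ τ ⟶ σ' ≫ τ' :=
  ⟨rel α ○ rel β, by
    rintro ⟨x, z⟩ ⟨y, h1, h2⟩
    obtain ⟨h3, h4⟩ := rel_sub α h1
    obtain ⟨h5, h6⟩ := rel_sub β h2
    exact ⟨(congrArg (val τ) h3).trans h5, (congrArg (val τ') h4).trans h6⟩⟩

/-- Equal 1-morphisms are isomorphic via the identity 2-morphism. -/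
def isoOfEq {a b : SymTwo n} {σ τ : a ⟶ b} (h : val σ = val τ) : σ ≅ τ where
  hom := ⟨graph (val σ), by rw [h]; simp⟩
  inv := ⟨graph (val σ), by rw [h]; simp⟩
  hom_inv_id := two_ext (Set.inter_self _)
  inv_hom_id := two_ext ((Set.inter_self _).trans (congrArg graph h))

theorem nat_iso {a b : SymTwo n} {σ τ σ' τ' : a ⟶ b} (h : val σ = val σ') (h' : val τ = val τ')
    (α : σ ⟶ τ) (β : σ' ⟶ τ') (e : rel α = rel β) :
    α ≫ (isoOfEq h').hom = (isoOfEq h).hom ≫ β := by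
  apply two_ext
  rw [rel_comp, rel_comp, e]
  change graph (val τ) ∩ _ = _ ∩ graph (val σ)
  rw [h, h', Set.inter_eq_right.2 fun _ h => (rel_sub β h).2,
    Set.inter_eq_left.2 fun _ h => (rel_sub β h).1]

theorem graph_comp (σ τ : Equiv.Perm (Fin n)) : graph σ ○ graph τ = graph (τ * σ) := by
  ext ⟨x, z⟩
  constructor
  · rintro ⟨y, h1, h2⟩
    exact (congrArg τ h1).trans h2
  · intro h
    exact ⟨σ x, rfl, h⟩

theorem id_rel {α : SetRel (Fin n) (Fin n)} : graph 1 ○ α = α := by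
  ext ⟨x, z⟩
  constructor
  · rintro ⟨y, h1, h2⟩
    obtain rfl : x = y := h1
    exact h2
  · intro h
    exact ⟨x, rfl, h⟩

theorem rel_id {α : SetRel (Fin n) (Fin n)} : α ○ graph 1 = α := by
  ext ⟨x, z⟩
  constructor
  · rintro ⟨y, h1, h2⟩
    obtain rfl : y = z := h2
    exact h1
  · intro h
    exact ⟨z, h, rfl⟩

theorem rel_comp_graph {a b : SymTwo n} {σ τ ρ : a ⟶ b} {α : σ ⟶ τ} {β : τ ⟶ ρ}
    {π : Equiv.Perm (Fin n)} (hα : rel α = graph π) (hβ : rel β = graph π) :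
    rel (α ≫ β) = graph π := by
  rw [rel_comp, hα, hβ, Set.inter_self]

theorem rel_hc_graph {a b c : SymTwo n} {σ σ' : a ⟶ b} {τ τ' : b ⟶ c} {α : σ ⟶ σ'} {β : τ ⟶ τ'}
    {π ρ π' : Equiv.Perm (Fin n)} (hα : rel α = graph π) (hβ : rel β = graph ρ) (h : ρ * π = π') :
    rel (hc α β) = graph π' := by
  change rel α ○ rel β = _
  rw [hα, hβ, graph_comp, h]

instance : Bicategory.{0} (SymTwo n) := HCompData.toBicategory
  { hcomp := hc
    assoc := fun f g h => isoOfEq (mul_assoc (val h) (val g) (val f)).symm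
    left := fun f => isoOfEq (mul_one (val f))
    right := fun f => isoOfEq (one_mul (val f))
    hcomp_id := fun f g => two_ext (graph_comp (val f) (val g))
    interchange := fun η η' θ θ' => two_ext (by
      ext ⟨x, z⟩
      constructor
      · rintro ⟨y, ⟨h1, h2⟩, ⟨h3, h4⟩⟩
        exact ⟨⟨y, h1, h3⟩, ⟨y, h2, h4⟩⟩
      · rintro ⟨⟨y, h1, h3⟩, ⟨y', h2, h4⟩⟩
        obtain rfl : y' = y := (rel_sub η h2).2.symm.trans (rel_sub η' h1).1
        exact ⟨y', ⟨h1, h2⟩, ⟨h3, h4⟩⟩)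
    assoc_nat := fun η θ ζ => nat_iso _ _ _ _ (SetRel.comp_assoc (rel η) (rel θ) (rel ζ))
    left_nat := fun η => nat_iso _ _ _ _ id_rel
    right_nat := fun η => nat_iso _ _ _ _ rel_id
    pentagon := fun f g h i => two_ext (Eq.trans (b := graph (val i * (val h * (val g * val f))))
      (rel_comp_graph (rel_hc_graph rfl rfl rfl) (rel_comp_graph (congrArg graph (by
          change val i * (val h * val g * val f) = _
          rw [mul_assoc (val h)])) (rel_hc_graph rfl rfl (by
            change val i * (val h * val g) * val f = _
            simp only [mul_assoc]))))
      (rel_comp_graph (α := (isoOfEq _).hom) (β := (isoOfEq _).hom)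
        (π := val i * (val h * (val g * val f))) rfl
        (congrArg graph (mul_assoc (val i) (val h) (val g * val f)))).symm)
    triangle := fun f g => two_ext (Eq.trans (b := graph (val g * val f))
      (rel_comp_graph rfl (rel_hc_graph rfl rfl (by
        change val g * 1 * val f = _
        rw [mul_one])))
      (rel_hc_graph rfl rfl rfl).symm) }

end SymTwo

end SymTwo

/-! ### The symmetric inverse monoid -/

section InverseMonoid

/-- The symmetric inverse monoid: all bijections between subsets of `Fin n`, that is, all partial
injective self-maps of `Fin n`. It is ordered by inclusion of graphs. -/
abbrev IS (n : ℕ) := Fin n ≃. Fin n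

variable {n : ℕ}

/-- The product `s * t` is the composite of partial maps: first `t`, then `s`. -/
instance : Monoid (IS n) where
  mul s t := t.trans s
  one := PEquiv.refl _
  mul_assoc s t r := (PEquiv.trans_assoc r t s).symm
  one_mul s := PEquiv.trans_refl s
  mul_one s := PEquiv.refl_trans s

theorem IS.mem_mul {s t : IS n} {x z : Fin n} : z ∈ (s * t) x ↔ ∃ y, y ∈ t x ∧ z ∈ s y :=
  PEquiv.mem_trans t s x z

instance : MulLeftMono (IS n) where
  elim s t t' h := PEquiv.le_def.2 fun x z hz => by
    obtain ⟨y, h1, h2⟩ := IS.mem_mul.1 hz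
    exact IS.mem_mul.2 ⟨y, PEquiv.le_def.1 h x y h1, h2⟩

instance : MulRightMono (IS n) where
  elim s t t' h := PEquiv.le_def.2 fun x z hz => by
    obtain ⟨y, h1, h2⟩ := IS.mem_mul.1 hz
    exact IS.mem_mul.2 ⟨y, h1, PEquiv.le_def.1 h y z h2⟩

/-- Inclusion is the natural partial order of the inverse monoid. -/
theorem IS.le_iff {s t : IS n} : s ≤ t ↔ ∃ e : IS n, e * e = e ∧ s = e * t := by
  classical
  constructor
  · intro h
    have key : ∀ x z, z ∈ (PEquiv.ofSet {y : Fin n | ∃ x : Fin n, y ∈ s x} * t) x ↔ z ∈ s x := by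
      intro x z
      simp only [IS.mem_mul, PEquiv.mem_ofSet_iff]
      constructor
      · rintro ⟨y, h1, rfl, x', h2⟩
        obtain rfl : x' = x := t.inj (PEquiv.le_def.1 h _ _ h2) h1
        exact h2
      · intro hz
        exact ⟨z, PEquiv.le_def.1 h x z hz, rfl, x, hz⟩
    refine ⟨PEquiv.ofSet {y : Fin n | ∃ x : Fin n, y ∈ s x}, ?_, ?_⟩
    · refine PEquiv.ext fun x => Option.ext fun z => ?_
      refine IS.mem_mul.trans ?_
      constructor
      · rintro ⟨y, h1, h2⟩
        rw [PEquiv.mem_ofSet_iff] at h1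
        rwa [h1.1] at h2
      · intro h1
        obtain ⟨rfl, h3⟩ := PEquiv.mem_ofSet_iff.1 h1
        exact ⟨z, h1, h1⟩
    · exact PEquiv.ext fun x => Option.ext fun z => (key x z).symm
  · rintro ⟨e, he, rfl⟩
    refine PEquiv.le_def.2 fun x z hz => ?_
    obtain ⟨y, h1, h2⟩ := IS.mem_mul.1 hz
    have h3 : z ∈ (e * e) y := by rwa [he]
    obtain ⟨w, h4, h5⟩ := IS.mem_mul.1 h3
    obtain rfl : w = z := Option.mem_unique h4 h2
    obtain rfl : y = w := e.inj h2 h5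
    exact h1

instance : Finite (IS n) :=
  Finite.of_injective (fun s : IS n => (s : Fin n → Option (Fin n))) DFunLike.coe_injective

/-- The number of elements of the set-theoretic difference of the graphs of `s` and `r`. -/
def IS.diffCard (s r : IS n) : ℕ := {p : Fin n × Fin n | p.2 ∈ s p.1 ∧ p.2 ∉ r p.1}.ncard

/-- The element `∑_{r ⊆ s} (-1)^{|s ∖ r|} r` of the integral semigroup algebra of `IS n`. -/
def moebius (s : IS n) : MonoidAlgebra ℤ (IS n) :=
  ∑ r ∈ (Set.toFinite {r : IS n | r ≤ s}).toFinset,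
    MonoidAlgebra.single r ((-1 : ℤ) ^ IS.diffCard s r)

open scoped Classical in
/-- The restriction of a permutation to a subset `X`, as a partial injective map. -/
def restr (σ : Equiv.Perm (Fin n)) (X : Finset (Fin n)) : IS n :=
  (PEquiv.ofSet (X : Set (Fin n))).trans σ.toPEquiv

end InverseMonoid

/-! ### Distinguished objects and 1-morphisms -/

section Objects

open SymTwo

variable (k : Type*) [Field k] (n : ℕ)

/-- A subset `Y` of `Fin n` as a subrelation of the identity permutation. -/
def idOn {n : ℕ} (Y : Finset (Fin n)) : (𝟙 pt : (pt : SymTwo n) ⟶ pt) ⟶ 𝟙 pt :=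
  ⟨{p | p.1 = p.2 ∧ p.1 ∈ Y}, fun _ h => ⟨h.1, h.1⟩⟩

/-- The element `∑_{Y ⊆ X} (-1)^{|X| - |Y|} Y` of the 2-endomorphism algebra of the identity
1-morphism. -/
def eps (X : Finset (Fin n)) :
    𝟙 (Fin2.obj k (pt : SymTwo n)) ⟶ 𝟙 (Fin2.obj k (pt : SymTwo n)) :=
  Fin2.endId pt (∑ Y ∈ X.powerset, Finsupp.single (idOn Y) ((-1 : k) ^ (X.card - Y.card)))

variable {k n}

/-- The object of the splitting of `k𝒜ₙ` corresponding to the idempotent `eps k n X`. -/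
def splitObj (hp : ∀ X : Finset (Fin n), IsPrimitive (eps k n X)) (X : Finset (Fin n)) :
    SplitFin2 k (SymTwo n) :=
  ⟨Fin2.obj k pt, eps k n X, hp X⟩

/-- An element of `IS n` as a 1-morphism of the finitarization of the bicategory of the ordered
monoid `IS n`. -/
def ordMor (k : Type*) [Field k] {n : ℕ} (s : IS n) :
    Fin2.obj k (OrdTwo.pt : OrdTwo (IS n)) ⟶ Fin2.obj k OrdTwo.pt :=
  Fin2.mor k (OrdTwo.mor s)

/-- A permutation as a 1-morphism of the splitting of `k𝒜ₙ`. -/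
def splitMor (hp : ∀ X : Finset (Fin n), IsPrimitive (eps k n X)) (X Y : Finset (Fin n))
    (σ : Equiv.Perm (Fin n)) : splitObj hp X ⟶ splitObj hp Y :=
  ⟨Fin2.mor k (SymTwo.mor σ)⟩

end Objects


end Decat

end

open Decat

/-! Both decategorifications are computed by one device. Let `L` be a category of 1-morphisms with
linearized 2-morphisms. Suppose it carries additive functionals χ_t to `k` that are multiplicative
for vertical composition, can be prescribed freely wherever the identities allow it, and have a
common kernel that is nilpotent on matrices (`CharSystem`). Modulo this kernel, `L` splits into
pieces with hom spaces `k` or 0. An object of the idempotent completion of the additive envelope is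
an idempotent matrix, and it is determined up to isomorphism by the ranks of its images under the
χ_t (`CharSystem.isDimVector`). The split Grothendieck group is then free on the unit vectors that
are realized, and multiplicativity need only be checked on products of basis classes
(`Groth.exists_ringEquiv`).

For a finite ordered monoid, χ_s reads off the coefficient of the identity of s. The common kernel
consists of strictly increasing 2-morphisms and is nilpotent by finiteness. The basis classes are
the elements of the monoid and multiply as such.

For 𝒜ₙ, the functional χ_p with p in `IS n` adds up the coefficients of all relations containing p.
It is multiplicative because p lies in α ∩ β exactly if it lies in both. By triangularity the χ_p
with p ⊆ σ ∩ τ are coordinates on Hom(σ, τ), so the common kernel is zero. On End(𝟙) they become the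
χ_{id_Z}, and ε^(X) is the element with χ_{id_Z} = δ_{Z,X}; hence the ε^(X) are exactly the
primitive idempotents (`isPrimitive_eps`, `bijective_splitObj`). The value of χ_p on a horizontal
composite is a product of two values (`char_hcomp`), so cutting by ε^(X) and ε^(Y) keeps precisely
the χ_p with domain X and range Y (`char_idp`). For a permutation with σ(X) = Y a single one
survives, p = σ|_X, so σ has a unit vector. These unit vectors compose as bijections between subsets
do, with product 0 if range and domain differ. The Möbius basis of ℤ[ISₙ] obeys the same rule
(`IS.moebius_mul_moebius`, `IS.moebius_mul_of_ne`). -/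

namespace Decat

/-! ### Additive categories classified by dimension vectors -/

section DimensionVector

variable {C : Type*} [Category C] [Preadditive C] [HasBinaryBiproducts C] {T : Type*}

open scoped Classical in
theorem single_le_of_ne_zero {v : T → ℕ} {t : T} (ht : v t ≠ 0) : Pi.single t 1 ≤ v := by
  intro s
  rcases eq_or_ne s t with rfl | h
  · simpa [Nat.one_le_iff_ne_zero] using ht
  · simp [h]

open scoped Classical in
/-- A function `d` assigning to the objects of an additive category vectors of natural numbers, such
that `d` is additive, `d X` determines `X` up to isomorphism, and every coordinate of a value of `d`
which is not zero is realized by an object whose vector is a standard basis vector. -/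
structure IsDimVector (d : C → T → ℕ) : Prop where
  biprod : ∀ {X Y Z : C}, (Z ≅ X ⊞ Y) → d Z = d X + d Y
  iso : ∀ {X Y : C}, d X = d Y → Nonempty (X ≅ Y)
  -- Not a consequence of `iso`, which would only give X ≅ X ⊞ X.
  isZero : ∀ {X : C}, d X = 0 → IsZero X
  -- Only coordinates that occur are asked for: between two fixed objects of the splitting of k𝒜ₙ, a
  -- partial map with the wrong domain or range never occurs.
  simple : ∀ {X : C} {t : T}, d X t ≠ 0 → ∃ S : C, d S = Pi.single t 1

namespace IsDimVector

variable {d : C → T → ℕ}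

/-- Additivity suffices: X ⊞ X is isomorphic to Y ⊞ X, and `d X` cancels. -/
theorem of_iso (hd : IsDimVector d) {X Y : C} (e : X ≅ Y) : d X = d Y := by
  have h1 := hd.biprod (Iso.refl (X ⊞ X))
  have h2 := hd.biprod (biprod.mapIso e (Iso.refl X))
  exact add_right_cancel (h1.symm.trans h2)

theorem eq_zero (hd : IsDimVector d) {X : C} (h : IsZero X) : d X = 0 := by
  have h1 := hd.biprod (isoBiprodZero (X := X) h)
  exact left_eq_add.1 h1

/-- The number 1 is not a sum of two positive integers, so in any decomposition one summand has
vector zero. -/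
theorem indecomposable (hd : IsDimVector d) {X : C} {t : T} (h : ∀ s, d X s ≠ 0 → s = t)
    (ht : d X t = 1) :
    Indecomposable X := by
  refine ⟨fun hX => ?_, fun Y Z e => ?_⟩
  · rw [hd.eq_zero hX] at ht
    simp at ht
  · have h1 := hd.biprod e
    have h2 : ∀ s, d X s = d Y s + d Z s := fun s => congrFun h1 s
    have h3 := h2 t
    have h4 : ∀ s, s ≠ t → d Y s = 0 ∧ d Z s = 0 := fun s hs => by
      have h5 := h2 s
      rw [of_not_not fun h6 => hs (h s h6)] at h5
      omega
    rcases Nat.eq_zero_or_pos (d Y t) with h5 | h5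
    · refine Or.inl (hd.isZero (funext fun s => ?_))
      by_cases hs : s = t
      · subst hs; exact h5
      · exact (h4 s hs).1
    · refine Or.inr (hd.isZero (funext fun s => ?_))
      by_cases hs : s = t
      · subst hs
        change d Z s = 0
        omega
      · exact (h4 s hs).2

variable [Fintype T]

-- Unit vectors are split off one at a time. The zero vector is excluded because binary biproducts
-- alone do not provide a zero object.
open scoped Classical in
theorem exists_eq (hd : IsDimVector d) {v : T → ℕ} (hv : v ≠ 0)
    (h : ∀ t, v t ≠ 0 → ∃ S, d S = Pi.single t 1) :
    ∃ X, d X = v := by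
  induction hN : ∑ t, v t using Nat.strong_induction_on generalizing v with
  | _ N ih =>
  obtain ⟨t, ht⟩ := Function.ne_iff.1 hv
  obtain ⟨S, hS⟩ := h t ht
  have hle : (Pi.single t 1 : T → ℕ) ≤ v := single_le_of_ne_zero ht
  obtain ⟨w, rfl⟩ := exists_add_of_le hle
  by_cases hw : w = 0
  · exact ⟨S, by rw [hS, hw, add_zero]⟩
  · obtain ⟨G, hG⟩ := ih (∑ t, w t) (by
        rw [← hN]
        simp [Finset.sum_add_distrib]) hw
      (fun s hs => h s (by simp [hs])) rfl
    exact ⟨S ⊞ G, by rw [hd.biprod (Iso.refl _), hS, hG]⟩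

open scoped Classical in
/-- An object with a vector that is not zero has a direct summand with a standard basis vector. -/
theorem exists_summand (hd : IsDimVector d) {X : C} (h : ¬ IsZero X) :
    ∃ (t : T) (S : C), d S = Pi.single t 1 ∧
      (Nonempty (X ≅ S) ∨ ∃ G, ¬ IsZero G ∧ Nonempty (X ≅ S ⊞ G)) := by
  have h0 : d X ≠ 0 := fun h' => h (hd.isZero h')
  obtain ⟨t, ht⟩ := Function.ne_iff.1 h0
  obtain ⟨S, hS⟩ := hd.simple ht
  refine ⟨t, S, hS, ?_⟩
  have hle : (Pi.single t 1 : T → ℕ) ≤ d X := single_le_of_ne_zero ht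
  obtain ⟨w, hw⟩ := exists_add_of_le hle
  -- With no zero object at hand, a complement of vector zero cannot be constructed, so this case is
  -- kept apart.
  by_cases hw0 : w = 0
  · exact Or.inl (hd.iso (by rw [hw, hw0, add_zero, hS]))
  · obtain ⟨G, rfl⟩ := hd.exists_eq hw0 (fun s hs => hd.simple (X := X) (by simp [hw, hs]))
    refine Or.inr ⟨G, fun hG => hw0 (hd.eq_zero hG), hd.iso ?_⟩
    rw [hw, hd.biprod (Iso.refl (S ⊞ G)), hS]

open scoped Classical in
theorem exists_single_of_indecomposable (hd : IsDimVector d) {X : C} (h : Indecomposable X) :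
    ∃ t : T, d X = Pi.single t 1 := by
  obtain ⟨t, S, hS, ⟨⟨e⟩⟩ | ⟨G, hG, ⟨e⟩⟩⟩ := hd.exists_summand h.1
  · exact ⟨t, (hd.of_iso e).trans hS⟩
  · rcases h.2 _ _ e with h1 | h1
    · have h2 := hd.eq_zero h1
      rw [hS] at h2
      exact absurd (congrFun h2 t) (by simp)
    · exact absurd h1 hG

open scoped Classical in
/-- An additive function on the split Grothendieck group is determined by its values on the objects
with a standard basis vector. -/
theorem map_of {A : Type*} [AddCommGroup A] (hd : IsDimVector d) (g : K0 C →+ A) (w : T → A)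
    (hw : ∀ (t : T) (S : C), d S = Pi.single t 1 → g (K0.of S) = w t) (X : C) :
    g (K0.of X) = ∑ t, d X t • w t := by
  induction hN : ∑ t, d X t using Nat.strong_induction_on generalizing X with
  | _ N ih =>
  by_cases hX : IsZero X
  · have h1 := K0.of_biprod (isoBiprodZero (X := X) hX)
    rw [hd.eq_zero hX, left_eq_add.1 h1]
    simp
  · have key : ∀ (t : T) (S : C), d S = Pi.single t 1 → ∑ s, d S s • w s = w t := fun t S h => by
      rw [h, Finset.sum_eq_single t (fun s _ hs => by simp [hs]) (by simp)]
      simp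
    obtain ⟨t, S, hS, ⟨⟨e⟩⟩ | ⟨G, hG, ⟨e⟩⟩⟩ := hd.exists_summand hX
    · rw [K0.of_iso e, hd.of_iso e, hw t S hS, key t S hS]
    · have hdX := hd.biprod e
      have h1 := ih (∑ t, d G t) (by
        rw [← hN, hdX, hS]
        simp [Finset.sum_add_distrib]) G rfl
      rw [K0.of_biprod e, map_add, h1, hw t S hS, hdX]
      simp only [Pi.add_apply, add_smul, Finset.sum_add_distrib]
      rw [key t S hS]

end IsDimVector

end DimensionVector

/-! ### Ranks of idempotent matrices -/

section IdempotentRank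

/-- The image of the sum is the direct sum of the images: p x = (p + q)(p x), and an element v = q y
of both images satisfies v = p v = p (q y) = 0. -/
theorem finrank_range_add_of_orthogonal {k V : Type*} [Field k] [AddCommGroup V] [Module k V]
    [FiniteDimensional k V] {p q : V →ₗ[k] V} (hp : p ∘ₗ p = p) (hq : q ∘ₗ q = q)
    (hpq : p ∘ₗ q = 0) (hqp : q ∘ₗ p = 0) :
    Module.finrank k (LinearMap.range (p + q)) =
      Module.finrank k (LinearMap.range p) + Module.finrank k (LinearMap.range q) := by
  have hp' := fun x => LinearMap.congr_fun hp x
  have hq' := fun x => LinearMap.congr_fun hq x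
  have hpq' := fun x => LinearMap.congr_fun hpq x
  have hqp' := fun x => LinearMap.congr_fun hqp x
  simp only [LinearMap.comp_apply, LinearMap.zero_apply] at hp' hq' hpq' hqp'
  have h1 : LinearMap.range (p + q) = LinearMap.range p ⊔ LinearMap.range q := by
    apply le_antisymm
    · rintro _ ⟨x, rfl⟩
      exact Submodule.add_mem_sup ⟨x, rfl⟩ ⟨x, rfl⟩
    · rw [sup_le_iff]
      constructor
      · rintro _ ⟨x, rfl⟩
        exact ⟨p x, by simp [hp', hqp']⟩
      · rintro _ ⟨x, rfl⟩
        exact ⟨q x, by simp [hq', hpq']⟩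
  have h2 : LinearMap.range p ⊓ LinearMap.range q = ⊥ := by
    rw [eq_bot_iff]
    rintro _ ⟨⟨x, rfl⟩, ⟨y, hy⟩⟩
    have h3 : p (p x) = p (q y) := by rw [hy]
    rw [hp', hpq'] at h3
    simp [h3]
  have h3 := Submodule.finrank_sup_add_finrank_inf_eq (LinearMap.range p) (LinearMap.range q)
  rw [h2, finrank_bot, add_zero] at h3
  rw [h1, h3]

variable {k : Type*} [Field k] {l m n : Type*} [Fintype l] [Fintype m] [Fintype n]

theorem rank_add_of_orthogonal {p q : Matrix n n k} (hp : p * p = p) (hq : q * q = q)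
    (hpq : p * q = 0) (hqp : q * p = 0) : (p + q).rank = p.rank + q.rank := by
  classical
  unfold Matrix.rank
  rw [Matrix.mulVecLin_add]
  apply finrank_range_add_of_orthogonal <;> rw [← Matrix.mulVecLin_mul] <;> simp [*]

/-- From ab = a(ba)b and ba = b(ab)a, each rank bounds the other. -/
theorem rank_mul_comm_of_idempotent {a : Matrix n m k} {b : Matrix m n k}
    (h1 : a * b * (a * b) = a * b) (h2 : b * a * (b * a) = b * a) :
    (a * b).rank = (b * a).rank := by
  apply le_antisymm
  · have h3 : a * b = a * (b * a) * b := by rw [← h1]; simp only [Matrix.mul_assoc]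
    rw [h3]
    exact (Matrix.rank_mul_le_left _ _).trans (Matrix.rank_mul_le_right _ _)
  · have h3 : b * a = b * (a * b) * a := by rw [← h2]; simp only [Matrix.mul_assoc]
    rw [h3]
    exact (Matrix.rank_mul_le_left _ _).trans (Matrix.rank_mul_le_right _ _)

/-- The hypotheses are the matrix form of a biproduct: `a`, `c` are the inclusions and `b`, `d` the
projections, with `p`, `q`, `r` in the role of identities. Then `b * a` and `d * c` are orthogonal
idempotents with the ranks of `p` and `q`. -/
theorem rank_eq_add_of_biprod {p : Matrix m m k} {q : Matrix n n k} {r : Matrix l l k}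
    {a : Matrix m l k} {b : Matrix l m k} {c : Matrix n l k} {d : Matrix l n k}
    (hp : p * p = p) (hq : q * q = q) (hab : a * b = p) (hcd : c * d = q) (had : a * d = 0)
    (hcb : c * b = 0) (hap : p * a = a) (hcq : q * c = c) (hr : b * a + d * c = r) :
    r.rank = p.rank + q.rank := by
  have h1 : b * a * (b * a) = b * a := by
    rw [Matrix.mul_assoc, ← Matrix.mul_assoc a, hab, hap]
  have h2 : d * c * (d * c) = d * c := by
    rw [Matrix.mul_assoc, ← Matrix.mul_assoc c, hcd, hcq]
  rw [← hr, rank_add_of_orthogonal h1 h2, ← hab, ← hcd,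
    rank_mul_comm_of_idempotent (by rw [hab, hp]) h1,
    rank_mul_comm_of_idempotent (by rw [hcd, hq]) h2]
  · rw [Matrix.mul_assoc, ← Matrix.mul_assoc a, had]; simp
  · rw [Matrix.mul_assoc, ← Matrix.mul_assoc c, hcb]; simp

theorem rangeRestrict_of_idempotent {p : Matrix n n k} (hp : p * p = p)
    (x : LinearMap.range p.mulVecLin) : p.mulVecLin.rangeRestrict (x : n → k) = x := by
  obtain ⟨_, y, rfl⟩ := x
  apply Subtype.ext
  simp [hp]

/-- Idempotent matrices of the same rank are equivalent. -/
theorem exists_mul_eq_of_rank_eq {p : Matrix m m k} {q : Matrix n n k} (hp : p * p = p)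
    (hq : q * q = q) (h : p.rank = q.rank) :
    ∃ (a : Matrix m n k) (b : Matrix n m k),
      a * b = p ∧ b * a = q ∧ p * a * q = a ∧ q * b * p = b := by
  classical
  -- An isomorphism `e` of the two images is turned into matrices by projecting before it and
  -- including after it.
  obtain ⟨a, b, hab, hba⟩ : ∃ (a : Matrix m n k) (b : Matrix n m k), a * b = p ∧ b * a = q := by
    obtain ⟨e⟩ := FiniteDimensional.nonempty_linearEquiv_of_finrank_eq (R := k)
      (M := LinearMap.range p.mulVecLin) (M' := LinearMap.range q.mulVecLin) h
    refine ⟨LinearMap.toMatrix' ((Submodule.subtype _ ∘ₗ e.symm.toLinearMap) ∘ₗ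
      q.mulVecLin.rangeRestrict), LinearMap.toMatrix' ((Submodule.subtype _ ∘ₗ e.toLinearMap) ∘ₗ
      p.mulVecLin.rangeRestrict), ?_, ?_⟩
    · rw [← LinearMap.toMatrix'_comp]
      apply Matrix.toLin'.injective
      ext1 x
      ext1
      simp [rangeRestrict_of_idempotent hq]
    · rw [← LinearMap.toMatrix'_comp]
      apply Matrix.toLin'.injective
      ext1 x
      ext1
      simp [rangeRestrict_of_idempotent hp]
  -- Cutting down on both sides leaves the products unchanged and yields the last two equations.
  refine ⟨p * a * q, q * b * p, ?_, ?_, ?_, ?_⟩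
  · calc p * a * q * (q * b * p) = p * a * (q * q) * b * p := by simp only [Matrix.mul_assoc]
      _ = p * (a * b) * (a * b) * p := by rw [hq, ← hba]; simp only [Matrix.mul_assoc]
      _ = p := by simp only [hab, hp]
  · calc q * b * p * (p * a * q) = q * b * (p * p) * a * q := by simp only [Matrix.mul_assoc]
      _ = q * (b * a) * (b * a) * q := by rw [hp, ← hab]; simp only [Matrix.mul_assoc]
      _ = q := by simp only [hba, hq]
  · calc p * (p * a * q) * q = (p * p) * a * (q * q) := by simp only [Matrix.mul_assoc]
      _ = p * a * q := by rw [hp, hq]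
  · calc q * (q * b * p) * p = (q * q) * b * (p * p) := by simp only [Matrix.mul_assoc]
      _ = q * b * p := by rw [hp, hq]

theorem eq_zero_of_rank_eq_zero {a : Matrix n n k} (h : a.rank = 0) : a = 0 := by
  classical
  rw [Matrix.rank, Submodule.finrank_eq_zero, LinearMap.range_eq_bot] at h
  exact Matrix.toLin'.injective ((Matrix.toLin'_apply' a).trans (h.trans (map_zero _).symm))

theorem rank_unique [Unique n] (a : Matrix n n k) (h : a default default = 1) : a.rank = 1 := by
  classical
  have : a = 1 := by
    ext i j
    rw [Subsingleton.elim i default, Subsingleton.elim j default, h]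
    simp
  rw [this, Matrix.rank_one, Fintype.card_unique]

end IdempotentRank

/-! ### Dimension vectors from multiplicative functionals -/

section CharSystem

open Idempotents

/-- A family of additive and multiplicative functionals on the morphisms of a preadditive category,
such that arbitrary values can be prescribed, and such that a matrix all of whose values are zero is
nilpotent. -/
structure CharSystem (k : Type*) [Field k] (L : Type*) [Category L] [Preadditive L]
    (T : Type*) where
  χ : T → ∀ {X Y : L}, (X ⟶ Y) →+ k
  map_comp : ∀ (t : T) {X Y Z : L} (f : X ⟶ Y) (g : Y ⟶ Z), χ t (f ≫ g) = χ t f * χ t g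
  -- The values on identities are idempotent in `k`, so the condition says that `c` vanishes
  -- wherever a functional kills the identity of `X` or of `Y`; every morphism has this property.
  full : ∀ {X Y : L} (c : T → k), (∀ t, χ t (𝟙 X) * c t * χ t (𝟙 Y) = c t) →
    ∃ f : X ⟶ Y, ∀ t, χ t f = c t
  nil : ∀ {M : Mat_ L} (f : M ⟶ M), (∀ t i j, χ t (f i j) = 0) → IsNilpotent (R := End M) f

namespace CharSystem

variable {k : Type*} [Field k] {L : Type*} [Category L] [Preadditive L] {T : Type*}
  (S : CharSystem k L T)

/-- The matrix of values of a functional on a morphism of the additive envelope. -/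
def mat (t : T) {M N : Mat_ L} (f : M ⟶ N) : Matrix M.ι N.ι k := Matrix.of fun i j => S.χ t (f i j)

theorem mat_comp (t : T) {M N K : Mat_ L} (f : M ⟶ N) (g : N ⟶ K) :
    S.mat t (f ≫ g) = S.mat t f * S.mat t g := by
  ext i j
  change S.χ t ((f ≫ g : Mat_.Hom M K) i j) = _
  rw [Mat_.comp_def]
  simp only [map_sum, S.map_comp]
  rfl

theorem mat_add (t : T) {M N : Mat_ L} (f g : M ⟶ N) :
    S.mat t (f + g) = S.mat t f + S.mat t g := by
  ext i j
  exact (S.χ t).map_add _ _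

theorem mat_zero (t : T) {M N : Mat_ L} : S.mat t (0 : M ⟶ N) = 0 := by
  ext i j
  exact (S.χ t).map_zero

theorem mat_eq_one (t : T) {M N : Mat_ L} (f : M ⟶ N) (i : M.ι) (j : N.ι) :
    S.χ t (𝟙 (M.X i)) * S.mat t f i j * S.χ t (𝟙 (N.X j)) = S.mat t f i j := by
  change _ * S.χ t _ * _ = S.χ t _
  rw [← S.map_comp, ← S.map_comp, Category.id_comp, Category.comp_id]

/-- Entries of `S.mat t p` and `S.mat t q` absorb the values on identities, so a matrix sandwiched
between them meets the condition of `full` at every position. -/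
theorem exists_mat_eq {M N : Mat_ L} {p : M ⟶ M} {q : N ⟶ N} (a : ∀ _ : T, Matrix M.ι N.ι k)
    (ha : ∀ t, S.mat t p * a t * S.mat t q = a t) : ∃ f : M ⟶ N, ∀ t, S.mat t f = a t := by
  have h : ∀ i j, ∃ f : M.X i ⟶ N.X j, ∀ t, S.χ t f = a t i j := by
    intro i j
    refine S.full _ fun t => ?_
    rw [← ha t, Matrix.mul_apply, Finset.mul_sum, Finset.sum_mul]
    refine Finset.sum_congr rfl fun j' _ => ?_
    rw [Matrix.mul_apply, Finset.sum_mul, Finset.mul_sum, Finset.sum_mul]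
    refine Finset.sum_congr rfl fun i' _ => ?_
    rw [← S.mat_eq_one t p i i', ← S.mat_eq_one t q j' j]
    have h1 : S.χ t (𝟙 (M.X i)) * S.χ t (𝟙 (M.X i)) = S.χ t (𝟙 (M.X i)) := by
      rw [← S.map_comp, Category.comp_id]
    have h2 : S.χ t (𝟙 (N.X j)) * S.χ t (𝟙 (N.X j)) = S.χ t (𝟙 (N.X j)) := by
      rw [← S.map_comp, Category.comp_id]
    linear_combination (S.mat t p i i' * S.χ t (𝟙 (M.X i')) * a t i' j' * S.χ t (𝟙 (N.X j')) *
      S.mat t q j' j) * (S.χ t (𝟙 (N.X j)) * S.χ t (𝟙 (N.X j)) * h1 + S.χ t (𝟙 (M.X i)) * h2)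
  choose f hf using h
  exact ⟨fun i j => f i j, fun t => by ext i j; exact hf i j t⟩

variable {C : Type*} [Category C] (Φ : C ⥤ Karoubi (Mat_ L))

/-- The vector of ranks of the matrices of values on an idempotent. -/
noncomputable def dim (X : C) (t : T) : ℕ := (S.mat t (Φ.obj X).p).rank

theorem dim_eq_one {X : C} {t : T} [Unique (Φ.obj X).X.ι]
    (h : ∀ i, S.χ t ((Φ.obj X).p i i) = 1) : S.dim Φ X t = 1 :=
  rank_unique _ (h default)

theorem dim_eq_zero {X : C} {t : T} (h : ∀ i j, S.χ t ((Φ.obj X).p i j) = 0) :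
    S.dim Φ X t = 0 := by
  rw [dim, show S.mat t (Φ.obj X).p = 0 from Matrix.ext h, Matrix.rank_zero]

theorem map_f_mat (t : T) {X Y : C} (f : X ⟶ Y) :
    S.mat t (Φ.obj X).p * S.mat t (Φ.map f).f = S.mat t (Φ.map f).f := by
  rw [← S.mat_comp, Karoubi.p_comp]

theorem mat_map_comp (t : T) {X Y Z : C} (f : X ⟶ Y) (g : Y ⟶ Z) :
    S.mat t (Φ.map f).f * S.mat t (Φ.map g).f = S.mat t (Φ.map (f ≫ g)).f := by
  rw [← S.mat_comp, Φ.map_comp]; rfl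

theorem mat_map_id (t : T) (X : C) : S.mat t (Φ.map (𝟙 X)).f = S.mat t (Φ.obj X).p := by
  rw [Φ.map_id]; rfl

theorem mat_idem (t : T) (X : C) :
    S.mat t (Φ.obj X).p * S.mat t (Φ.obj X).p = S.mat t (Φ.obj X).p := by
  rw [← S.mat_comp, (Φ.obj X).idem]

variable [Preadditive C] [Φ.Additive]

theorem mat_map_add (t : T) {X Y : C} (f g : X ⟶ Y) :
    S.mat t (Φ.map (f + g)).f = S.mat t (Φ.map f).f + S.mat t (Φ.map g).f := by
  rw [← S.mat_add, Φ.map_add]; rfl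

theorem mat_map_sub (t : T) {X Y : C} (f g : X ⟶ Y) :
    S.mat t (Φ.map (f - g)).f = S.mat t (Φ.map f).f - S.mat t (Φ.map g).f := by
  rw [eq_sub_iff_add_eq, ← S.mat_map_add, sub_add_cancel]

theorem mat_map_zero (t : T) {X Y : C} : S.mat t (Φ.map (0 : X ⟶ Y)).f = 0 := by
  rw [Φ.map_zero]; exact S.mat_zero t

variable [Φ.Faithful]

/-- This transports `nil` back along the faithful functor `Φ`. -/
theorem isNilpotent_of_mat {X : C} (f : X ⟶ X) (h : ∀ t, S.mat t (Φ.map f).f = 0) :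
    IsNilpotent (R := End X) f := by
  obtain ⟨m, hm⟩ := S.nil (Φ.map f).f fun t i j => congrFun (congrFun (h t) i) j
  -- The exponent is raised by one because the zeroth power of `f` goes to the idempotent of `Φ.obj
  -- X` and not to the identity of the ambient object; powers correspond only from exponent one on.
  refine ⟨m + 1, Φ.map_injective (Karoubi.hom_ext _ _ ?_)⟩
  let f' : End X := f
  let g : End (Φ.obj X).X := (Φ.map f).f
  have key : ∀ m : ℕ, (Φ.map (f' ^ (m + 1))).f = g ^ (m + 1) := by
    intro m
    induction m with
    | zero => simp only [zero_add, pow_one]; rfl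
    | succ m ih =>
      rw [pow_succ f', pow_succ g, ← ih]
      change (Φ.map (_ ≫ _)).f = _
      rw [Φ.map_comp]; rfl
  refine (key m).trans ?_
  rw [pow_succ, show g ^ m = 0 from hm, zero_mul, Φ.map_zero]; rfl

/-- Such an `f` differs from the identity by a nilpotent endomorphism. -/
theorem isIso_of_mat {X : C} (f : X ⟶ X) (h : ∀ t, S.mat t (Φ.map f).f = S.mat t (Φ.obj X).p) :
    IsIso f := by
  have h1 : IsNilpotent (R := End X) (f - 𝟙 X) := S.isNilpotent_of_mat Φ _ fun t => by
    have h2 := S.mat_map_sub Φ t f (𝟙 X)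
    rw [h, S.mat_map_id, sub_self] at h2
    exact h2
  have h2 := h1.isUnit_one_add
  exact (isUnit_iff_isIso f).1 (by simpa [End.one_def] using h2)

/-- Ranks of idempotents are additive on biproducts. Idempotent matrices of equal rank are
equivalent, and the equivalences lift to morphisms by `full`; the composites of the lifts have the
values of identities and hence are invertible. -/
theorem isDimVector [HasBinaryBiproducts C] [Φ.Full]
    (simple : ∀ {X : C} {t : T}, S.dim Φ X t ≠ 0 → ∃ Y : C,
      S.dim Φ Y t = 1 ∧ ∀ s ≠ t, S.dim Φ Y s = 0) : IsDimVector (S.dim Φ) where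
  biprod {X Y Z} e := by
    funext t
    exact rank_eq_add_of_biprod (a := S.mat t (Φ.map (biprod.inl ≫ e.inv)).f)
      (b := S.mat t (Φ.map (e.hom ≫ biprod.fst)).f) (c := S.mat t (Φ.map (biprod.inr ≫ e.inv)).f)
      (d := S.mat t (Φ.map (e.hom ≫ biprod.snd)).f) (S.mat_idem Φ t X) (S.mat_idem Φ t Y)
      (by rw [S.mat_map_comp, ← S.mat_map_id]; simp)
      (by rw [S.mat_map_comp, ← S.mat_map_id]; simp)
      (by rw [S.mat_map_comp, ← S.mat_map_zero Φ t]; simp)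
      (by rw [S.mat_map_comp, ← S.mat_map_zero Φ t]; simp)
      (S.map_f_mat Φ t _) (S.map_f_mat Φ t _)
      (by
        rw [S.mat_map_comp, S.mat_map_comp, ← S.mat_map_add, ← S.mat_map_id]
        congr 3
        simp only [Category.assoc]
        rw [← Preadditive.comp_add, ← Category.assoc, ← Category.assoc, ← Preadditive.add_comp,
          biprod.total]
        simp)
  iso {X Y} h := by
    choose a b hab hba ha hb using fun t =>
      exists_mul_eq_of_rank_eq (S.mat_idem Φ t X) (S.mat_idem Φ t Y) (congrFun h t)
    have lift : ∀ {X Y : C} (a : ∀ _ : T, Matrix (Φ.obj X).X.ι (Φ.obj Y).X.ι k),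
        (∀ t, S.mat t (Φ.obj X).p * a t * S.mat t (Φ.obj Y).p = a t) →
        ∃ f : X ⟶ Y, ∀ t, S.mat t (Φ.map f).f = a t := by
      intro X Y a ha
      obtain ⟨f, hf⟩ := S.exists_mat_eq a ha
      -- The lift `f` need not be compatible with the idempotents. Sandwiching makes it so, and by
      -- `ha` its values do not change.
      obtain ⟨g, hg⟩ := Φ.map_surjective (⟨(Φ.obj X).p ≫ f ≫ (Φ.obj Y).p, by
        simp only [Category.assoc, (Φ.obj Y).idem]
        rw [← Category.assoc, (Φ.obj X).idem]⟩ : Φ.obj X ⟶ Φ.obj Y)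
      refine ⟨g, fun t => ?_⟩
      rw [hg]
      change S.mat t ((Φ.obj X).p ≫ f ≫ (Φ.obj Y).p) = _
      rw [S.mat_comp, S.mat_comp, hf, ← Matrix.mul_assoc, ha]
    obtain ⟨f, hf⟩ := lift a ha
    obtain ⟨g, hg⟩ := lift b hb
    -- The lifts are inverse to each other only modulo the kernel of the functionals, so the two
    -- composites are merely invertible; this makes `f` a split monomorphism and a split
    -- epimorphism.
    have h1 : IsIso (f ≫ g) := S.isIso_of_mat Φ _ fun t => by
      rw [← S.mat_map_comp, hf, hg, hab]
    have h2 : IsIso (g ≫ f) := S.isIso_of_mat Φ _ fun t => by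
      rw [← S.mat_map_comp, hf, hg, hba]
    have h3 : IsSplitMono f := IsSplitMono.mk' ⟨g ≫ inv (f ≫ g), by
      rw [← Category.assoc, IsIso.hom_inv_id]⟩
    have h4 : IsSplitEpi f := IsSplitEpi.mk' ⟨inv (g ≫ f) ≫ g, by
      rw [Category.assoc, IsIso.inv_hom_id]⟩
    have : IsIso f := isIso_of_mono_of_isSplitEpi f
    exact ⟨asIso f⟩
  isZero {X} h := by
    -- If all ranks vanish, zero and the identity have the same values.
    have h1 : IsIso (0 : X ⟶ X) := S.isIso_of_mat Φ _ fun t => by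
      rw [S.mat_map_zero]
      exact (eq_zero_of_rank_eq_zero (congrFun h t)).symm
    rw [IsZero.iff_id_eq_zero, ← IsIso.hom_inv_id (0 : X ⟶ X), zero_comp]
  simple {X t} h := by
    obtain ⟨Y, h1, h2⟩ := simple h
    refine ⟨Y, funext fun s => ?_⟩
    by_cases hs : s = t
    · subst hs; simpa using h1
    · simpa [hs] using h2 s hs

end CharSystem

end CharSystem

/-! ### Decategorification of bicategories with a dimension vector -/

section GrothDim

open Bicategory

universe w v u

variable {B : Type u} [Bicategory.{w, v} B] [LocallyPreadditive B]
  [∀ a b : B, HasBinaryBiproducts (a ⟶ b)]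

/-- A family of homomorphisms from the split Grothendieck groups extends to the
decategorification. -/
noncomputable def Groth.lift {A : Type*} [AddCommGroup A] (g : ∀ a b : B, K0 (a ⟶ b) →+ A) :
    Groth B →+ A := by
  classical
  exact DirectSum.toAddMonoid fun p : B × B => g p.1 p.2

theorem Groth.lift_incl {A : Type*} [AddCommGroup A] (g : ∀ a b : B, K0 (a ⟶ b) →+ A) {a b : B}
    (x : K0 (a ⟶ b)) : Groth.lift g (Groth.incl a b x) = g a b x := by
  classical
  exact DirectSum.toAddMonoid_of (fun p : B × B => g p.1 p.2) (a, b) x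

theorem Groth.hom_ext {A : Type*} [AddCommGroup A] {f g : Groth B →+ A}
    (h : ∀ (a b : B) (F : a ⟶ b), f (Groth.cls F) = g (Groth.cls F)) : f = g := by
  ext x
  induction x using Groth.ind with
  | h0 => simp
  | ha x y hx hy => simp [hx, hy]
  | hi a b y =>
    have : f.comp (Groth.incl a b) = g.comp (Groth.incl a b) := K0.hom_ext fun F => h a b F
    exact DFunLike.congr_fun this y

variable {T : Type*} [Fintype T]

open scoped Classical in
/-- The ring isomorphism from the decategorification determined by a dimension vector and a system
of representatives of the 1-morphisms whose vector is a standard basis vector. -/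
theorem Groth.exists_ringEquiv (d : ∀ {a b : B}, (a ⟶ b) → T → ℕ)
    (hd : ∀ a b : B, IsDimVector (d : (a ⟶ b) → T → ℕ)) (src tgt : T → B)
    (S : ∀ t, src t ⟶ tgt t) (hS : ∀ t, d (S t) = Pi.single t 1)
    -- All pairs of objects are covered, since otherwise the classes of the `S t` need not generate
    -- the whole direct sum.
    (hcls : ∀ {a b : B} (F : a ⟶ b) (t : T), d F = Pi.single t 1 → cls F = cls (S t))
    {R : Type*} [NonUnitalNonAssocRing R] (M : (T →₀ ℤ) ≃+ R)
    (hmul : ∀ s t, (cls (S s) * cls (S t) = 0 ∧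
        M (Finsupp.single s 1) * M (Finsupp.single t 1) = 0) ∨
      ∃ u, cls (S s) * cls (S t) = cls (S u) ∧
        M (Finsupp.single s 1) * M (Finsupp.single t 1) = M (Finsupp.single u 1)) :
    ∃ φ : Groth B ≃+* R, ∀ t, φ (cls (S t)) = M (Finsupp.single t 1) := by
  -- `α` takes dimension vectors and `β` below sends basis vectors to the classes of the
  -- representatives; they are mutually inverse.
  let α : Groth B →+ (T →₀ ℤ) := Groth.lift fun a b =>
    K0.lift (fun F => Finsupp.equivFunOnFinite.symm fun t => (d F t : ℤ)) (fun X Y Z e => by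
      ext t
      have h1 := congrFun ((hd a b).biprod e) t
      simp only [Finsupp.coe_add, Pi.add_apply, Finsupp.equivFunOnFinite_symm_apply_apply] at h1 ⊢
      rw [h1, Nat.cast_add])
  have hα : ∀ {a b : B} (F : a ⟶ b),
      α (cls F) = Finsupp.equivFunOnFinite.symm fun t => (d F t : ℤ) := fun F =>
    (Groth.lift_incl _ _).trans (K0.lift_of _ _ _)
  have hαS : ∀ t, α (cls (S t)) = Finsupp.single t 1 := fun t => by
    rw [hα, hS]
    ext s
    by_cases h : s = t
    · subst h; simp
    · simp [h]
  let β : (T →₀ ℤ) →+ Groth B := Finsupp.liftAddHom fun t => zmultiplesHom _ (cls (S t))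
  have hβ : ∀ (t : T) (r : ℤ), β (Finsupp.single t r) = r • cls (S t) := fun t r => by
    simp [β]
  have hαβ : ∀ x, α (β x) = x := by
    intro x
    have : α.comp β = AddMonoidHom.id _ := Finsupp.addHom_ext fun t r => by
      simp only [AddMonoidHom.comp_apply, AddMonoidHom.id_apply]
      rw [hβ, map_zsmul, hαS]
      simp
    exact DFunLike.congr_fun this x
  have hβα : ∀ x, β (α x) = x := by
    intro x
    -- By `map_of`, the class of a 1-morphism is the sum of the representative classes weighted by
    -- its vector.
    have : β.comp α = AddMonoidHom.id _ := Groth.hom_ext fun a b F => by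
      refine Eq.trans ?_ ((hd a b).map_of (incl a b) (fun t => cls (S t))
        (fun t G hG => hcls G t hG) F).symm
      change β (α (cls F)) = _
      have h1 : (Finsupp.equivFunOnFinite.symm fun t => (d F t : ℤ)) =
          ∑ t, Finsupp.single t (d F t : ℤ) := by
        ext s
        simp [Finsupp.finsetSum_apply, Finsupp.single_apply]
      rw [hα, h1, map_sum]
      exact Finset.sum_congr rfl fun t _ => by rw [hβ, natCast_zsmul]
    exact DFunLike.congr_fun this x
  let e : Groth B ≃+ R := AddEquiv.trans
    { toFun := α, invFun := β, left_inv := hβα, right_inv := hαβ, map_add' := α.map_add } M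
  have he : ∀ t, e (cls (S t)) = M (Finsupp.single t 1) := fun t => congrArg M (hαS t)
  -- The representative classes generate additively, which reduces multiplicativity to `hmul`.
  have hgen : ∀ {P : Groth B → Prop} (x : Groth B), P 0 → (∀ t, P (cls (S t))) →
      (∀ x, P x → P (-x)) → (∀ x y, P x → P y → P (x + y)) → P x := by
    intro P x h0 hS hn ha
    rw [← hβα x]
    induction α x using Finsupp.induction_linear with
    | zero => rwa [map_zero]
    | add f g hf hg => rw [map_add]; exact ha _ _ hf hg
    | single t r =>
      rw [hβ]
      induction r with
      | zero => rwa [zero_smul]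
      | succ r ih => rw [add_smul, one_smul]; exact ha _ _ ih (hS t)
      | pred r ih => rw [sub_smul, one_smul, sub_eq_add_neg]; exact ha _ _ ih (hn _ (hS t))
  refine ⟨{ e with map_mul' := fun x y => ?_ }, he⟩
  change e (x * y) = e x * e y
  refine hgen (P := fun x => e (x * y) = e x * e y) x ?_ (fun s => ?_) (fun x hx => ?_)
    (fun x x' hx hx' => ?_)
  · simp only [zero_mul, map_zero]
  · refine hgen (P := fun y => e (cls (S s) * y) = e (cls (S s)) * e y) y ?_ (fun t => ?_)
      (fun y hy => ?_) (fun y y' hy hy' => ?_)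
    · simp only [mul_zero, map_zero]
    · rcases hmul s t with ⟨h1, h2⟩ | ⟨u, h1, h2⟩
      · rw [he, he, h1, h2, map_zero]
      · rw [he, he, h1, h2, he]
    · simp only [mul_neg, map_neg, hy]
    · simp only [mul_add, map_add, hy, hy']
  · simp only [neg_mul, map_neg, hx]
  · simp only [add_mul, map_add, hx, hx']

end GrothDim

/-! ### Functionals on linear combinations, and embeddings into categories of idempotents -/

section Embeddings

open Bicategory Idempotents

universe w v u uk

namespace Lin

variable {k : Type uk} [CommRing k] {B : Type u} [Bicategory.{w, v} B]

/-- The linear extension of a function on the 2-morphisms of `B`. -/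
noncomputable def ev {a b : Lin k B} {f g : a ⟶ b} (c : (un f ⟶ un g) → k) : (f ⟶ g) →+ k :=
  (Finsupp.liftAddHom fun α => AddMonoidHom.mulRight (c α) : ((un f ⟶ un g) →₀ k) →+ k)

theorem ev_sg {a b : Lin k B} {f g : a ⟶ b} (c : (un f ⟶ un g) → k) (α : un f ⟶ un g) (r : k) :
    ev c (sg α r : f ⟶ g) = r * c α := by
  exact Finsupp.liftAddHom_apply_single _ _ _

theorem ev_id {a b : Lin k B} {f : a ⟶ b} (c : (un f ⟶ un f) → k) :
    ev c (𝟙 f) = c (𝟙 (un f)) := by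
  rw [id_eq, ev_sg, one_mul]

theorem ev_comp {a b : Lin k B} {f g h : a ⟶ b} {c : (un f ⟶ un g) → k} {c' : (un g ⟶ un h) → k}
    {c'' : (un f ⟶ un h) → k} (hc : ∀ α β, c'' (α ≫ β) = c α * c' β) (x : f ⟶ g) (y : g ⟶ h) :
    ev c'' (x ≫ y) = ev c x * ev c' y := by
  induction x using ind with
  | h0 => simp
  | ha x x' hx hx' => simp [add_mul, hx, hx']
  | hs α r =>
  induction y using ind with
  | h0 => simp
  | ha y y' hy hy' => simp [mul_add, hy, hy']
  | hs β s =>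
    rw [sg_comp, ev_sg, ev_sg, ev_sg, hc]
    ring

/-- Both sides are biadditive, so multiplicativity on 2-morphisms of `B` is enough; the three
functionals may differ, as they will for relations. -/
theorem ev_hcomp {a b d : Lin k B} {f f' : a ⟶ b} {g g' : b ⟶ d} {c : (un f ⟶ un f') → k}
    {c' : (un g ⟶ un g') → k} {c'' : (un f ≫ un g ⟶ un f' ≫ un g') → k}
    (hc : ∀ α β, c'' (hcomp α β) = c α * c' β) (x : f ⟶ f') (y : g ⟶ g') :
    ev (B := B) (a := a) (b := d) (f := f ≫ g) (g := f' ≫ g') c'' (hcomp x y) =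
      ev c x * ev c' y := by
  rw [hcomp_eq]
  induction x using ind with
  | h0 => rw [zero_hc]; simp
  | ha x x' hx hx' => rw [add_hc]; simp [add_mul, hx, hx']
  | hs α r =>
  induction y using ind with
  | h0 => rw [hc_zero]; simp
  | ha y y' hy hy' => rw [hc_add]; simp [mul_add, hy, hy']
  | hs β s =>
    rw [hc_sg, ev_sg, ev_sg]
    refine (ev_sg _ _ _).trans ?_
    rw [hc]
    ring

end Lin

/-- The embedding of the categories of 1-morphisms of `Kar (AddEnv B)` into the Karoubi envelopes of
the additive envelopes of the categories of 1-morphisms of `B`. -/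
noncomputable def Kar.embed {B : Type u} [Bicategory.{w, v} B] [LocallyPreadditive B]
    (a b : Kar (AddEnv B)) :
    (a ⟶ b) ⥤ Karoubi (Mat_ (a.obj.obj ⟶ b.obj.obj)) where
  obj F := ⟨AddEnv.un (Kar.un F).X, (Kar.un F).p, (Kar.un F).idem⟩
  map {F G} f := ⟨Kar.two f, Karoubi.Hom.comm (P := Kar.un F) (Q := Kar.un G) f⟩

instance {B : Type u} [Bicategory.{w, v} B] [LocallyPreadditive B] (a b : Kar (AddEnv B)) :
    (Kar.embed a b).Full where
  map_surjective f := ⟨Kar.ofTwo f.f f.comm, rfl⟩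

instance {B : Type u} [Bicategory.{w, v} B] [LocallyPreadditive B] (a b : Kar (AddEnv B)) :
    (Kar.embed a b).Faithful where
  map_injective h := Kar.two_ext (congrArg Karoubi.Hom.f h)

instance {B : Type u} [Bicategory.{w, v} B] [LocallyPreadditive B] (a b : Kar (AddEnv B)) :
    (Kar.embed a b).Additive where
  map_add := rfl

/-- The embedding of the categories of 1-morphisms of `Split (AddEnv B)` into the Karoubi envelopes
of the additive envelopes of the categories of 1-morphisms of `B`. -/
noncomputable def Split.embed {B : Type u} [Bicategory.{w, v} B] [LocallyPreadditive B]
    (X Y : Split (AddEnv B)) : (X ⟶ Y) ⥤ Karoubi (Mat_ (X.obj.obj.obj ⟶ Y.obj.obj.obj)) where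
  -- The identity 2-morphism of `F` in the splitting is the idempotent cut by the two primitive
  -- idempotents, so the ranks must be taken of `Split.idp F`.
  obj F := ⟨AddEnv.un (Kar.un F.mor).X, Split.idp F, Split.idp_idem F⟩
  map {F G} f := ⟨Split.tw (F := F) (G := G) f, by
    refine Eq.trans ?_ (Split.idp_tw (F := F) (G := G) f)
    exact congrArg (Split.idp F ≫ ·) (Split.tw_idp (F := F) (G := G) f)⟩
  map_id F := Karoubi.hom_ext _ _ (Split.tw_id F)

instance {B : Type u} [Bicategory.{w, v} B] [LocallyPreadditive B] (X Y : Split (AddEnv B)) :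
    (Split.embed X Y).Full where
  map_surjective f := ⟨Split.ofTw f.f f.comm, rfl⟩

instance {B : Type u} [Bicategory.{w, v} B] [LocallyPreadditive B] (X Y : Split (AddEnv B)) :
    (Split.embed X Y).Faithful where
  map_injective {F G} _ _ h := by
    have h' := congrArg Karoubi.Hom.f h
    exact Split.tw_ext (F := F) (G := G) h'

instance {B : Type u} [Bicategory.{w, v} B] [LocallyPreadditive B] (X Y : Split (AddEnv B)) :
    (Split.embed X Y).Additive where
  map_add := rfl

end Embeddings

/-! ### The decategorification of the bicategory of an ordered monoid -/

section OrderedMonoid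

open Bicategory

variable (k : Type*) [Field k] {S : Type*} [Monoid S] [PartialOrder S] [MulLeftMono S]
  [MulRightMono S]

namespace OrdTwo

/-- The element of the monoid underlying a 1-morphism of the linearization. -/
def lval {k : Type*} [Field k] {a b : Lin k (OrdTwo S)} (x : a ⟶ b) : S := val (Lin.un x)

/-- Parallel 2-morphisms coincide, so each hom space has dimension at most one. -/
theorem eq_sg {k : Type*} [Field k] {a b : Lin k (OrdTwo S)} {x y : a ⟶ b} (f : x ⟶ y)
    (α : Lin.un x ⟶ Lin.un y) : ∃ r, f = Lin.sg α r := by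
  induction f using Lin.ind with
  | h0 => exact ⟨0, (Finsupp.single_zero _).symm⟩
  | ha f g hf hg =>
    obtain ⟨r, rfl⟩ := hf
    obtain ⟨s, rfl⟩ := hg
    exact ⟨r + s, (Finsupp.single_add _ _ _).symm⟩
  | hs β r => exact ⟨r, by rw [two_ext α β]⟩

theorem eq_zero_of_not_le {k : Type*} [Field k] {a b : Lin k (OrdTwo S)} {x y : a ⟶ b} (f : x ⟶ y)
    (h : ¬ lval x ≤ lval y) : f = 0 := by
  induction f using Lin.ind with
  | h0 => rfl
  | ha f g hf hg => rw [hf, hg, add_zero]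
  | hs β r => exact absurd β.down h

open scoped Classical in
/-- The functional on 2-morphisms that vanishes on the morphisms between different elements and on
the endomorphisms of all elements different from `s`. -/
noncomputable def char (s : S) {a b : Lin k (OrdTwo S)} {x y : a ⟶ b} : (x ⟶ y) →+ k :=
  Lin.ev fun _ => if lval x = s ∧ lval y = s then 1 else 0

theorem char_sg (s : S) {a b : Lin k (OrdTwo S)} {x y : a ⟶ b} (α : Lin.un x ⟶ Lin.un y) (r : k)
    (hx : lval x = s) (hy : lval y = s) : char k s (Lin.sg α r : x ⟶ y) = r := by
  rw [char, Lin.ev_sg, if_pos ⟨hx, hy⟩, mul_one]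

theorem char_eq_zero (s : S) {a b : Lin k (OrdTwo S)} {x y : a ⟶ b} (f : x ⟶ y)
    (h : ¬ (lval x = s ∧ lval y = s)) : char k s f = 0 := by
  induction f using Lin.ind with
  | h0 => exact map_zero _
  | ha f g hf hg => rw [map_add, hf, hg, add_zero]
  | hs β r => rw [char, Lin.ev_sg, if_neg h, mul_zero]

open scoped Classical in
theorem char_id (s : S) {a b : Lin k (OrdTwo S)} (x : a ⟶ b) :
    char k s (𝟙 x) = if lval x = s then 1 else 0 := by
  rw [char, Lin.ev_id]
  simp

/-- The common kernel of the functionals thus lives only between elements with a strict inequality.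
-/
theorem eq_zero_of_char {a b : Lin k (OrdTwo S)} {x y : a ⟶ b} (f : x ⟶ y)
    (h : ∀ s, char k s f = 0) (h' : ¬ lval x < lval y) : f = 0 := by
  by_cases hle : lval x ≤ lval y
  · have heq : lval x = lval y := hle.eq_of_not_lt h'
    obtain ⟨r, rfl⟩ := eq_sg f ⟨hle⟩
    have h1 := h (lval x)
    rw [char_sg k _ _ _ rfl heq.symm] at h1
    rw [h1]
    exact Finsupp.single_zero _
  · exact eq_zero_of_not_le f hle

/-- A nonzero entry of the m-th power needs a strictly increasing chain of m steps in the monoid,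
and each step enlarges the set of elements below. -/
theorem isNilpotent_of_char [Finite S] {a b : Lin k (OrdTwo S)} {M : Mat_ (a ⟶ b)} (f : M ⟶ M)
    (h : ∀ s i j, char k s (f i j) = 0) : IsNilpotent (R := End M) f := by
  let f' : End M := f
  have key : ∀ (m : ℕ) (i j : M.ι), (f' ^ m : Mat_.Hom M M) i j ≠ 0 →
      (Set.Iic (lval (M.X i))).ncard + m ≤ (Set.Iic (lval (M.X j))).ncard := by
    intro m
    induction m with
    | zero =>
      intro i j hij
      have : i = j := by
        by_contra hne
        exact hij (Mat_.id_apply_of_ne M i j hne)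
      rw [this, add_zero]
    | succ m ih =>
      intro i j hij
      have h1 : (f' ^ (m + 1) : Mat_.Hom M M) i j =
          ∑ l, (f : Mat_.Hom M M) i l ≫ (f' ^ m : Mat_.Hom M M) l j := by
        rw [pow_succ]
        exact Mat_.comp_apply f (f' ^ m : End M) i j
      rw [h1] at hij
      obtain ⟨l, -, hl⟩ := Finset.exists_ne_zero_of_sum_ne_zero hij
      have h2 := ih l j fun h0 => hl (by rw [h0, comp_zero])
      have h3 : lval (M.X i) < lval (M.X l) := by
        by_contra hlt
        exact hl (by rw [eq_zero_of_char k (f i l) (fun s => h s i l) hlt, zero_comp])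
      have h4 := Set.ncard_lt_ncard (Set.Iic_ssubset_Iic.2 h3) (Set.toFinite _)
      omega
  -- A down-set has at most |S| elements, so it cannot grow by |S| + 1.
  refine ⟨Nat.card S + 1, Mat_.hom_ext _ _ fun i j => ?_⟩
  by_contra h0
  have h1 := key _ i j h0
  have h2 := Set.ncard_le_card (Set.Iic (lval (M.X j)))
  omega

variable [Finite S]

/-- The functionals `char k s` form a system as required for dimension vectors. -/
noncomputable def charSystem (a b : Lin k (OrdTwo S)) : CharSystem k (a ⟶ b) S where
  χ s _ _ := char k s
  map_comp s {x y z} f g := by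
    by_cases h : lval x = s ∧ lval z = s
    · by_cases hy : lval y = s
      · exact Lin.ev_comp (fun _ _ => by simp [h, hy]) f g
      · rw [char_eq_zero k s f (fun h' => hy h'.2), zero_mul]
        -- A composite from s to s through y ≠ s would need s ≤ y ≤ s, so by antisymmetry one factor
        -- is zero.
        by_cases h1 : lval x ≤ lval y
        · by_cases h2 : lval y ≤ lval z
          · exact absurd (le_antisymm (by rwa [h.2] at h2) (by rwa [h.1] at h1)) hy
          · rw [eq_zero_of_not_le g h2, comp_zero, map_zero]
        · rw [eq_zero_of_not_le f h1, zero_comp, map_zero]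
    · rw [char_eq_zero k s _ h]
      by_cases hx : lval x = s
      · rw [char_eq_zero k s g (fun h' => h ⟨hx, h'.2⟩), mul_zero]
      · rw [char_eq_zero k s f (fun h' => hx h'.1), zero_mul]
  full {x y} c hc := by
    have hc' : ∀ s, ¬ (lval x = s ∧ lval y = s) → c s = 0 := fun s hs => by
      rw [← hc s, char_id, char_id]
      by_cases hx : lval x = s
      · rw [if_neg fun hy => hs ⟨hx, hy⟩, mul_zero]
      · rw [if_neg hx, zero_mul, zero_mul]
    by_cases h : lval x = lval y
    · refine ⟨Lin.sg ⟨le_of_eq h⟩ (c (lval x)), fun s => ?_⟩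
      by_cases hs : lval x = s
      · subst hs
        exact char_sg k _ _ _ rfl h.symm
      · rw [char_eq_zero k s _ (fun h' => hs h'.1), hc' s fun h' => hs h'.1]
    · refine ⟨0, fun s => ?_⟩
      rw [map_zero, hc' s fun h' => h (h'.1.trans h'.2.symm)]
  nil f h := isNilpotent_of_char k f h

/-- The multiplicities of the elements of the monoid in a 1-morphism of the finitarization. -/
noncomputable def mult {a b : Kar (AddEnv (Lin k (OrdTwo S)))} (F : a ⟶ b) : S → ℕ :=
  (charSystem k a.obj.obj b.obj.obj).dim (Kar.embed a b) F

-- Phrased for any one-point index type so as to cover composites, whose index type is a product of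
-- one-point types.
open scoped Classical in
theorem mult_of_unique {a b : Kar (AddEnv (Lin k (OrdTwo S)))} (F : a ⟶ b)
    [Unique (AddEnv.un (Kar.un F).X).ι] (hF : (Kar.un F).p = 𝟙 _) (s : S)
    (hs : lval ((AddEnv.un (Kar.un F).X).X default) = s) : mult k F = Pi.single s 1 := by
  have key : ∀ (t : S) (i : (AddEnv.un (Kar.un F).X).ι),
      char k t (AddEnv.ent (Kar.un F).p i i) = if s = t then 1 else 0 := fun t i => by
    rw [hF, Subsingleton.elim i default]
    refine (congrArg (char k t) (Mat_.id_apply_self (AddEnv.un (Kar.un F).X) default)).trans ?_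
    rw [char_id, hs]
  funext t
  by_cases h : t = s
  · subst h
    rw [Pi.single_eq_same]
    have : Unique ((Kar.embed a b).obj F).X.ι := inferInstanceAs (Unique (AddEnv.un (Kar.un F).X).ι)
    exact CharSystem.dim_eq_one _ _ fun i => (key t i).trans (if_pos rfl)
  · rw [Pi.single_eq_of_ne h]
    refine CharSystem.dim_eq_zero _ _ fun i j => ?_
    rw [Subsingleton.elim (α := (AddEnv.un (Kar.un F).X).ι) j i]
    exact (key t i).trans (if_neg (Ne.symm h))

/-- An element of the monoid as a 1-morphism of the finitarization. -/
noncomputable def elt (s : S) : Fin2.obj k (pt : OrdTwo S) ⟶ Fin2.obj k pt := Fin2.mor k (mor s)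

open scoped Classical in
theorem mult_elt (s : S) : mult k (elt k s) = Pi.single s 1 :=
  have : Unique (AddEnv.un (Kar.un (elt k s)).X).ι := inferInstanceAs (Unique PUnit)
  mult_of_unique k _ rfl s rfl

open scoped Classical in
theorem mult_elt_comp_elt (s t : S) : mult k (elt k s ≫ elt k t) = Pi.single (t * s) 1 :=
  have : Unique (AddEnv.un (Kar.un (elt k s ≫ elt k t)).X).ι :=
    Unique.mk' (PUnit × PUnit)
  mult_of_unique k (elt k s ≫ elt k t) (hcomp_id (Kar.un (elt k s)).X (Kar.un (elt k t)).X) _ rfl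

theorem isDimVector_mult (a b : Kar (AddEnv (Lin k (OrdTwo S)))) :
    IsDimVector (mult k : (a ⟶ b) → S → ℕ) :=
  CharSystem.isDimVector _ _ fun {X t} _ => by
    classical
    obtain ⟨⟨⟨⟨⟩⟩⟩⟩ := a
    obtain ⟨⟨⟨⟨⟩⟩⟩⟩ := b
    have h := mult_elt k t
    exact ⟨elt k t, (congrFun h t).trans (Pi.single_eq_same _ _),
      fun s hs => (congrFun h s).trans (Pi.single_eq_of_ne hs _)⟩

theorem cls_eq_cls_elt {a b : Kar (AddEnv (Lin k (OrdTwo S)))} (F : a ⟶ b) (s : S) 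
    (h : mult k F = mult k (elt k s)) :
    Groth.cls F = Groth.cls (elt k s) := by
  obtain ⟨⟨⟨⟨⟩⟩⟩⟩ := a
  obtain ⟨⟨⟨⟨⟩⟩⟩⟩ := b
  obtain ⟨e⟩ := (isDimVector_mult k _ _).iso h
  exact congrArg (Groth.incl _ _) (K0.of_iso e)

variable (S) in
theorem exists_ringEquiv : ∃ ψ : Groth (Fin2 k (OrdTwo S)) ≃+* MonoidAlgebra ℤ S,
    ∀ s : S, ψ (Groth.cls (elt k s)) = MonoidAlgebra.single s 1 := by
  classical
  have := Fintype.ofFinite S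
  refine Groth.exists_ringEquiv (B := Fin2 k (OrdTwo S)) (fun F => mult k F) (isDimVector_mult k)
    (fun _ => Fin2.obj k pt)
    (fun _ => Fin2.obj k pt) (fun s => elt k s) (mult_elt k)
    (fun F s h => cls_eq_cls_elt k F s (h.trans (mult_elt k s).symm))
    -- The monoid itself is the basis here. The class of s times the class of t is that of t
    -- followed by s, which is again s * t.
    MonoidAlgebra.coeffAddEquiv.symm (fun s t => Or.inr ⟨s * t, ?_, ?_⟩)
  · refine (Groth.incl_mul_incl _ _).trans ?_
    rw [K0.comp_of]
    exact cls_eq_cls_elt k _ _ ((mult_elt_comp_elt k t s).trans (mult_elt k (s * t)).symm)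
  · exact (MonoidAlgebra.single_mul_single ..).trans (by rw [one_mul]; rfl)

theorem indecomposable_elt (s : S) : Indecomposable (elt k s) := by
  classical
  refine (isDimVector_mult k _ _).indecomposable (t := s) (fun t ht => ?_) ?_
  · by_contra h
    exact ht ((congrFun (mult_elt k s) t).trans (Pi.single_eq_of_ne h _))
  · exact (congrFun (mult_elt k s) s).trans (Pi.single_eq_same _ _)

theorem exists_iso_elt (F : Fin2.obj k (pt : OrdTwo S) ⟶ Fin2.obj k pt) (hF : Indecomposable F) :
    ∃ s : S, Nonempty (F ≅ elt k s) := by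
  classical
  have := Fintype.ofFinite S
  obtain ⟨s, hs⟩ := (isDimVector_mult k _ _).exists_single_of_indecomposable hF
  exact ⟨s, (isDimVector_mult k _ _).iso (hs.trans (mult_elt k s).symm)⟩

end OrdTwo

end OrderedMonoid

/-! ### Alternating sums over subsets -/

section Alternating

variable {α A : Type*} [AddCommGroup A]

/-- The alternating sum of a function over the subsets of a finite set. -/
def altSum (X : Finset α) (f : Finset α → A) : A :=
  ∑ Y ∈ X.powerset, (-1 : ℤ) ^ (X.card - Y.card) • f Y

theorem altSum_congr {X : Finset α} {f g : Finset α → A} (h : ∀ Y ⊆ X, f Y = g Y) :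
    altSum X f = altSum X g :=
  Finset.sum_congr rfl fun Y hY => by rw [h Y (Finset.mem_powerset.1 hY)]

theorem altSum_map {β : Type*} (X : Finset α) (σ : α ↪ β) (f : Finset β → A) :
    altSum (X.map σ) f = altSum X fun Y => f (Y.map σ) := by
  have : (X.map σ).powerset = X.powerset.map (Finset.mapEmbedding σ).toEmbedding := by
    ext Y
    simp only [Finset.mem_powerset, Finset.mem_map, Finset.subset_map_iff]
    exact ⟨fun ⟨u, h1, h2⟩ => ⟨u, h1, h2.symm⟩, fun ⟨u, h1, h2⟩ => ⟨u, h1, h2.symm⟩⟩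
  rw [altSum, this, Finset.sum_map, altSum]
  simp

variable [DecidableEq α]

/-- The subsets pair off as Y and Y ∪ {x}, with equal values and opposite signs. -/
theorem altSum_eq_zero {X : Finset α} {x : α} (hx : x ∈ X) {f : Finset α → A}
    (h : ∀ Y, f (insert x Y) = f Y) : altSum X f = 0 := by
  obtain ⟨X, hX, rfl⟩ : ∃ X', x ∉ X' ∧ insert x X' = X :=
    ⟨X.erase x, Finset.notMem_erase x X, Finset.insert_erase hx⟩
  rw [altSum, Finset.sum_powerset_insert hX, ← Finset.sum_add_distrib]
  refine Finset.sum_eq_zero fun Y hY => ?_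
  have hY' := Finset.mem_powerset.1 hY
  have h1 := Finset.card_le_card hY'
  rw [h, Finset.card_insert_of_notMem hX, Finset.card_insert_of_notMem fun h => hX (hY' h),
    Nat.add_sub_add_right, Nat.sub_add_comm h1, pow_succ]
  simp

/-- Möbius inversion for subsets: if Z is properly contained in X, the condition Z ⊆ Y does not see
a point of X outside Z. -/
theorem altSum_superset (X Z : Finset α) (a : A) :
    altSum X (fun Y => if Z ⊆ Y then a else 0) = if Z = X then a else 0 := by
  by_cases h : Z = X
  · subst h
    rw [if_pos rfl, altSum, Finset.sum_eq_single Z]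
    · simp
    · intro Y hY hne
      rw [if_neg fun h => hne (Finset.Subset.antisymm (Finset.mem_powerset.1 hY) h), smul_zero]
    · simp
  · rw [if_neg h]
    by_cases hZ : Z ⊆ X
    · obtain ⟨x, hx, hxZ⟩ := Finset.exists_of_ssubset (hZ.ssubset_of_ne h)
      exact altSum_eq_zero hx fun Y => by simp only [Finset.subset_insert_iff_of_notMem hxZ]
    · refine Finset.sum_eq_zero fun Y hY => ?_
      exact (congrArg _ (if_neg fun h' => hZ (h'.trans (Finset.mem_powerset.1 hY)))).trans
        (smul_zero _)

/-- The inner sum vanishes unless X ⊆ W, as a point of X outside W is invisible in Z ∩ W; the outer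
sum is then `altSum_superset`. This is the cancellation behind the product of Möbius elements. -/
theorem altSum_altSum_inter (V X : Finset α) (f : Finset α → A) :
    altSum V (fun W => altSum X fun Z => f (Z ∩ W)) = if X = V then altSum X f else 0 := by
  rw [← altSum_superset]
  refine altSum_congr fun W _ => ?_
  by_cases h : X ⊆ W
  · rw [if_pos h]
    exact altSum_congr fun Z hZ => by rw [Finset.inter_eq_left.2 (hZ.trans h)]
  · rw [if_neg h]
    obtain ⟨x, hx, hxW⟩ := Finset.not_subset.1 h
    exact altSum_eq_zero hx fun Z => by rw [Finset.insert_inter_of_notMem hxW]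

end Alternating

/-! ### The Möbius basis of the algebra of the symmetric inverse monoid -/

namespace IS

variable {n : ℕ}

/-- The domain of a partial injective map. -/
def dom (p : IS n) : Finset (Fin n) := Finset.univ.filter fun x => (p x).isSome

/-- The range of a partial injective map. -/
def ran (p : IS n) : Finset (Fin n) := dom (PEquiv.symm p)

theorem mem_dom {p : IS n} {x : Fin n} : x ∈ dom p ↔ ∃ y, y ∈ p x := by
  simp [dom, Option.isSome_iff_exists]

theorem mem_ran {p : IS n} {y : Fin n} : y ∈ ran p ↔ ∃ x, y ∈ p x := by
  rw [ran, mem_dom]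
  exact exists_congr fun x => PEquiv.mem_iff_mem p

theorem mem_restr {σ : Equiv.Perm (Fin n)} {X : Finset (Fin n)} {x y : Fin n} :
    y ∈ restr σ X x ↔ x ∈ X ∧ σ x = y := by
  classical
  rw [restr, PEquiv.mem_trans]
  constructor
  · rintro ⟨z, h1, h2⟩
    obtain ⟨rfl, h3⟩ := PEquiv.mem_ofSet_iff.1 h1
    exact ⟨h3, by simpa using h2⟩
  · rintro ⟨h1, rfl⟩
    exact ⟨x, PEquiv.mem_ofSet_iff.2 ⟨rfl, h1⟩, by simp⟩

theorem ext' {p q : IS n} (h : ∀ x y, y ∈ p x ↔ y ∈ q x) : p = q :=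
  PEquiv.ext fun x => Option.ext fun y => h x y

theorem dom_restr (σ : Equiv.Perm (Fin n)) (X : Finset (Fin n)) : dom (restr σ X) = X := by
  ext x
  simp only [mem_dom, mem_restr, exists_and_left, exists_eq', and_true]

theorem ran_restr (σ : Equiv.Perm (Fin n)) (X : Finset (Fin n)) :
    ran (restr σ X) = X.map σ.toEmbedding := by
  ext y
  simp only [mem_ran, mem_restr, Finset.mem_map, Equiv.coe_toEmbedding]

theorem restr_dom_of_le {p : IS n} {σ : Equiv.Perm (Fin n)} (h : ∀ x y, y ∈ p x → σ x = y) :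
    restr σ (dom p) = p := by
  refine ext' fun x y => ?_
  rw [mem_restr, mem_dom]
  constructor
  · rintro ⟨⟨z, hz⟩, rfl⟩
    rwa [h _ _ hz]
  · intro hy
    exact ⟨⟨y, hy⟩, h _ _ hy⟩

theorem restr_le_restr (σ : Equiv.Perm (Fin n)) {X Y : Finset (Fin n)} (h : X ⊆ Y) :
    restr σ X ≤ restr σ Y :=
  PEquiv.le_def.2 fun _ _ hy => mem_restr.2 ⟨h (mem_restr.1 hy).1, (mem_restr.1 hy).2⟩

/-- A partial injection of a finite set extends to a permutation, so computations in `IS n` can be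
made with pairs of a permutation and a subset. -/
theorem exists_restr_eq (p : IS n) : ∃ σ : Equiv.Perm (Fin n), restr σ (dom p) = p := by
  classical
  have h1 : ∀ x : {x // x ∈ dom p}, ∃ y, y ∈ p x := fun x => mem_dom.1 x.2
  choose f hf using h1
  have hinj : Function.Injective f := fun x x' h =>
    Subtype.ext (p.inj (hf x) (by rw [h]; exact hf x'))
  obtain ⟨σ, hσ⟩ := Equiv.Perm.exists_extending_pair _ f Subtype.val_injective hinj
  refine ⟨σ, restr_dom_of_le fun x y hy => ?_⟩
  have hx : x ∈ dom p := mem_dom.2 ⟨y, hy⟩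
  exact (hσ ⟨x, hx⟩).trans (Option.mem_unique (hf ⟨x, hx⟩) hy)

/-- Writing the domain of the left factor as an image under σ makes the domain of the product a
plain intersection. -/
theorem restr_mul_restr (τ σ : Equiv.Perm (Fin n)) (W Z : Finset (Fin n)) :
    restr τ (W.map σ.toEmbedding) * restr σ Z = restr (τ * σ) (Z ∩ W) := by
  refine ext' fun x y => ?_
  simp only [mem_mul, mem_restr, Finset.mem_inter]
  constructor
  · rintro ⟨_, ⟨h1, rfl⟩, h2, rfl⟩
    exact ⟨⟨h1, by simpa using h2⟩, rfl⟩
  · rintro ⟨⟨h1, h2⟩, rfl⟩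
    exact ⟨σ x, ⟨h1, rfl⟩, by simpa using h2, rfl⟩

theorem diffCard_restr (σ : Equiv.Perm (Fin n)) {X Z : Finset (Fin n)} (h : Z ⊆ X) :
    diffCard (restr σ X) (restr σ Z) = X.card - Z.card := by
  have h1 : {p : Fin n × Fin n | p.2 ∈ restr σ X p.1 ∧ p.2 ∉ restr σ Z p.1} =
      (fun x => (x, σ x)) '' (X \ Z : Finset (Fin n)) := by
    ext ⟨x, y⟩
    simp only [Set.mem_ofPred_eq, mem_restr, Set.mem_image, Finset.mem_coe, Finset.mem_sdiff,
      Prod.mk.injEq]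
    constructor
    · rintro ⟨⟨h1, rfl⟩, h2⟩
      exact ⟨x, ⟨h1, fun h3 => h2 ⟨h3, rfl⟩⟩, rfl, rfl⟩
    · rintro ⟨_, ⟨h1, h2⟩, rfl, rfl⟩
      exact ⟨⟨h1, rfl⟩, fun h3 => h2 h3.1⟩
  rw [diffCard, h1, Set.ncard_image_of_injective _ fun x y h => congrArg Prod.fst h,
    Set.ncard_coe_finset, Finset.card_sdiff_of_subset h]

/-- The partial maps below σ|_X are the σ|_Z with Z ⊆ X, so the sum runs over a Boolean lattice. -/
theorem moebius_restr (σ : Equiv.Perm (Fin n)) (X : Finset (Fin n)) :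
    moebius (restr σ X) = altSum X fun Z => MonoidAlgebra.single (restr σ Z) (1 : ℤ) := by
  have hle : ∀ r : IS n, r ≤ restr σ X → restr σ (dom r) = r ∧ dom r ⊆ X := fun r hr => by
    have h1 : ∀ x y, y ∈ r x → x ∈ X ∧ σ x = y := fun x y h =>
      mem_restr.1 (PEquiv.le_def.1 hr x y h)
    exact ⟨restr_dom_of_le fun x y h => (h1 x y h).2, fun x hx => by
      obtain ⟨y, hy⟩ := mem_dom.1 hx
      exact (h1 x y hy).1⟩
  refine Finset.sum_nbij' dom (restr σ) (fun r hr => ?_) (fun Z hZ => ?_) (fun r hr => ?_)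
    (fun Z _ => dom_restr σ Z) (fun r hr => ?_)
  · exact Finset.mem_powerset.2 (hle r (by simpa using hr)).2
  · simpa using restr_le_restr σ (Finset.mem_powerset.1 hZ)
  · exact (hle r (by simpa using hr)).1
  · obtain ⟨h1, h2⟩ := hle r (by simpa using hr)
    rw [← diffCard_restr σ h2, MonoidAlgebra.smul_single, smul_eq_mul, mul_one, h1]

/-- Expanding both factors and pulling the left one back along σ gives a double alternating sum of
the restrictions of τσ to Z ∩ V, which collapses by `altSum_altSum_inter`. -/
theorem moebius_mul_moebius (τ σ : Equiv.Perm (Fin n)) (W X : Finset (Fin n)) :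
    moebius (restr τ (W.map σ.toEmbedding)) * moebius (restr σ X) =
      if X = W then moebius (restr (τ * σ) X) else 0 := by
  rw [moebius_restr, moebius_restr, moebius_restr, ← altSum_altSum_inter, altSum_map]
  unfold altSum
  rw [Finset.sum_mul]
  refine Finset.sum_congr rfl fun V _ => ?_
  rw [Finset.mul_sum, Finset.smul_sum]
  refine Finset.sum_congr rfl fun Z _ => ?_
  rw [smul_mul_smul_comm, MonoidAlgebra.single_mul_single, restr_mul_restr, mul_one, mul_smul]

theorem moebius_mul_of_ne {p q : IS n} (h : ran q ≠ dom p) : moebius p * moebius q = 0 := by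
  obtain ⟨τ, hτ⟩ := exists_restr_eq p
  obtain ⟨σ, hσ⟩ := exists_restr_eq q
  obtain ⟨W, hW⟩ : ∃ W : Finset (Fin n), W.map σ.toEmbedding = dom p :=
    ⟨(dom p).map σ.symm.toEmbedding, by ext; simp⟩
  rw [← hτ, ← hσ, ← hW, moebius_mul_moebius, if_neg]
  rintro rfl
  rw [← hσ, ran_restr] at h
  exact h hW

/-- The Möbius element of σ|_X is σ|_X plus terms on smaller domains, so induction over subsets
recovers every standard basis element. -/
theorem surjective_moebius :
    Function.Surjective (Finsupp.linearCombination ℤ (moebius : IS n → _)) := by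
  have key : ∀ (σ : Equiv.Perm (Fin n)) (X : Finset (Fin n)),
      MonoidAlgebra.single (restr σ X) (1 : ℤ) ∈
        LinearMap.range (Finsupp.linearCombination ℤ (moebius : IS n → _)) := by
    intro σ X
    induction X using Finset.strongInduction with
    | H X ih =>
    have h1 := moebius_restr σ X
    rw [altSum, ← Finset.add_sum_erase _ _ (Finset.mem_powerset_self X), Nat.sub_self, pow_zero,
      one_smul, ← sub_eq_iff_eq_add] at h1
    rw [← h1]
    refine Submodule.sub_mem _ ⟨Finsupp.single (restr σ X) 1, by simp⟩
      (Submodule.sum_mem _ fun Z hZ => Submodule.smul_mem _ _ (ih Z ?_))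
    rw [Finset.mem_erase, Finset.mem_powerset] at hZ
    exact hZ.2.ssubset_of_ne hZ.1
  rw [← LinearMap.range_eq_top, eq_top_iff]
  intro x _
  induction x using MonoidAlgebra.induction_linear with
  | zero => exact Submodule.zero_mem _
  | add f g hf hg => exact Submodule.add_mem _ (hf trivial) (hg trivial)
  | single p r =>
    obtain ⟨σ, hσ⟩ := exists_restr_eq p
    have h1 := Submodule.smul_mem _ r (key σ (dom p))
    rwa [hσ, MonoidAlgebra.smul_single, smul_eq_mul, mul_one] at h1

/-- The change of basis to the Möbius basis. -/
theorem exists_moebius_equiv : ∃ M : (IS n →₀ ℤ) ≃+ MonoidAlgebra ℤ (IS n),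
    ∀ p, M (Finsupp.single p 1) = moebius p := by
  have := Fintype.ofFinite (IS n)
  let c : MonoidAlgebra ℤ (IS n) →+ (IS n →₀ ℤ) :=
    (MonoidAlgebra.coeffAddEquiv : MonoidAlgebra ℤ (IS n) ≃+ _).toAddMonoidHom
  have hinj : Function.Injective fun x =>
      c (Finsupp.linearCombination ℤ (moebius : IS n → _) x) :=
        -- A surjective endomorphism of a finitely generated module is injective; `c` identifies the
        -- algebra with the free module on `IS n` to make this an endomorphism.
        OrzechProperty.injective_of_surjective_endomorphism
    (c.toIntLinearMap ∘ₗ Finsupp.linearCombination ℤ (moebius : IS n → _))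
    ((MonoidAlgebra.coeffAddEquiv : MonoidAlgebra ℤ (IS n) ≃+ _).surjective.comp
      surjective_moebius)
  refine ⟨AddEquiv.ofBijective (Finsupp.linearCombination ℤ (moebius : IS n → _))
    ⟨fun x y h => hinj (congrArg c h), surjective_moebius⟩, fun p => ?_⟩
  exact (Finsupp.linearCombination_single ℤ 1 p).trans (one_smul ℤ _)

end IS

/-! ### Functionals on the linearization of the bicategory of the symmetric group -/

section SymmetricGroup

open Bicategory

open scoped SetRel

/-- A partial injective map as a binary relation. -/
def IS.graph {n : ℕ} (p : IS n) : SetRel (Fin n) (Fin n) := {q | q.2 ∈ p q.1}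

theorem IS.mem_graph {n : ℕ} {p : IS n} {x y : Fin n} : (x, y) ∈ p.graph ↔ y ∈ p x := Iff.rfl

theorem IS.graph_injective {n : ℕ} : Function.Injective (IS.graph (n := n)) := fun p q h =>
  IS.ext' fun x y => by rw [← IS.mem_graph, h, IS.mem_graph]

namespace SymTwo

variable {k : Type*} [Field k] {n : ℕ} {a b c : Lin k (SymTwo n)}

/-- The permutation underlying a 1-morphism of the linearization. -/
def lval (x : a ⟶ b) : Equiv.Perm (Fin n) := val (Lin.un x)

theorem mem_graph {σ : Equiv.Perm (Fin n)} {x y : Fin n} : (x, y) ∈ graph σ ↔ σ x = y := Iff.rfl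

theorem graph_subset_graph_iff {p : IS n} {σ : Equiv.Perm (Fin n)} :
    p.graph ⊆ graph σ ↔ restr σ p.dom = p :=
  ⟨fun h => IS.restr_dom_of_le fun x y hy => h (IS.mem_graph.2 hy), fun h => by
    rintro ⟨x, y⟩ hy
    rw [← h, IS.mem_graph, IS.mem_restr] at hy
    exact hy.2⟩

/-- Hence the 2-morphisms σ ⟶ τ are the elements of `IS n` lying below both permutations, which is
why `IS n` indexes the functionals. -/
theorem exists_graph_eq {r : SetRel (Fin n) (Fin n)} {σ : Equiv.Perm (Fin n)} (h : r ⊆ graph σ) :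
    ∃ p : IS n, p.graph = r := by
  classical
  refine ⟨restr σ (Finset.univ.filter fun x => (x, σ x) ∈ r), ?_⟩
  ext ⟨x, y⟩
  rw [IS.mem_graph, IS.mem_restr, Finset.mem_filter]
  constructor
  · rintro ⟨⟨-, h1⟩, rfl⟩
    exact h1
  · intro h1
    have h2 : σ x = y := h h1
    subst h2
    exact ⟨⟨Finset.mem_univ _, h1⟩, rfl⟩

/-- `hcomp` is a vertical composite of two whiskerings, hence an intersection. The two intermediate
points agree because α lies in the graph of σ'. -/
theorem rel_hcomp {i j l : SymTwo n} {σ σ' : i ⟶ j} {τ τ' : j ⟶ l} (α : σ ⟶ σ') (β : τ ⟶ τ') :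
    rel (hcomp α β) = rel α ○ rel β := by
  change (graph (val σ') ○ rel β) ∩ (rel α ○ graph (val τ)) = _
  ext ⟨x, z⟩
  constructor
  · rintro ⟨⟨y, h1, h2⟩, ⟨y', h3, h4⟩⟩
    obtain rfl : y = y' := (mem_graph.1 h1).symm.trans (rel_sub α h3).2
    exact ⟨y, h3, h2⟩
  · rintro ⟨y, h1, h2⟩
    exact ⟨⟨y, (rel_sub α h1).2, h2⟩, ⟨y, h1, (rel_sub β h2).1⟩⟩

open scoped Classical in
/-- The functional that takes the value one on the relations containing `r` and the value zero on
all other relations. -/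
noncomputable def char (r : SetRel (Fin n) (Fin n)) {x y : a ⟶ b} : (x ⟶ y) →+ k :=
  Lin.ev fun α => if r ⊆ rel α then 1 else 0

open scoped Classical in
theorem char_sg (r : SetRel (Fin n) (Fin n)) {x y : a ⟶ b} (α : Lin.un x ⟶ Lin.un y) (t : k) :
    char r (Lin.sg α t : x ⟶ y) = if r ⊆ rel α then t else 0 := by
  rw [char, Lin.ev_sg, mul_ite, mul_one, mul_zero]

/-- A relation lies in an intersection exactly if it lies in both parts. -/
theorem char_comp (r : SetRel (Fin n) (Fin n)) {x y z : a ⟶ b} (f : x ⟶ y) (g : y ⟶ z) :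
    char r (f ≫ g) = char r f * char r g := by
  refine Lin.ev_comp (fun α β => ?_) f g
  have h : r ⊆ rel (α ≫ β) ↔ r ⊆ rel α ∧ r ⊆ rel β :=
    Set.subset_inter_iff.trans and_comm
  classical
  refine (if_congr h rfl rfl).trans ?_
  split_ifs <;> simp_all

open scoped Classical in
theorem char_id (r : SetRel (Fin n) (Fin n)) (x : a ⟶ b) :
    char r (𝟙 x) = if r ⊆ graph (lval x) then (1 : k) else 0 := by
  rw [char, Lin.ev_id]
  rfl

theorem char_eq_zero {r : SetRel (Fin n) (Fin n)} {x y : a ⟶ b}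
    (h : ¬ r ⊆ graph (lval x) ∩ graph (lval y)) (f : x ⟶ y) : char r f = 0 := by
  induction f using Lin.ind with
  | h0 => exact map_zero _
  | ha f g hf hg => rw [map_add, hf, hg, add_zero]
  | hs α t => rw [char_sg, if_neg fun h' => h (h'.trans (rel_sub α))]

/-- As α lies in the graph of the permutation of x, the point between i and p(i) can only be x(i).
So p lies in the composite of α and β exactly if α contains x restricted to the domain of p and β
contains p ∘ x⁻¹. -/
theorem char_hcomp (p : IS n) {x x' : a ⟶ b} {y y' : b ⟶ c} (f : x ⟶ x') (g : y ⟶ y') :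
    char p.graph (hcomp f g) = char (restr (lval x) p.dom).graph f *
      char (p * restr (lval x)⁻¹ Finset.univ).graph g := by
  refine Lin.ev_hcomp (fun α β => ?_) f g
  have h : p.graph ⊆ rel (hcomp α β) ↔ (restr (lval x) p.dom).graph ⊆ rel α ∧
      (p * restr (lval x)⁻¹ Finset.univ).graph ⊆ rel β := by
    rw [rel_hcomp]
    constructor
    · intro h
      constructor
      · rintro ⟨i, j⟩ hij
        obtain ⟨h1, h0⟩ : i ∈ p.dom ∧ lval x i = j := IS.mem_restr.1 hij
        subst h0
        obtain ⟨z, hz⟩ := IS.mem_dom.1 h1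
        obtain ⟨y, h2, -⟩ := h (IS.mem_graph.2 hz)
        have h3 : lval x i = y := (rel_sub α h2).1
        rwa [h3]
      · rintro ⟨i, j⟩ hij
        obtain ⟨l, h1, h2⟩ := IS.mem_mul.1 hij
        obtain ⟨-, h0⟩ : _ ∧ (lval x)⁻¹ i = l := IS.mem_restr.1 h1
        subst h0
        obtain ⟨y, h3, h4⟩ := h (IS.mem_graph.2 h2)
        have h5 : lval x ((lval x)⁻¹ i) = y := (rel_sub α h3).1
        rw [← Equiv.Perm.mul_apply, mul_inv_cancel, Equiv.Perm.one_apply] at h5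
        rwa [h5]
    · rintro ⟨h1, h2⟩ ⟨i, j⟩ hij
      exact ⟨lval x i, h1 (IS.mem_restr.2 ⟨IS.mem_dom.2 ⟨j, hij⟩, rfl⟩),
        h2 (IS.mem_mul.2 ⟨i, IS.mem_restr.2 ⟨Finset.mem_univ _, by simp⟩, hij⟩)⟩
  classical
  refine (if_congr h rfl rfl).trans ?_
  split_ifs <;> simp_all

instance (x y : a ⟶ b) : Finite (Lin.un x ⟶ Lin.un y) :=
  inferInstanceAs (Finite {α : SetRel (Fin n) (Fin n) // α ⊆ graph (lval x) ∩ graph (lval y)})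

theorem char_rel {x y : a ⟶ b} (f : (Lin.un x ⟶ Lin.un y) →₀ k) (r : SetRel (Fin n) (Fin n))
    [DecidablePred fun β : Lin.un x ⟶ Lin.un y => r ⊆ rel β] :
    char r (f : x ⟶ y) = f.sum fun β t => if r ⊆ rel β then t else 0 := by
  refine Eq.trans (b := f.sum fun β t => t * if r ⊆ rel β then 1 else 0) ?_ ?_
  · simp only [char, Lin.ev]
    refine (Finsupp.liftAddHom_apply _ _).trans ?_
    exact Finsupp.sum_congr fun β _ => by simp only [AddMonoidHom.mulRight_apply]; congr!
  · simp

/-- Triangularity: for a relation of maximal size in the support, its own functional sees no other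
coefficient. -/
theorem eq_zero_of_char {x y : a ⟶ b} (f : x ⟶ y) (h : ∀ p : IS n, char p.graph f = 0) :
    f = 0 := by
  classical
  by_contra hf
  let f' : (Lin.un x ⟶ Lin.un y) →₀ k := f
  have hne : f'.support.Nonempty := Finsupp.support_nonempty_iff.2 hf
  obtain ⟨α, hα, hmax⟩ := Finset.exists_max_image f'.support (fun α => (rel α).ncard) hne
  obtain ⟨p, hp⟩ := exists_graph_eq fun _ h => (rel_sub α h).1
  have h1 := h p
  rw [hp] at h1
  have h2 := (char_rel f' (rel α)).symm.trans h1
  rw [Finsupp.sum, Finset.sum_eq_single α] at h2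
  · rw [if_pos subset_rfl] at h2
    exact Finsupp.mem_support_iff.1 hα h2
  · intro β hβ hne
    rw [if_neg]
    intro hle
    exact hne (two_ext (Set.eq_of_subset_of_ncard_le hle (hmax β hβ) (Set.toFinite _)).symm)
  · exact fun h => absurd hα h

theorem eq_of_char {x y : a ⟶ b} {f g : x ⟶ y} (h : ∀ p : IS n, char p.graph f = char p.graph g) :
    f = g :=
  sub_eq_zero.1 (eq_zero_of_char _ fun p => by rw [map_sub, h, sub_self])

/-- The values form a square system indexed by the 2-morphisms x ⟶ y, so injectivity implies
surjectivity. -/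
theorem exists_char_eq {x y : a ⟶ b} (c : (Lin.un x ⟶ Lin.un y) → k) :
    ∃ f : x ⟶ y, ∀ α, char (rel α) f = c α := by
  classical
  have := Fintype.ofFinite (Lin.un x ⟶ Lin.un y)
  let Φ : ((Lin.un x ⟶ Lin.un y) →₀ k) →ₗ[k] ((Lin.un x ⟶ Lin.un y) → k) :=
    Finsupp.linearCombination k fun β α => if rel α ⊆ rel β then 1 else 0
  have hΦ : ∀ f α, Φ f α = char (rel α) (f : x ⟶ y) := by
    intro f α
    rw [char_rel f (rel α), Finsupp.linearCombination_apply, Finsupp.sum, Finsupp.sum,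
      Finset.sum_apply]
    simp
  have hinj : Function.Injective Φ := by
    rw [injective_iff_map_eq_zero]
    intro f hf
    refine eq_zero_of_char (f : x ⟶ y) fun p => ?_
    by_cases hp : p.graph ⊆ graph (lval x) ∩ graph (lval y)
    · rw [← show rel (⟨p.graph, hp⟩ : Lin.un x ⟶ Lin.un y) = p.graph from rfl, ← hΦ, hf]
      rfl
    · exact char_eq_zero hp _
  have hsurj := (LinearMap.injective_iff_surjective_of_finrank_eq_finrank (by simp)).1 hinj
  obtain ⟨f, hf⟩ := hsurj c
  exact ⟨f, fun α => (hΦ f α).symm.trans (congrFun hf α)⟩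

variable (a b) in
/-- The functionals `char p.graph` form a system as required for dimension vectors. -/
noncomputable def charSystem : CharSystem k (a ⟶ b) (IS n) where
  χ p _ _ := char p.graph
  map_comp p _ _ _ f g := char_comp p.graph f g
  full {x y} c hc := by
    classical
    choose p hp using fun α : Lin.un x ⟶ Lin.un y => exists_graph_eq fun _ h => (rel_sub α h).1
    obtain ⟨f, hf⟩ := exists_char_eq (x := x) (y := y) fun α => c (p α)
    refine ⟨f, fun q => ?_⟩
    by_cases hq : q.graph ⊆ graph (lval x) ∩ graph (lval y)
    · have h1 := hf ⟨q.graph, hq⟩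
      rwa [IS.graph_injective (hp ⟨q.graph, hq⟩)] at h1
    -- Outside the intersection the prescribed value is already zero, because the functional kills
    -- one of the two identities.
    · rw [char_eq_zero hq, ← hc q, char_id, char_id]
      rw [Set.subset_inter_iff, not_and_or] at hq
      rcases hq with hq | hq <;> rw [if_neg hq] <;> simp
  nil {M} f h := by
    -- The functionals are jointly injective, so there is no radical.
    have : f = 0 := Mat_.hom_ext _ _ fun i j => eq_zero_of_char _ fun p => h p i j
    rw [this]
    exact IsNilpotent.zero (R := End M)

end SymTwo

end SymmetricGroup

/-! ### Matrix entries of horizontal composites -/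

section Entries

open Bicategory KarAux

universe w v u

namespace AddEnv

variable {B : Type u} [Bicategory.{w, v} B] [LocallyPreadditive B] {a b : AddEnv B}

/-- The only entry of a 2-endomorphism of an identity 1-morphism. -/
def scal (u : 𝟙 a ⟶ 𝟙 a) : 𝟙 a.obj ⟶ 𝟙 a.obj := ent u PUnit.unit PUnit.unit

theorem scal_injective {u v : 𝟙 a ⟶ 𝟙 a} (h : scal u = scal v) : u = v :=
  Mat_.hom_ext _ _ fun _ _ => h

theorem scal_comp (u v : 𝟙 a ⟶ 𝟙 a) : scal (u ≫ v) = scal u ≫ scal v := by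
  refine (Mat_.comp_apply (M := un (𝟙 a)) (N := un (𝟙 a)) (K := un (𝟙 a)) u v _ _).trans ?_
  exact Fintype.sum_unique (ι := PUnit) fun _ => scal u ≫ scal v

/-- The identity 1-morphism has a one-point index set, so the action works entry by entry. Keeping a
unitor on each side avoids inverses when functionals are applied. -/
theorem ent_lact (u : 𝟙 a ⟶ 𝟙 a) {F F' : a ⟶ b} (f : F ⟶ F') (i : (un F).ι) (j : (un F').ι) :
    hcomp (scal u) (ent f i j) ≫ (λ_ ((un F').X j)).hom =
      (λ_ ((un F).X i)).hom ≫ ent (lact u f) i j := by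
  have h : hc u f ≫ (λ_ F').hom = (λ_ F).hom ≫ lact u f := by
    rw [← hcomp_eq]
    simp [lact]
  have h1 := congrFun (congrFun h (PUnit.unit, i)) j
  refine (MatAux.comp_mono (N := un (𝟙 a ≫ F')) (K := un F') (Equiv.punitProd (un F').ι)
    (fun p => (λ_ ((un F').X p.2)).hom) (hc u f) (PUnit.unit, i) (PUnit.unit, j)).symm.trans
    (h1.trans ?_)
  exact MatAux.mono_comp (M := un (𝟙 a ≫ F)) _ _ _ _ _

theorem ent_ract {F F' : a ⟶ b} (f : F ⟶ F') (u : 𝟙 b ⟶ 𝟙 b) (i : (un F).ι) (j : (un F').ι) :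
    hcomp (ent f i j) (scal u) ≫ (ρ_ ((un F').X j)).hom =
      (ρ_ ((un F).X i)).hom ≫ ent (ract f u) i j := by
  have h : hc f u ≫ (ρ_ F').hom = (ρ_ F).hom ≫ ract f u := by
    rw [← hcomp_eq]
    simp [ract]
  have h1 := congrFun (congrFun h (i, PUnit.unit)) j
  refine (MatAux.comp_mono (N := un (F' ≫ 𝟙 b)) (K := un F') (Equiv.prodPUnit (un F').ι)
    (fun p => (ρ_ ((un F').X p.1)).hom) (hc f u) (i, PUnit.unit) (j, PUnit.unit)).symm.trans
    (h1.trans ?_)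
  exact MatAux.mono_comp (M := un (F ≫ 𝟙 b)) _ _ _ _ _

end AddEnv

end Entries

/-! ### Values of the functionals on 2-morphisms cut by endomorphisms of identities -/

section SymmetricGroup

open Bicategory KarAux

namespace SymTwo

variable {k : Type*} [Field k] {n : ℕ}

section

variable {a b : Lin k (SymTwo n)}

theorem char_leftUnitor (p : IS n) (x : a ⟶ b) :
    char p.graph (λ_ x).hom = char p.graph (𝟙 x) := by
  classical
  rw [char_id]
  exact (char_sg _ _ _)

theorem char_rightUnitor (p : IS n) (x : a ⟶ b) :
    char p.graph (ρ_ x).hom = char p.graph (𝟙 x) := by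
  classical
  rw [char_id]
  exact (char_sg _ _ _)

/-- Applied to `g = lact u f`. The unitors contribute the value on an identity, which is absorbed,
and `char_hcomp` with the identity permutation on the left leaves p itself as the right piece. -/
theorem char_of_comm_left {x y : a ⟶ b} {f g : x ⟶ y} {u : 𝟙 a ⟶ 𝟙 a}
    (h : hcomp u f ≫ (λ_ y).hom = (λ_ x).hom ≫ g) (p : IS n) :
    char p.graph g = char (restr 1 p.dom).graph u * char p.graph f := by
  have h1 := congrArg (char p.graph) h
  rw [char_comp, char_comp, char_hcomp, char_leftUnitor, char_leftUnitor, ← char_comp,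
    Category.id_comp, mul_assoc] at h1
  have h2 : p * restr (lval (𝟙 a))⁻¹ Finset.univ = p := by
    refine IS.ext' fun i j => ?_
    rw [IS.mem_mul]
    constructor
    · rintro ⟨l, h1, h2⟩
      obtain rfl : i = l := (IS.mem_restr.1 h1).2
      exact h2
    · intro h
      exact ⟨i, IS.mem_restr.2 ⟨Finset.mem_univ _, rfl⟩, h⟩
  rw [h2, ← char_comp, Category.comp_id] at h1
  exact h1.symm

/-- Applied to `g = ract f u`. If p lies in the graph of x, the piece p ∘ x⁻¹ from `char_hcomp` is
the identity on the range of p; if p does not lie in both permutations, both sides vanish. -/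
theorem char_of_comm_right {x y : a ⟶ b} {f g : x ⟶ y} {u : 𝟙 b ⟶ 𝟙 b}
    (h : hcomp f u ≫ (ρ_ y).hom = (ρ_ x).hom ≫ g) (p : IS n) :
    char p.graph g = char p.graph f * char (restr 1 p.ran).graph u := by
  have h1 := congrArg (char p.graph) h
  rw [char_comp, char_comp, char_hcomp, char_rightUnitor, char_rightUnitor, ← char_comp,
    Category.id_comp] at h1
  by_cases hp : p.graph ⊆ graph (lval x) ∩ graph (lval y)
  · classical
    rw [Set.subset_inter_iff] at hp
    have h2 : restr (lval x) p.dom = p := graph_subset_graph_iff.1 hp.1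
    have h3 : p * restr (lval x)⁻¹ Finset.univ = restr 1 p.ran := by
      refine IS.ext' fun i j => ?_
      rw [IS.mem_mul, IS.mem_restr, IS.mem_ran]
      constructor
      · rintro ⟨l, h1, h3⟩
        obtain ⟨-, rfl⟩ := IS.mem_restr.1 h1
        have h4 : lval x ((lval x)⁻¹ i) = j := hp.1 (IS.mem_graph.2 h3)
        rw [← Equiv.Perm.mul_apply, mul_inv_cancel] at h4
        exact ⟨⟨_, by rwa [← h4] at h3⟩, h4⟩
      · rintro ⟨⟨l, hl⟩, rfl⟩
        have h4 : lval x l = i := hp.1 (IS.mem_graph.2 hl)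
        exact ⟨l, IS.mem_restr.2 ⟨Finset.mem_univ _, by rw [← h4]; simp⟩, hl⟩
    rw [h2, h3, char_id, if_pos hp.2, mul_one] at h1
    exact h1.symm
  · rw [char_eq_zero hp, char_eq_zero hp, zero_mul]

end

section

variable {a b : AddEnv (Lin k (SymTwo n))}

theorem char_cut (u : 𝟙 a ⟶ 𝟙 a) (v : 𝟙 b ⟶ 𝟙 b) {F F' : a ⟶ b} (f : F ⟶ F') (p : IS n)
    (i : (AddEnv.un F).ι) (j : (AddEnv.un F').ι) :
    char p.graph (AddEnv.ent (cut u v f) i j) = char (restr 1 p.dom).graph (AddEnv.scal u) *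
      char p.graph (AddEnv.ent f i j) * char (restr 1 p.ran).graph (AddEnv.scal v) := by
  unfold cut
  rw [char_of_comm_right (AddEnv.ent_ract (lact u f) v i j),
    char_of_comm_left (AddEnv.ent_lact u f i j)]

end

end SymTwo

end SymmetricGroup

/-! ### The splitting of the bicategory of the symmetric group -/

section SymmetricGroup

open Bicategory KarAux

/-- Matches the two pieces in `char_hcomp` with a composite of permutations. The second equation
alone determines q; the first is kept to fit that product. -/
theorem IS.eq_restr_mul_iff {n : ℕ} {q : IS n} {σ τ : Equiv.Perm (Fin n)} {X : Finset (Fin n)} :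
    q = restr (τ * σ) X ↔ restr σ q.dom = restr σ X ∧
      q * restr σ⁻¹ Finset.univ = restr τ (X.map σ.toEmbedding) := by
  have key : ∀ x y, y ∈ (q * restr σ⁻¹ Finset.univ) (σ x) ↔ y ∈ q x := by
    intro x y
    rw [IS.mem_mul]
    constructor
    · rintro ⟨z, h1, h2⟩
      obtain ⟨-, rfl⟩ := IS.mem_restr.1 h1
      simpa using h2
    · intro h
      exact ⟨x, IS.mem_restr.2 ⟨Finset.mem_univ _, by simp⟩, h⟩
  constructor
  · intro h
    refine ⟨by rw [h, IS.dom_restr], IS.ext' fun x y => ?_⟩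
    obtain ⟨x, rfl⟩ := σ.surjective x
    rw [key, h, IS.mem_restr, IS.mem_restr]
    simp
  · rintro ⟨-, h⟩
    refine IS.ext' fun x y => ?_
    rw [← key, h, IS.mem_restr, IS.mem_restr]
    simp

namespace SymTwo

variable {k : Type*} [Field k] {n : ℕ}

/-- The values of the functionals on a 2-endomorphism of an identity 1-morphism. -/
noncomputable def idChar {a : Kar (AddEnv (Lin k (SymTwo n)))} (Z : Finset (Fin n))
    (u : 𝟙 a ⟶ 𝟙 a) : k :=
  char (restr 1 Z).graph (AddEnv.scal (Kar.twoId u))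

section

variable {a : Kar (AddEnv (Lin k (SymTwo n)))}

/-- Only partial maps below the identity can give nonzero functionals on End(𝟙), so the values at
subsets are complete coordinates. -/
theorem idChar_ext {u v : 𝟙 a ⟶ 𝟙 a} (h : ∀ Z, idChar Z u = idChar Z v) : u = v := by
  refine Kar.two_ext (AddEnv.scal_injective (eq_of_char fun p => ?_))
  by_cases hp : p.graph ⊆ graph 1
  · rw [← graph_subset_graph_iff.1 hp]
    exact h p.dom
  · have hp' : ¬ p.graph ⊆ graph (lval (𝟙 a.obj.obj)) ∩ graph (lval (𝟙 a.obj.obj)) :=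
      fun h' => hp (h'.trans Set.inter_subset_left)
    exact (char_eq_zero hp' _).trans (char_eq_zero hp' _).symm

theorem idChar_comp (Z : Finset (Fin n)) (u v : 𝟙 a ⟶ 𝟙 a) :
    idChar Z (u ≫ v) = idChar Z u * idChar Z v := by
  refine (congrArg (char (restr 1 Z).graph) (AddEnv.scal_comp (Kar.twoId u) (Kar.twoId v))).trans ?_
  exact char_comp _ _ _

theorem idChar_zero (Z : Finset (Fin n)) : idChar Z (0 : 𝟙 a ⟶ 𝟙 a) = 0 :=
  map_zero (char (k := k) (restr 1 Z).graph)

/-- The functional of id_Z takes the value 1 on id_Y exactly if Z ⊆ Y, and the signs in `eps`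
perform the Möbius inversion. -/
theorem idChar_eps (X Z : Finset (Fin n)) : idChar Z (eps k n X) = if Z = X then 1 else 0 := by
  classical
  rw [← altSum_superset]
  refine (map_sum (char (restr 1 Z).graph) _ _).trans (Finset.sum_congr rfl fun Y _ => ?_)
  refine (char_sg _ _ _).trans ?_
  have h : (restr 1 Z).graph ⊆ rel (idOn Y) ↔ Z ⊆ Y := by
    constructor
    · intro h x hx
      exact (h (IS.mem_graph.2 (IS.mem_restr.2 ⟨hx, rfl⟩))).2
    · rintro h ⟨x, y⟩ hxy
      obtain ⟨h1, h2⟩ := IS.mem_restr.1 hxy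
      exact ⟨h2, h h1⟩
  refine (if_congr h rfl rfl).trans ?_
  split_ifs with hZ
  · simp [hZ]
  · simp [hZ]

theorem idChar_eq_zero_or_one {u : 𝟙 a ⟶ 𝟙 a} (hu : u ≫ u = u) (Z : Finset (Fin n)) :
    idChar Z u = 0 ∨ idChar Z u = 1 := by
  have h := idChar_comp Z u u
  rw [hu] at h
  have h1 : idChar Z u * (idChar Z u - 1) = 0 := by linear_combination -h
  exact (mul_eq_zero.1 h1).imp_right sub_eq_zero.1

end

/-- In the coordinates `idChar` composition is pointwise, idempotents are 0-1 functions, and `eps`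
is the indicator of a point. -/
theorem isPrimitive_eps (X : Finset (Fin n)) : IsPrimitive (eps k n X) where
  idem := idChar_ext fun Z => by
    rw [idChar_comp, idChar_eps]
    simp
  ne_zero h := by
    have h1 := idChar_eps (k := k) X X
    rw [h, idChar_zero, if_pos rfl] at h1
    exact zero_ne_one h1
  minimal f hf hef _ := by
    have key : ∀ Z, Z ≠ X → idChar Z f = 0 := fun Z hZ => by
      rw [← hef, idChar_comp, idChar_eps, if_neg hZ, zero_mul]
    rcases idChar_eq_zero_or_one hf X with h | h
    · left
      refine idChar_ext fun Z => ?_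
      rw [idChar_zero]
      by_cases hZ : Z = X
      · rw [hZ, h]
      · exact key Z hZ
    · right
      refine idChar_ext fun Z => ?_
      rw [idChar_eps]
      by_cases hZ : Z = X
      · rw [hZ, h, if_pos rfl]
      · rw [if_neg hZ, key Z hZ]

theorem bijective_splitObj (hp : ∀ X : Finset (Fin n), IsPrimitive (eps k n X)) :
    Function.Bijective (splitObj hp) := by
  constructor
  · intro X Y h
    have h1 : eps k n X = eps k n Y := by
      simpa [splitObj] using h
    have h2 := idChar_eps (k := k) X Y
    rw [h1, idChar_eps, if_pos rfl] at h2
    by_contra hne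
    rw [if_neg (Ne.symm hne)] at h2
    exact one_ne_zero h2
  · rintro ⟨⟨⟨⟨⟨⟩⟩⟩⟩, e, he⟩
    obtain ⟨X, hX⟩ : ∃ X, idChar X e ≠ 0 := by
      by_contra! h
      exact he.ne_zero (idChar_ext fun Z => by rw [h Z, idChar_zero])
    have hX1 := (idChar_eq_zero_or_one he.idem X).resolve_left hX
    have key : ∀ Z, (if Z = X then (1 : k) else 0) * idChar Z e = if Z = X then 1 else 0 := by
      intro Z
      by_cases hZ : Z = X
      · rw [hZ, hX1, mul_one]
      · rw [if_neg hZ, zero_mul]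
    -- As `e` has value 1 at X, the idempotent `eps k n X` lies below it, and minimality of `e`
    -- gives equality.
    have h1 : eps k n X = e := by
      refine (he.minimal (eps k n X) (hp X).idem ?_ ?_).resolve_left (hp X).ne_zero
      · exact idChar_ext fun Z => by rw [idChar_comp, idChar_eps, mul_comm, key]
      · exact idChar_ext fun Z => by rw [idChar_comp, idChar_eps, key]
    refine ⟨X, ?_⟩
    subst h1
    rfl

/-- The multiplicities of the partial injective maps in a 1-morphism of the splitting. -/
noncomputable def mult {a b : SplitFin2 k (SymTwo n)} (F : a ⟶ b) : IS n → ℕ :=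
  (charSystem a.obj.obj.obj b.obj.obj.obj).dim (Split.embed a b) F

variable (hp : ∀ X : Finset (Fin n), IsPrimitive (eps k n X))

/-- By `char_cut` and `idChar_eps`, cutting multiplies the value at p by the indicators of dom p = X
and ran p = Y. -/
theorem char_idp {X Y : Finset (Fin n)} (F : splitObj hp X ⟶ splitObj hp Y) (p : IS n)
    (i j : (AddEnv.un (Kar.un F.mor).X).ι) :
    char p.graph (AddEnv.ent (Split.idp F) i j) =
      if p.dom = X ∧ p.ran = Y then char p.graph (AddEnv.ent (Kar.un F.mor).p i j) else 0 := by
  refine (char_cut _ _ _ p i j).trans ?_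
  refine (congrArg₂ (fun x y => x * _ * y) (idChar_eps X p.dom) (idChar_eps Y p.ran)).trans ?_
  by_cases h1 : p.dom = X <;> by_cases h2 : p.ran = Y <;> simp [h1, h2]

theorem dom_ran_of_mult_ne_zero {X Y : Finset (Fin n)} {F : splitObj hp X ⟶ splitObj hp Y}
    {p : IS n} (h : mult F p ≠ 0) : p.dom = X ∧ p.ran = Y := by
  by_contra h'
  exact h (CharSystem.dim_eq_zero _ _ fun i j => (char_idp hp F p i j).trans (if_neg h'))

open scoped Classical in
theorem mult_of_unique {a b : SplitFin2 k (SymTwo n)} (F : a ⟶ b)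
    [Unique (AddEnv.un (Kar.un F.mor).X).ι] (p : IS n) (h : ∀ (q : IS n) i,
      char q.graph (AddEnv.ent (Split.idp F) i i) = if q = p then 1 else 0) :
    mult F = Pi.single p 1 := by
  funext q
  by_cases hq : q = p
  · rw [hq, Pi.single_eq_same]
    have : Unique ((Split.embed a b).obj F).X.ι :=
      inferInstanceAs (Unique (AddEnv.un (Kar.un F.mor).X).ι)
    exact CharSystem.dim_eq_one _ _ fun i => (h p i).trans (if_pos rfl)
  · rw [Pi.single_eq_of_ne hq]
    refine CharSystem.dim_eq_zero _ _ fun i j => ?_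
    rw [Subsingleton.elim (α := (AddEnv.un (Kar.un F.mor).X).ι) j i]
    exact (h q i).trans (if_neg hq)

instance (X Y : Finset (Fin n)) (σ : Equiv.Perm (Fin n)) :
    Unique (AddEnv.un (Kar.un (splitMor hp X Y σ).mor).X).ι := inferInstanceAs (Unique PUnit)

-- Uncut, the identity of σ has value 1 at every restriction of σ; the cut leaves only the one with
-- domain X.
open scoped Classical in
theorem char_idp_splitMor {X Y : Finset (Fin n)} {σ : Equiv.Perm (Fin n)}
    (hσ : X.map σ.toEmbedding = Y) (q : IS n)
    (i : (AddEnv.un (Kar.un (splitMor hp X Y σ).mor).X).ι) :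
    char q.graph (AddEnv.ent (Split.idp (splitMor hp X Y σ)) i i) =
      if q = restr σ X then (1 : k) else 0 := by
  have h1 : char q.graph (AddEnv.ent (Kar.un (splitMor hp X Y σ).mor).p i i) =
      if q.graph ⊆ graph σ then (1 : k) else 0 := by
    refine (congrArg (char q.graph) (Mat_.id_apply_self _ i)).trans ?_
    exact char_id _ _
  have h2 : (q.dom = X ∧ q.ran = Y) ∧ restr σ q.dom = q ↔ q = restr σ X := by
    constructor
    · rintro ⟨⟨rfl, -⟩, h⟩
      exact h.symm
    · rintro rfl
      rw [IS.dom_restr, IS.ran_restr]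
      exact ⟨⟨rfl, hσ⟩, rfl⟩
  rw [char_idp, h1, graph_subset_graph_iff]
  split_ifs <;> first | rfl | tauto

open scoped Classical in
theorem mult_splitMor {X Y : Finset (Fin n)} {σ : Equiv.Perm (Fin n)}
    (hσ : X.map σ.toEmbedding = Y) : mult (splitMor hp X Y σ) = Pi.single (restr σ X) 1 :=
  mult_of_unique _ _ (char_idp_splitMor hp hσ)

-- The idempotent of a composite is the horizontal composite of the two idempotents, so `char_hcomp`
-- gives a product of two indicators.
open scoped Classical in
theorem mult_splitMor_comp_splitMor {X Y Z : Finset (Fin n)} {σ τ : Equiv.Perm (Fin n)}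
    (hσ : X.map σ.toEmbedding = Y) (hτ : Y.map τ.toEmbedding = Z) :
    mult (splitMor hp X Y σ ≫ splitMor hp Y Z τ) = Pi.single (restr (τ * σ) X) 1 := by
  have : Unique (AddEnv.un (Kar.un (splitMor hp X Y σ ≫ splitMor hp Y Z τ).mor).X).ι :=
    Unique.mk' (PUnit × PUnit)
  refine mult_of_unique _ _ fun q i => ?_
  have h1 : AddEnv.ent (Split.idp (splitMor hp X Y σ ≫ splitMor hp Y Z τ)) i i =
      hcomp (AddEnv.ent (Split.idp (splitMor hp X Y σ)) i.1 i.1)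
        (AddEnv.ent (Split.idp (splitMor hp Y Z τ)) i.2 i.2) := by
    rw [Split.idp_comp, AddEnv.hcomp_eq]
    rfl
  refine (congrArg (char q.graph) h1).trans ((char_hcomp q _ _).trans ?_)
  refine (congrArg₂ (· * ·) (char_idp_splitMor hp hσ _ _) (char_idp_splitMor hp hτ _ _)).trans ?_
  refine (ite_zero_mul_ite_zero _ _ _ _).trans ?_
  rw [mul_one, ← hσ]
  exact if_congr (IS.eq_restr_mul_iff (q := q)).symm rfl rfl

theorem isDimVector_mult (a b : SplitFin2 k (SymTwo n)) :
    IsDimVector (mult : (a ⟶ b) → IS n → ℕ) :=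
  CharSystem.isDimVector _ _ fun {F p} hF => by
    classical
    obtain ⟨X, rfl⟩ := (bijective_splitObj isPrimitive_eps).2 a
    obtain ⟨Y, rfl⟩ := (bijective_splitObj isPrimitive_eps).2 b
    -- A coordinate that occurs fits the two objects, so any permutation extending p realizes its
    -- unit vector there.
    obtain ⟨rfl, rfl⟩ := dom_ran_of_mult_ne_zero isPrimitive_eps (F := F) hF
    obtain ⟨σ, hσ⟩ := IS.exists_restr_eq p
    have h := mult_splitMor isPrimitive_eps (k := k) (X := p.dom) (Y := p.ran) (σ := σ)
      (by rw [← IS.ran_restr, hσ])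
    rw [hσ] at h
    exact ⟨splitMor isPrimitive_eps p.dom p.ran σ, (congrFun h p).trans (Pi.single_eq_same _ _),
      fun q hq => (congrFun h q).trans (Pi.single_eq_of_ne hq _)⟩

-- The vector already determines the source and the target, through the domain and range of the
-- partial map, so F may start between arbitrary objects.
open scoped Classical in
theorem cls_eq_cls_splitMor {a b : SplitFin2 k (SymTwo n)} (F : a ⟶ b) {X Y : Finset (Fin n)}
    {σ : Equiv.Perm (Fin n)} (hσ : X.map σ.toEmbedding = Y)
    (hF : mult F = Pi.single (restr σ X) 1) :
    Groth.cls F = Groth.cls (splitMor hp X Y σ) := by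
  obtain ⟨X', rfl⟩ := (bijective_splitObj hp).2 a
  obtain ⟨Y', rfl⟩ := (bijective_splitObj hp).2 b
  obtain ⟨h1, h2⟩ := dom_ran_of_mult_ne_zero hp (F := F) (p := restr σ X) (by rw [hF]; simp)
  rw [IS.dom_restr] at h1
  rw [IS.ran_restr, hσ] at h2
  subst h1 h2
  obtain ⟨e⟩ := (isDimVector_mult _ _).iso (hF.trans (mult_splitMor hp hσ).symm)
  exact congrArg (Groth.incl _ _) (K0.of_iso e)

theorem cls_mul_cls {X Y Z : Finset (Fin n)} {σ τ : Equiv.Perm (Fin n)}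
    (hσ : X.map σ.toEmbedding = Y) (hτ : Y.map τ.toEmbedding = Z) :
    Groth.cls (splitMor hp Y Z τ) * Groth.cls (splitMor hp X Y σ) =
      Groth.cls (splitMor hp X Z (τ * σ)) := by
  refine (Groth.incl_mul_incl _ _).trans ?_
  rw [K0.comp_of]
  refine cls_eq_cls_splitMor hp _ ?_ (mult_splitMor_comp_splitMor hp hσ hτ)
  rw [← hτ, ← hσ, Finset.map_map]
  rfl

/-- Each p in `IS n` is represented by one chosen permutation extending it, taken between the
objects of its domain and range, and is sent to its Möbius element. -/
theorem exists_ringEquiv : ∃ φ : Groth (SplitFin2 k (SymTwo n)) ≃+* MonoidAlgebra ℤ (IS n),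
    ∀ (X Y : Finset (Fin n)) (σ : Equiv.Perm (Fin n)), X.map σ.toEmbedding = Y →
      φ (Groth.cls (splitMor hp X Y σ)) = moebius (restr σ X) := by
  classical
  have := Fintype.ofFinite (IS n)
  obtain ⟨M, hM⟩ := IS.exists_moebius_equiv (n := n)
  choose σ hσ using IS.exists_restr_eq (n := n)
  have hmap : ∀ p : IS n, p.dom.map (σ p).toEmbedding = p.ran := fun p => by
    rw [← IS.ran_restr, hσ]
  have hmult : ∀ p : IS n, mult (splitMor hp p.dom p.ran (σ p)) = Pi.single p 1 := fun p => by
    rw [mult_splitMor hp (hmap p), hσ]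
  obtain ⟨φ, hφ⟩ := Groth.exists_ringEquiv (B := SplitFin2 k (SymTwo n)) (fun F => mult F)
    isDimVector_mult (fun p => splitObj hp p.dom) (fun p => splitObj hp p.ran)
    (fun p => splitMor hp p.dom p.ran (σ p)) (fun p => by convert hmult p)
    (fun F p hF => cls_eq_cls_splitMor hp F (hmap p) (by rw [hF, hσ]; congr!)) M (fun p q => by
      rw [hM, hM]
      by_cases h : q.ran = p.dom
      -- This partial map is the product of p and q.
      · refine Or.inr ⟨restr (σ p * σ q) q.dom, ?_, ?_⟩
        · have h1 : Groth.cls (splitMor hp q.dom q.ran (σ q)) =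
              Groth.cls (splitMor hp q.dom p.dom (σ q)) := by rw [h]
          have h2 : q.dom.map (σ p * σ q).toEmbedding = p.ran := by
            rw [← hmap p, ← h, ← hmap q, Finset.map_map]
            rfl
          refine (congrArg _ h1).trans ((cls_mul_cls hp ((hmap q).trans h) (hmap p)).trans ?_)
          exact cls_eq_cls_splitMor hp _ (hmap _) (by rw [hσ]; exact mult_splitMor hp h2)
        · rw [hM]
          have h1 := IS.moebius_mul_moebius (σ p) (σ q) q.dom q.dom
          rwa [hmap, h, hσ, hσ, if_pos rfl] at h1
      -- Distinct subsets give distinct objects, so the two 1-morphisms are not composable.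
      · refine Or.inl ⟨?_, IS.moebius_mul_of_ne h⟩
        exact Groth.incl_mul_incl_ne (fun h' => h ((bijective_splitObj hp).1 h')) _ _)
  refine ⟨φ, fun X Y τ hτ => ?_⟩
  -- The chosen extension is immaterial: any τ with the same restriction has the same vector and
  -- hence the same class.
  rw [← hM, ← hφ]
  exact congrArg φ (cls_eq_cls_splitMor hp _ (hmap _)
    (by rw [hσ]; exact mult_splitMor hp hτ))

end SymTwo

end SymmetricGroup

/-! ### Indecomposable 1-morphisms of the splitting and their isomorphism classes -/

namespace SymTwo

variable {k : Type*} [Field k] {n : ℕ} (hp : ∀ X : Finset (Fin n), IsPrimitive (eps k n X))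

theorem indecomposable_splitMor {X Y : Finset (Fin n)} {σ : Equiv.Perm (Fin n)}
    (hσ : X.map σ.toEmbedding = Y) : Indecomposable (splitMor hp X Y σ) := by
  refine (isDimVector_mult _ _).indecomposable (t := restr σ X) (fun t ht => ?_) ?_
  · by_contra h
    exact ht ((congrFun (mult_splitMor hp hσ) t).trans (Pi.single_eq_of_ne h _))
  · exact (congrFun (mult_splitMor hp hσ) _).trans (Pi.single_eq_same _ _)

theorem nonempty_iso_iff {X Y : Finset (Fin n)} {σ τ : Equiv.Perm (Fin n)}
    (hσ : X.map σ.toEmbedding = Y) (hτ : X.map τ.toEmbedding = Y) :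
    Nonempty (splitMor hp X Y σ ≅ splitMor hp X Y τ) ↔ restr σ X = restr τ X := by
  constructor
  · rintro ⟨e⟩
    have h := (isDimVector_mult _ _).of_iso e
    rw [mult_splitMor hp hσ, mult_splitMor hp hτ] at h
    by_contra hne
    have h1 := congrFun h (restr σ X)
    rw [Pi.single_eq_same, Pi.single_eq_of_ne hne] at h1
    exact one_ne_zero h1
  · intro h
    exact (isDimVector_mult _ _).iso (by rw [mult_splitMor hp hσ, mult_splitMor hp hτ, h])

theorem exists_iso_splitMor {X Y : Finset (Fin n)} (F : splitObj hp X ⟶ splitObj hp Y)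
    (hF : Indecomposable F) :
    ∃ σ : Equiv.Perm (Fin n), X.map σ.toEmbedding = Y ∧ Nonempty (F ≅ splitMor hp X Y σ) := by
  have := Fintype.ofFinite (IS n)
  obtain ⟨p, h⟩ := (isDimVector_mult _ _).exists_single_of_indecomposable hF
  obtain ⟨rfl, rfl⟩ := dom_ran_of_mult_ne_zero hp (F := F) (p := p) (by rw [h]; simp)
  obtain ⟨σ, hσ⟩ := IS.exists_restr_eq p
  have hmap : p.dom.map σ.toEmbedding = p.ran := by rw [← IS.ran_restr, hσ]
  exact ⟨σ, hmap, (isDimVector_mult _ _).iso (by rw [h, mult_splitMor hp hmap, hσ]; congr!)⟩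

end SymTwo

end Decat

theorem theorem5p1 (k : Type*) [Field k] (n : ℕ) (hn : 1 ≤ n) :
    (∃ hp : ∀ X : Finset (Fin n), IsPrimitive (eps k n X),
      Function.Bijective (splitObj hp) ∧
      ∃ φ : Groth (SplitFin2 k (SymTwo n)) ≃+* MonoidAlgebra ℤ (IS n),
        (∀ (X Y : Finset (Fin n)) (σ : Equiv.Perm (Fin n)), X.map σ.toEmbedding = Y →
          Indecomposable (splitMor hp X Y σ) ∧
            φ (Groth.cls (splitMor hp X Y σ)) = moebius (restr σ X)) ∧
        (∀ (X Y : Finset (Fin n)) (σ τ : Equiv.Perm (Fin n)),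
          X.map σ.toEmbedding = Y → X.map τ.toEmbedding = Y →
            (Nonempty (splitMor hp X Y σ ≅ splitMor hp X Y τ) ↔ restr σ X = restr τ X)) ∧
        (∀ (X Y : Finset (Fin n)) (F : splitObj hp X ⟶ splitObj hp Y), Indecomposable F →
          ∃ σ : Equiv.Perm (Fin n), X.map σ.toEmbedding = Y ∧
            Nonempty (F ≅ splitMor hp X Y σ))) ∧
    (∃ ψ : Groth (Fin2 k (OrdTwo (IS n))) ≃+* MonoidAlgebra ℤ (IS n),
      (∀ s : IS n, Indecomposable (ordMor k s) ∧
        ψ (Groth.cls (ordMor k s)) = MonoidAlgebra.single s 1) ∧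
      (∀ F : Fin2.obj k (OrdTwo.pt : OrdTwo (IS n)) ⟶ Fin2.obj k OrdTwo.pt, Indecomposable F →
        ∃ s : IS n, Nonempty (F ≅ ordMor k s))) := by
  refine ⟨⟨SymTwo.isPrimitive_eps, SymTwo.bijective_splitObj _, ?_⟩, ?_⟩
  · obtain ⟨φ, hφ⟩ := SymTwo.exists_ringEquiv (k := k) (n := n) SymTwo.isPrimitive_eps
    exact ⟨φ, fun X Y σ h => ⟨SymTwo.indecomposable_splitMor _ h, hφ X Y σ h⟩,
      fun X Y σ τ hσ hτ => SymTwo.nonempty_iso_iff _ hσ hτ,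
      fun X Y F hF => SymTwo.exists_iso_splitMor _ F hF⟩
  · obtain ⟨ψ, hψ⟩ := OrdTwo.exists_ringEquiv k (IS n)
    exact ⟨ψ, fun s => ⟨OrdTwo.indecomposable_elt k s, hψ s⟩,
      fun F hF => OrdTwo.exists_iso_elt k F hF⟩
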